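/- **Proposition 5.3 (Green's function for arbitrary point interactions).** Write $\dot{\mathbb R}=\mathbb R\setminus\{0\}$, and let $\sqrt{\cdot}$ be the principal square root. *The function $G$.* Every unitary $2\times2$ matrix $J$ can be written as $$J=e^{i\phi}\begin{pmatrix}\alpha&-\overline\beta\\ \beta&\overline\alpha\end{pmatrix},\qquad \phi\in[0,\pi),\ \alpha,\beta\in\mathbb C,\ |\alpha|^2+|\beta|^2=1.$$ For such parameters, with $\Lambda(z)=e^{z^2}(1-\operatorname{erf}(z))$ and $\operatorname{erf}(z)=\frac{2}{\sqrt\pi}\int_0^z e^{-w^2}dw$, put for $t>0$, $x,y\in\dot{\mathbb R}$ $$G(t,x,y)=\sum_{\pm}\mu_\pm^{(x,y)}\,\Lambda\Big(\tfrac{|x|+|y|}{2\sqrt{it}}+\omega_\pm\sqrt{it}\Big)e^{-\frac{(|x|+|y|)^2}{4it}}+\frac{\mu_0^{(x,y)}}{2\sqrt{i\pi t}}e^{-\frac{(|x|+|y|)^2}{4it}}+\frac{1}{2\sqrt{i\pi t}}e^{-\frac{(x-y)^2}{4it}}.$$ Here $\eta^{(x,y)}=0$ if $|\operatorname{Re}\alpha|=1$,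 and otherwise $\eta^{(x,y)}$ is $\frac{1}{\sqrt{1-(\operatorname{Re}\alpha)^2}}$ times $-\operatorname{Im}\alpha$ if $x,y>0$, $-i\overline\beta$ if $x>0>y$, $i\beta$ if $x<0<y$, $\operatorname{Im}\alpha$ if $x,y<0$. With $\Theta$ the Heaviside function: - Case I, $\operatorname{Re}\alpha\ne-\cos\phi$: $\ \omega_\pm=\frac{-\sin\phi\pm\sqrt{1-(\operatorname{Re}\alpha)^2}}{\cos\phi+\operatorname{Re}\alpha}$, $\ \mu_\pm^{(x,y)}=-\frac{\omega_\pm}{2}\big(\Theta(xy)\pm\eta^{(x,y)}\big)$, $\ \mu_0^{(x,y)}=\operatorname{sgn}(xy)$. - Case II, $\operatorname{Re}\alpha=-\cos\phi\ne-1$: $\ \omega_-=\mu_-^{(x,y)}=0$, $\ \omega_+=\cot\phi$, $\ \mu_+^{(x,y)}=-\frac{\omega_+}{2}\big(\Theta(xy)+\eta^{(x,y)}\big)$, $\ \mu_0^{(x,y)}=\eta^{(x,y)}-\Theta(-xy)$. - Case III, $\operatorname{Re}\alpha=-\cos\phi=-1$: $\ \omega_\pm=\mu_\pm^{(x,y)}=0$,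 $\ \mu_0^{(x,y)}=-1$. *Claim.* Let $J$ be unitary, $(\phi,\alpha,\beta)$ any parameters representing it as above, $G$ the corresponding function, and $T\in(0,\infty]$. Put $V=0$, $M=I-J$, $N=i(I+J)$. Then $G$ satisfies the following assumptions on $(0,T)$ with respect to $V,M,N$. There is $\theta\in(0,\frac\pi2)$ such that, with $S_\theta=\{z\in\mathbb C\setminus\{0\}:\operatorname{Arg}z\in[0,\theta]\cup[\pi,\pi+\theta]\}$, $G$ has a continuation $G:(0,T)\times\dot{\mathbb R}\times S_\theta\to\mathbb C$ for which every $G(t,x,\cdot)$ is continuous on $S_\theta$ and holomorphic on $\operatorname{int}S_\theta$, and: 1. For every $z\in S_\theta$: $G(\cdot,x,z)\in\operatorname{AC}((0,T))$ for all $x\in\dot{\mathbb R}$; $G(t,\cdot,z)$ is differentiable on $\dot{\mathbb R}$ and it and $\partial_xG(t,\cdot,z)$ are in $\operatorname{AC}((-\infty,0))$ and $\operatorname{AC}((0,\infty))$ for all $t\in(0,T)$; and $i\partial_tG=(-\partial_x^2+V)G$ for almost every $(t,x)\in(0,T)\times\dot{\mathbb R}$. Here $f\in\operatorname{AC}(I)$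 means $f(y)-f(x)=\int_x^yg(s)\,ds$ on $I$ for some $g\in L^1_{\rm loc}(I)$. For all $t\in(0,T)$, $y\in\dot{\mathbb R}$ the one-sided limits below exist and $$M\begin{pmatrix}G(t,0^+,y)\\G(t,0^-,y)\end{pmatrix}=N\begin{pmatrix}G_x(t,0^+,y)\\-G_x(t,0^-,y)\end{pmatrix}.$$ 2. For every $x\in\dot{\mathbb R}$ there is $x_0>|x|$ such that, for all $\varphi\in C^\infty([-x_0,x_0])$, $G(t,x,\cdot)\varphi$ is integrable on $[-x_0,x_0]$ for all $t\in(0,T)$ and $\lim_{t\to0^+}\int_{-x_0}^{x_0}G(t,x,y)\varphi(y)\,dy=\varphi(x)$. 3. There are $a\in\operatorname{AC}((0,T))$ with $a>0$ and $\lim_{t\to0^+}a(t)=\infty$, an exponent $p\in(0,2)$, and continuous $A_j,B_j:(0,T)\times\dot{\mathbb R}\to[0,\infty)$, $j=0,1,2$, such that for $\widetilde G(t,x,z)=e^{-ia(t)(z-x)^2}G(t,x,z)$ and all $t\in(0,T)$, $x\in\dot{\mathbb R}$, $z\in S_\theta$ the derivatives below exist and $$|\widetilde G|\le A_0e^{B_0|z|^p},\qquad|\partial_x\widetilde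 G|\le A_1e^{B_1|z|^p},\qquad|\partial_x^2\widetilde G|,\ |\partial_t\widetilde G|\le A_2e^{B_2|z|^p}$$ (with $A_j,B_j$ taken at $(t,x)$). For every $x\in\dot{\mathbb R}$, $A_0(t,x)/\sqrt{a(t)}$ and $B_0(t,x)$ are bounded as $t\to0^+$. For every $t\in(0,T)$: if $M\ne0$ or $N\ne0$, then $A_0(t,\cdot),B_0(t,\cdot)$ are bounded as $x\to0^\pm$; if $N\ne0$, then also $A_1(t,\cdot),B_1(t,\cdot)$ are. *Special cases.* Each of the following conditions on boundary values $u_\pm=\Psi(t,0^\pm)$ and derivatives $d_\pm=\Psi_x(t,0^\pm)$ is equivalent, for a suitable unitary $J$, to $(I-J)(u_+,u_-)^{\mathsf T}=i(I+J)(d_+,-d_-)^{\mathsf T}$: the $\delta$-condition $u_+=u_-$, $d_+-d_-=cu_+$ ($c\in\mathbb R$); the $\delta'$-condition $d_+=d_-$, $u_+-u_-=cd_+$ ($c\in\mathbb R$); Dirichlet $u_\pm=0$; Neumann $d_\pm=0$; Robin $d_+=au_+$, $d_-=bu_-$ ($a,b\in\mathbb R$). -/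

import Mathlib

open MeasureTheory Filter Topology Set
open scoped Matrix ContDiff ComplexConjugate

namespace PointInteraction

noncomputable section

/-! ### Absolutely continuous functions and the Schrödinger equation off the origin -/

/-- The time interval `(0, T)`, where `T ∈ (0, ∞]`. -/
def timeInterval (T : EReal) : Set ℝ := {t | 0 < t ∧ (t : EReal) < T}

/-- The punctured real line. -/
def puncturedLine : Set ℝ := {x | x ≠ 0}

/-- `f ∈ AC(I)` for an open interval `I`: `f` is an indefinite integral of a function in
`L¹_loc(I)`. -/
def IsAC {E : Type*} [NormedAddCommGroup E] [NormedSpace ℝ E] (f : ℝ → E) (I : Set ℝ) : Prop :=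
  ∃ g : ℝ → E, LocallyIntegrableOn g I volume ∧
    ∀ x ∈ I, ∀ y ∈ I, f y - f x = ∫ s in x..y, g s

/-- `f ∈ AC(ℝ \ {0})`: absolutely continuous on each of the two half-lines. -/
def IsACPunctured (f : ℝ → ℂ) : Prop := IsAC f (Iio 0) ∧ IsAC f (Ioi 0)

/-- The space `AC_{1,2}((0,T) × (ℝ \ {0}))`. -/
def IsAC12 (T : EReal) (Ψ : ℝ → ℝ → ℂ) : Prop :=
  (∀ x ∈ puncturedLine, IsAC (fun t => Ψ t x) (timeInterval T)) ∧
  (∀ t ∈ timeInterval T,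
    (∀ x ∈ puncturedLine, DifferentiableAt ℝ (Ψ t) x) ∧
    IsACPunctured (Ψ t) ∧ IsACPunctured (deriv (Ψ t)))

/-- `i ∂Ψ/∂t = (-∂²/∂x² + V) Ψ` for almost every `(t, x) ∈ (0,T) × (ℝ \ {0})`; the existence of
the two derivatives at almost every point is part of the condition. -/
def SolvesSchrodinger (T : EReal) (V Ψ : ℝ → ℝ → ℂ) : Prop :=
  ∀ᵐ q : ℝ × ℝ, q.1 ∈ timeInterval T → q.2 ∈ puncturedLine →
    ∃ Ψt Ψxx : ℂ, HasDerivAt (fun s => Ψ s q.2) Ψt q.1 ∧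
      HasDerivAt (deriv (Ψ q.1)) Ψxx q.2 ∧
      Complex.I * Ψt = -Ψxx + V q.1 q.2 * Ψ q.1 q.2

/-- The linear relation `M (u₊, u₋)ᵀ = N (d₊, -d₋)ᵀ` between boundary values `u₊, u₋` and
boundary derivatives `d₊, d₋` at `0⁺, 0⁻`. -/
def BoundaryRelation (M N : Matrix (Fin 2) (Fin 2) ℂ) (uP uM dP dM : ℂ) : Prop :=
  M *ᵥ ![uP, uM] = N *ᵥ ![dP, -dM]

/-- The one-sided limits `f(0⁺), f(0⁻), f'(0⁺), f'(0⁻)` exist and satisfy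
`M (f(0⁺), f(0⁻))ᵀ = N (f'(0⁺), -f'(0⁻))ᵀ`. -/
def TransmissionCondition (M N : Matrix (Fin 2) (Fin 2) ℂ) (f : ℝ → ℂ) : Prop :=
  ∃ uP uM dP dM : ℂ,
    Tendsto f (𝓝[>] 0) (𝓝 uP) ∧ Tendsto f (𝓝[<] 0) (𝓝 uM) ∧
    Tendsto (deriv f) (𝓝[>] 0) (𝓝 dP) ∧ Tendsto (deriv f) (𝓝[<] 0) (𝓝 dM) ∧
    BoundaryRelation M N uP uM dP dM

/-! ### The assumptions on a Green's function -/

/-- The double sector `{z ≠ 0 : Arg z ∈ [0, θ] ∪ [π, π + θ]}`. As `Complex.arg` takes values in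
`(-π, π]`, the second half is written as `Arg (-z) ∈ [0, θ]`. -/
def doubleSector (θ : ℝ) : Set ℂ :=
  {z | z ≠ 0 ∧ (Complex.arg z ∈ Icc 0 θ ∨ Complex.arg (-z) ∈ Icc 0 θ)}

/-- The factor `G̃` in `G(t,x,z) = exp(i a(t) (z - x)²) G̃(t,x,z)`. -/
def reducedGreen (a : ℝ → ℝ) (G : ℝ → ℝ → ℂ → ℂ) (t x : ℝ) (z : ℂ) : ℂ :=
  Complex.exp (-(Complex.I * (a t : ℂ) * (z - (x : ℂ)) ^ 2)) * G t x z

/-- A pair of continuous coefficients `A, B : (0,T) × (ℝ \ {0}) → [0, ∞)`. -/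
def IsCoefficientPair (T : EReal) (A B : ℝ → ℝ → ℝ) : Prop :=
  ContinuousOn (Function.uncurry A) (timeInterval T ×ˢ puncturedLine) ∧
  ContinuousOn (Function.uncurry B) (timeInterval T ×ˢ puncturedLine) ∧
  ∀ t ∈ timeInterval T, ∀ x ∈ puncturedLine, 0 ≤ A t x ∧ 0 ≤ B t x

/-- A real function is bounded above near `0` along the filter `l` (`t → 0⁺`, or `x → 0^±`). It
is only applied to nonnegative functions. -/
def BoundedNear (l : Filter ℝ) (f : ℝ → ℝ) : Prop := ∃ C : ℝ, ∀ᶠ s in l, f s ≤ C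

/-- The decomposition of the Green's function into a Gaussian phase and an exponentially bounded
factor of order `p < 2`, together with the bounds on the coefficients. All derivatives of the
reduced function that are estimated are required to exist. -/
def ExponentialBounds (T : EReal) (M N : Matrix (Fin 2) (Fin 2) ℂ) (S : Set ℂ)
    (G : ℝ → ℝ → ℂ → ℂ) : Prop :=
  ∃ (a : ℝ → ℝ) (p : ℝ) (A₀ A₁ A₂ B₀ B₁ B₂ : ℝ → ℝ → ℝ),
    IsAC a (timeInterval T) ∧ (∀ t ∈ timeInterval T, 0 < a t) ∧ Tendsto a (𝓝[>] 0) atTop ∧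
    0 < p ∧ p < 2 ∧
    IsCoefficientPair T A₀ B₀ ∧ IsCoefficientPair T A₁ B₁ ∧ IsCoefficientPair T A₂ B₂ ∧
    (∀ t ∈ timeInterval T, ∀ x ∈ puncturedLine, ∀ z ∈ S,
      ‖reducedGreen a G t x z‖ ≤ A₀ t x * Real.exp (B₀ t x * ‖z‖ ^ p) ∧
      DifferentiableAt ℝ (fun y => reducedGreen a G t y z) x ∧
      ‖deriv (fun y => reducedGreen a G t y z) x‖ ≤ A₁ t x * Real.exp (B₁ t x * ‖z‖ ^ p) ∧
      DifferentiableAt ℝ (deriv fun y => reducedGreen a G t y z) x ∧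
      ‖deriv (deriv fun y => reducedGreen a G t y z) x‖
        ≤ A₂ t x * Real.exp (B₂ t x * ‖z‖ ^ p) ∧
      DifferentiableAt ℝ (fun s => reducedGreen a G s x z) t ∧
      ‖deriv (fun s => reducedGreen a G s x z) t‖ ≤ A₂ t x * Real.exp (B₂ t x * ‖z‖ ^ p)) ∧
    (∀ x ∈ puncturedLine,
      BoundedNear (𝓝[>] 0) (fun t => A₀ t x / √(a t)) ∧
      BoundedNear (𝓝[>] 0) (fun t => B₀ t x)) ∧
    (∀ t ∈ timeInterval T,
      (M ≠ 0 ∨ N ≠ 0 → BoundedNear (𝓝[≠] 0) (A₀ t) ∧ BoundedNear (𝓝[≠] 0) (B₀ t)) ∧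
      (N ≠ 0 → BoundedNear (𝓝[≠] 0) (A₁ t) ∧ BoundedNear (𝓝[≠] 0) (B₁ t)))

/-- The assumptions on a Green's function `G : (0,T) × (ℝ \ {0}) × (ℝ \ {0}) → ℂ` with respect to
the potential `V` and the transmission matrices `M, N`. The function `Gc` is the continuation of
`G` in the last variable to the double sector. Values of `G`, `Gc` outside these domains play no
role. -/
def GreenAssumption (T : EReal) (V : ℝ → ℝ → ℂ) (M N : Matrix (Fin 2) (Fin 2) ℂ)
    (G : ℝ → ℝ → ℝ → ℂ) : Prop :=
  ∃ (θ : ℝ) (Gc : ℝ → ℝ → ℂ → ℂ), 0 < θ ∧ θ < Real.pi / 2 ∧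
    -- continuation
    (∀ t ∈ timeInterval T, ∀ x ∈ puncturedLine,
      (∀ y ∈ puncturedLine, Gc t x (y : ℂ) = G t x y) ∧
      ContinuousOn (Gc t x) (doubleSector θ) ∧
      DifferentiableOn ℂ (Gc t x) (interior (doubleSector θ))) ∧
    -- Schrödinger equation
    (∀ z ∈ doubleSector θ,
      IsAC12 T (fun t x => Gc t x z) ∧ SolvesSchrodinger T V (fun t x => Gc t x z)) ∧
    -- transmission condition
    (∀ t ∈ timeInterval T, ∀ y ∈ puncturedLine, TransmissionCondition M N (fun x => G t x y)) ∧
    -- initial condition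
    (∀ x ∈ puncturedLine, ∃ x₀ : ℝ, |x| < x₀ ∧
      ∀ φ : ℝ → ℂ, ContDiffOn ℝ ∞ φ (Icc (-x₀) x₀) →
        (∀ t ∈ timeInterval T,
          IntervalIntegrable (fun y => G t x y * φ y) volume (-x₀) x₀) ∧
        Tendsto (fun t => ∫ y in (-x₀)..x₀, G t x y * φ y) (𝓝[>] 0) (𝓝 (φ x))) ∧
    -- exponential bounds
    ExponentialBounds T M N (doubleSector θ) Gc

/-! ### The explicit Green's function of a point interaction -/

/-- The complex error function `erf z = (2/√π) ∫_0^z e^{-w²} dw`, integrated along the segment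
from `0` to `z`. -/
def cerf (z : ℂ) : ℂ :=
  2 / (√Real.pi : ℂ) * ∫ s in (0 : ℝ)..1, z * Complex.exp (-((s : ℂ) * z) ^ 2)

/-- `Λ(z) = e^{z²} (1 - erf z)`. -/
def bigLambda (z : ℂ) : ℂ := Complex.exp (z ^ 2) * (1 - cerf z)

/-- The matrix `J = e^{iφ} (α, -β̄; β, ᾱ)`. -/
def unitaryOf (φ : ℝ) (α β : ℂ) : Matrix (Fin 2) (Fin 2) ℂ :=
  Complex.exp (Complex.I * φ) • !![α, -conj β; β, conj α]

/-- `(φ, α, β)` are admissible parameters representing the matrix `J`. -/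
def Represents (φ : ℝ) (α β : ℂ) (J : Matrix (Fin 2) (Fin 2) ℂ) : Prop :=
  0 ≤ φ ∧ φ < Real.pi ∧ ‖α‖ ^ 2 + ‖β‖ ^ 2 = 1 ∧ J = unitaryOf φ α β

/-- The Heaviside step function (only used at nonzero arguments). -/
def heaviside (x : ℝ) : ℝ := if 0 < x then 1 else 0

open Classical in
/-- The coefficient `η^{(x,y)}`. -/
def eta (α β : ℂ) (x y : ℝ) : ℂ :=
  if |α.re| = 1 then 0
  else 1 / (√(1 - α.re ^ 2) : ℂ) *
    (if 0 < x then
      (if 0 < y then -(α.im : ℂ) else -Complex.I * conj β)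
    else
      (if 0 < y then Complex.I * β else (α.im : ℂ)))

open Classical in
/-- The coefficient `ω₊`. -/
def omegaP (φ : ℝ) (α : ℂ) : ℝ :=
  if α.re ≠ -Real.cos φ then (-Real.sin φ + √(1 - α.re ^ 2)) / (Real.cos φ + α.re)
  else if α.re ≠ -1 then Real.cos φ / Real.sin φ
  else 0

open Classical in
/-- The coefficient `ω₋`. -/
def omegaM (φ : ℝ) (α : ℂ) : ℝ :=
  if α.re ≠ -Real.cos φ then (-Real.sin φ - √(1 - α.re ^ 2)) / (Real.cos φ + α.re)
  else 0

open Classical in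
/-- The coefficient `μ₊^{(x,y)}`. -/
def muP (φ : ℝ) (α β : ℂ) (x y : ℝ) : ℂ :=
  if α.re ≠ -Real.cos φ then -(omegaP φ α : ℂ) / 2 * (heaviside (x * y) + eta α β x y)
  else if α.re ≠ -1 then -(omegaP φ α : ℂ) / 2 * (heaviside (x * y) + eta α β x y)
  else 0

open Classical in
/-- The coefficient `μ₋^{(x,y)}`. -/
def muM (φ : ℝ) (α β : ℂ) (x y : ℝ) : ℂ :=
  if α.re ≠ -Real.cos φ then -(omegaM φ α : ℂ) / 2 * (heaviside (x * y) - eta α β x y)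
  else 0

open Classical in
/-- The coefficient `μ₀^{(x,y)}`. -/
def muZero (φ : ℝ) (α β : ℂ) (x y : ℝ) : ℂ :=
  if α.re ≠ -Real.cos φ then (Real.sign (x * y) : ℂ)
  else if α.re ≠ -1 then eta α β x y - heaviside (-(x * y))
  else -1

/-- The Green's function of the point interaction with parameters `(φ, α, β)`. All complex square
roots are principal ones. -/
def pointGreen (φ : ℝ) (α β : ℂ) (t x y : ℝ) : ℂ :=
  let s : ℂ := (|x| + |y| : ℝ)
  let r : ℂ := Complex.sqrt (Complex.I * t)
  let rπ : ℂ := Complex.sqrt (Complex.I * Real.pi * t)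
  muP φ α β x y * bigLambda (s / (2 * r) + omegaP φ α * r)
      * Complex.exp (-(s ^ 2 / (4 * Complex.I * t)))
    + muM φ α β x y * bigLambda (s / (2 * r) + omegaM φ α * r)
      * Complex.exp (-(s ^ 2 / (4 * Complex.I * t)))
    + muZero φ α β x y / (2 * rπ) * Complex.exp (-(s ^ 2 / (4 * Complex.I * t)))
    + 1 / (2 * rπ) * Complex.exp (-(((x : ℂ) - y) ^ 2 / (4 * Complex.I * t)))

/-- The interface condition `(I - J) (u₊, u₋)ᵀ = i (I + J) (d₊, -d₋)ᵀ`. -/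
def InterfaceCondition (J : Matrix (Fin 2) (Fin 2) ℂ) (uP uM dP dM : ℂ) : Prop :=
  BoundaryRelation (1 - J) (Complex.I • (1 + J)) uP uM dP dM

/-- A relation between the boundary values `u₊, u₋` and the boundary derivatives `d₊, d₋` is the
interface condition of some unitary matrix `J`. -/
def IsCoveredByUnitary (R : ℂ → ℂ → ℂ → ℂ → Prop) : Prop :=
  ∃ J ∈ Matrix.unitaryGroup (Fin 2) ℂ,
    ∀ uP uM dP dM : ℂ, InterfaceCondition J uP uM dP dM ↔ R uP uM dP dM

end

end PointInteraction

namespace PointInteraction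

/-! ### The Laplace representation of `Λ` -/

/-! The Green's function is the free kernel `K(t, x - y)` plus a layer: a combination of `K(t, s)`
and of `L_ω(t, s) = Λ(s / (2√(it)) + ω√(it)) e^{-s²/(4it)}` (`lambdaKernel`) for `ω = ω₊, ω₋`, taken
at `s = |x| + |y|`, with coefficients that depend only on the signs of `x` and `y`. Everything rests
on the Laplace representation `Λ(z) = (2/√π) ∫_0^∞ e^{-u² - 2uz} du` (`bigLambda_eq_gaussLaplace`),
which gives the equation `Λ' = 2zΛ - 2/√π`, boundedness on half-planes and the decay `1 / Re z`.

The differential equation for `Λ` becomes `∂_s L_ω = ω L_ω - 2K`, and `L_ω` solves the free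
Schrödinger equation. As `|x|` is affine with slope `±1` on each half-line, the equation off the
origin follows. At `x = 0^±` the boundary data are combinations of `L_{ω₊}`, `L_{ω₋}`, `K` and
`(|y|/(2it)) K`, so it is enough that each of the four coefficient vectors satisfies the interface
condition (`interfaceCoefficients`). That is spectral theory of `J`: the vector `Θ(xy) ± η^{(x,y)}`,
indexed by the sign of `x`, is a column of twice a spectral projection of `J`, and `ω_±` is the
Cayley transform of the corresponding eigenvalue. Cases II and III occur when `-1` is an eigenvalue.

For the initial condition, `-2K` is the space derivative of `L_0`, which is bounded, equals `1` at
`s = 0` and tends to `0` for `s > 0`. Integration by parts shows that `K` picks up half of the value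
at `0` from each side. The layer is evaluated at `s ≥ |x| > 0` and contributes nothing in the limit.

For the growth bounds take `a(t) = 1/(4t)`. Removing the Gaussian phase leaves `Λ` on a half-plane
times either `1` or `e^{i|x|ζ/t}`, where `ζ = ±z` lies in the closed first quadrant, so that this
factor has modulus at most `1`. Differentiation only brings down powers of `ζ`, so order `p = 1`
suffices. -/

lemma integrable_gauss_exp (z : ℂ) :
    Integrable (fun u : ℝ => Complex.exp (-(u : ℂ) ^ 2 - 2 * u * z)) := by
  have h := integrable_cexp_quadratic (b := 1) (by simp) (-2 * z) 0
  refine h.congr (Eventually.of_forall fun u => ?_)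
  simp only
  congr 1
  ring

lemma norm_gauss_exp (u : ℝ) (z : ℂ) :
    ‖Complex.exp (-(u : ℂ) ^ 2 - 2 * u * z)‖ = Real.exp (-u ^ 2 - 2 * u * z.re) := by
  rw [Complex.norm_exp]
  congr 1
  simp [← Complex.ofReal_pow]

lemma integrable_real_gauss_exp (c : ℝ) :
    Integrable (fun u : ℝ => Real.exp (-u ^ 2 - 2 * u * c)) := by
  refine (integrable_gauss_exp (c : ℂ)).norm.congr (Eventually.of_forall fun u => ?_)
  simp only [norm_gauss_exp, Complex.ofReal_re]

/-- Differentiation under the integral sign. In the `- 2` of the dominating function, one unit comes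
from moving `w` in the unit ball around `z`, the other from absorbing the factor `u` into `e^{2u}`.
-/
lemma hasDerivAt_integral_gauss_exp (z : ℂ) :
    Integrable (fun u : ℝ => -2 * (u : ℂ) * Complex.exp (-(u : ℂ) ^ 2 - 2 * u * z))
      (volume.restrict (Ioi 0)) ∧
    HasDerivAt (fun w : ℂ => ∫ u in Ioi (0 : ℝ), Complex.exp (-(u : ℂ) ^ 2 - 2 * u * w))
      (∫ u in Ioi (0 : ℝ), -2 * (u : ℂ) * Complex.exp (-(u : ℂ) ^ 2 - 2 * u * z)) z := by
  refine hasDerivAt_integral_of_dominated_loc_of_deriv_le (μ := volume.restrict (Ioi (0 : ℝ)))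
    (F := fun w u => Complex.exp (-(u : ℂ) ^ 2 - 2 * u * w))
    (F' := fun w u => -2 * (u : ℂ) * Complex.exp (-(u : ℂ) ^ 2 - 2 * u * w))
    (bound := fun u => 2 * Real.exp (-u ^ 2 - 2 * u * (z.re - 2)))
    (Metric.ball_mem_nhds z one_pos) ?_ ?_ ?_ ?_ ?_ ?_
  · exact Eventually.of_forall fun w => (integrable_gauss_exp w).aestronglyMeasurable.restrict
  · exact (integrable_gauss_exp z).restrict
  · exact (by fun_prop : Continuous fun u : ℝ =>
      -2 * (u : ℂ) * Complex.exp (-(u : ℂ) ^ 2 - 2 * u * z)).aestronglyMeasurable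
  · filter_upwards [ae_restrict_mem measurableSet_Ioi] with u hu w hw
    have hu : 0 < u := hu
    have hw' : z.re - 1 ≤ w.re := by
      have h1 : ‖w - z‖ < 1 := by simpa [dist_eq_norm] using hw
      have h2 := (Complex.abs_re_le_norm (w - z)).trans h1.le
      have := (abs_le.1 h2).1
      simp only [Complex.sub_re] at this
      linarith
    rw [norm_mul, norm_gauss_exp]
    have h3 : ‖-2 * (u : ℂ)‖ = 2 * u := by simp [abs_of_pos hu]
    rw [h3]
    have h4 : u ≤ Real.exp (2 * u) := by linarith [Real.add_one_le_exp (2 * u)]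
    calc 2 * u * Real.exp (-u ^ 2 - 2 * u * w.re)
        ≤ 2 * Real.exp (2 * u) * Real.exp (-u ^ 2 - 2 * u * (z.re - 1)) := by
          gcongr
      _ = 2 * Real.exp (-u ^ 2 - 2 * u * (z.re - 2)) := by
          rw [mul_assoc, ← Real.exp_add]
          ring_nf
  · exact ((integrable_real_gauss_exp _).const_mul 2).restrict
  · refine Eventually.of_forall fun u w _ => ?_
    have h : HasDerivAt (fun w : ℂ => -(u : ℂ) ^ 2 - 2 * u * w) (-2 * (u : ℂ)) w := by
      simpa using ((hasDerivAt_id w).const_mul (2 * (u : ℂ))).const_sub (-(u : ℂ) ^ 2)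
    simpa [mul_comm] using h.cexp

lemma tendsto_gauss_exp (z : ℂ) :
    Tendsto (fun u : ℝ => Complex.exp (-(u : ℂ) ^ 2 - 2 * u * z)) atTop (𝓝 0) := by
  rw [tendsto_zero_iff_norm_tendsto_zero]
  simp only [norm_gauss_exp]
  refine Real.tendsto_exp_atBot.comp ?_
  have h : Tendsto (fun u : ℝ => u * (u + 2 * z.re)) atTop atTop :=
    tendsto_id.atTop_mul_atTop₀ (tendsto_atTop_add_const_right _ _ tendsto_id)
  refine (tendsto_neg_atTop_atBot.comp h).congr fun u => ?_
  simp only [Function.comp]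
  ring

/-- The total derivative `(-2u - 2z) e^{-u² - 2uz}` integrates to `-1` over the half-line. This is
what turns the Laplace integral into a solution of a first-order linear equation. -/
lemma integral_deriv_gauss_exp (z : ℂ) :
    ∫ u in Ioi (0 : ℝ), -2 * (u : ℂ) * Complex.exp (-(u : ℂ) ^ 2 - 2 * u * z) =
      2 * z * (∫ u in Ioi (0 : ℝ), Complex.exp (-(u : ℂ) ^ 2 - 2 * u * z)) - 1 := by
  have h1 := (hasDerivAt_integral_gauss_exp z).1
  have h2 : IntegrableOn (fun u : ℝ => Complex.exp (-(u : ℂ) ^ 2 - 2 * u * z)) (Ioi 0) :=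
    (integrable_gauss_exp z).integrableOn
  have key := integral_Ioi_of_hasDerivAt_of_tendsto' (a := (0 : ℝ))
    (f := fun u : ℝ => Complex.exp (-(u : ℂ) ^ 2 - 2 * u * z))
    (f' := fun u : ℝ => -2 * (u : ℂ) * Complex.exp (-(u : ℂ) ^ 2 - 2 * u * z) -
      2 * z * Complex.exp (-(u : ℂ) ^ 2 - 2 * u * z)) (m := 0) ?_
      (h1.sub (h2.const_mul (2 * z))) (tendsto_gauss_exp z)
  · rw [integral_sub h1 (h2.const_mul (2 * z)), integral_const_mul] at key
    have h0 : Complex.exp (-((0 : ℝ) : ℂ) ^ 2 - 2 * ((0 : ℝ) : ℂ) * z) = 1 := by simp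
    rw [h0] at key
    linear_combination key
  · intro u _
    have hu : HasDerivAt (fun u : ℝ => (u : ℂ)) 1 u := Complex.ofRealCLM.hasDerivAt
    have h : HasDerivAt (fun u : ℝ => -(u : ℂ) ^ 2 - 2 * u * z) (-2 * (u : ℂ) - 2 * z) u := by
      have := (hu.pow 2).neg.sub ((hu.const_mul 2).mul_const z)
      refine this.congr_deriv ?_
      simp
    refine h.cexp.congr_deriv ?_
    ring

/-- `(2/√π) ∫_0^∞ e^{-u² - 2uz} du`, the Laplace representation of `Λ`. -/
noncomputable def gaussLaplace (z : ℂ) : ℂ :=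
  2 / (√Real.pi : ℂ) * ∫ u in Ioi (0 : ℝ), Complex.exp (-(u : ℂ) ^ 2 - 2 * u * z)

lemma hasDerivAt_gaussLaplace (z : ℂ) :
    HasDerivAt gaussLaplace (2 * z * gaussLaplace z - 2 / (√Real.pi : ℂ)) z := by
  have h := (hasDerivAt_integral_gauss_exp z).2.const_mul (2 / (√Real.pi : ℂ))
  refine h.congr_deriv ?_
  rw [integral_deriv_gauss_exp, gaussLaplace]
  ring

lemma sqrt_pi_ne_zero : (√Real.pi : ℂ) ≠ 0 := by
  exact_mod_cast (Real.sqrt_pos.2 Real.pi_pos).ne'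

lemma gaussLaplace_zero : gaussLaplace 0 = 1 := by
  have h : ∫ u in Ioi (0 : ℝ), Complex.exp (-(u : ℂ) ^ 2 - 2 * u * 0) = (√Real.pi : ℂ) / 2 := by
    have h1 := integral_gaussian_Ioi 1
    have : ∀ u : ℝ, Complex.exp (-(u : ℂ) ^ 2 - 2 * u * 0) = ((Real.exp (-1 * u ^ 2) : ℝ) : ℂ) := by
      intro u
      push_cast
      congr 1
      ring
    simp only [this]
    rw [integral_complex_ofReal, h1]
    simp
  rw [gaussLaplace, h]
  field_simp [sqrt_pi_ne_zero]

/-- The Laplace representation of `Λ`. -/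
theorem bigLambda_eq_gaussLaplace : bigLambda = gaussLaplace := by
  funext z
  -- The term `2wΛ` of the differential equation cancels against the derivative of `e^{-w²}`, so
  -- `e^{-w²} gaussLaplace w` has the derivative of `1 - erf w`. Both equal `1` at the origin.
  have hd : ∀ s ∈ uIcc (0 : ℝ) 1, HasDerivAt
      (fun s : ℝ => Complex.exp (-((s : ℂ) * z) ^ 2) * gaussLaplace (s * z))
      (-(2 / (√Real.pi : ℂ)) * (z * Complex.exp (-((s : ℂ) * z) ^ 2))) s := by
    intro s _
    have hs : HasDerivAt (fun s : ℝ => (s : ℂ) * z) z s := by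
      simpa using (Complex.ofRealCLM.hasDerivAt (x := s)).mul_const z
    have h1 := (hasDerivAt_gaussLaplace (s * z)).comp s hs
    have h2 := ((hs.pow 2).neg).cexp
    refine (h2.mul h1).congr_deriv ?_
    simp only [Function.comp]
    simp
    ring
  have key := intervalIntegral.integral_eq_sub_of_hasDerivAt hd
    ((by fun_prop : Continuous fun s : ℝ =>
      -(2 / (√Real.pi : ℂ)) * (z * Complex.exp (-((s : ℂ) * z) ^ 2))).intervalIntegrable _ _)
  rw [intervalIntegral.integral_const_mul] at key
  simp only [Complex.ofReal_one, one_mul, Complex.ofReal_zero, zero_mul, gaussLaplace_zero] at key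
  norm_num at key
  have h3 : 1 - cerf z = Complex.exp (-z ^ 2) * gaussLaplace z := by
    rw [cerf, intervalIntegral.integral_const_mul]
    linear_combination key
  rw [bigLambda, h3, ← mul_assoc, ← Complex.exp_add]
  simp

/-! ### Derivatives and bounds -/

theorem hasDerivAt_bigLambda (z : ℂ) :
    HasDerivAt bigLambda (2 * z * bigLambda z - 2 / (√Real.pi : ℂ)) z := by
  rw [bigLambda_eq_gaussLaplace]
  exact hasDerivAt_gaussLaplace z

lemma differentiable_bigLambda : Differentiable ℂ bigLambda :=
  fun z => (hasDerivAt_bigLambda z).differentiableAt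

lemma bigLambda_zero : bigLambda 0 = 1 := by
  rw [bigLambda_eq_gaussLaplace, gaussLaplace_zero]

lemma norm_two_div_sqrt_pi : ‖2 / (√Real.pi : ℂ)‖ = 2 / √Real.pi := by
  simp [abs_of_nonneg (Real.sqrt_nonneg _)]

/-- The Laplace integrand is dominated by its value at `-c`. Enlarging the half-line to the whole
line and completing the square leaves a Gaussian integral with the factor `e^{c²}`. -/
theorem norm_bigLambda_le {c : ℝ} {w : ℂ} (hw : -c ≤ w.re) :
    ‖bigLambda w‖ ≤ 2 * Real.exp (c ^ 2) := by
  have hpi : 0 < √Real.pi := Real.sqrt_pos.2 Real.pi_pos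
  rw [bigLambda_eq_gaussLaplace, gaussLaplace, norm_mul, norm_two_div_sqrt_pi]
  have hint : Integrable (fun u : ℝ => Real.exp (-u ^ 2 - 2 * u * (-c))) :=
    integrable_real_gauss_exp _
  have h1 : ‖∫ u in Ioi (0 : ℝ), Complex.exp (-(u : ℂ) ^ 2 - 2 * u * w)‖ ≤
      ∫ u in Ioi (0 : ℝ), Real.exp (-u ^ 2 - 2 * u * (-c)) := by
    refine norm_integral_le_of_norm_le hint.integrableOn ?_
    filter_upwards [ae_restrict_mem measurableSet_Ioi] with u hu
    have hu : 0 < u := hu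
    rw [norm_gauss_exp]
    gcongr
  have h2 : ∫ u in Ioi (0 : ℝ), Real.exp (-u ^ 2 - 2 * u * (-c)) ≤
      ∫ u : ℝ, Real.exp (-u ^ 2 - 2 * u * (-c)) :=
    setIntegral_le_integral hint (Eventually.of_forall fun u => (Real.exp_pos _).le)
  have h3 : ∫ u : ℝ, Real.exp (-u ^ 2 - 2 * u * (-c)) = Real.exp (c ^ 2) * √Real.pi := by
    have h4 : ∀ u : ℝ, Real.exp (-u ^ 2 - 2 * u * (-c)) =
        Real.exp (c ^ 2) * Real.exp (-1 * (u - c) ^ 2) := by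
      intro u
      rw [← Real.exp_add]
      ring_nf
    simp only [h4]
    rw [integral_const_mul, integral_sub_right_eq_self (fun u : ℝ => Real.exp (-1 * u ^ 2)) c,
      integral_gaussian]
    simp
  calc _ ≤ 2 / √Real.pi * (Real.exp (c ^ 2) * √Real.pi) := by
        gcongr
        exact (h1.trans h2).trans h3.le
    _ = 2 * Real.exp (c ^ 2) := by field_simp

/-- Dropping `e^{-u²}` leaves an elementary exponential integral. This decay is what kills the layer
as `t → 0⁺`. -/
theorem norm_bigLambda_le_inv {w : ℂ} (hw : 0 < w.re) : ‖bigLambda w‖ ≤ 1 / w.re := by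
  have hpi : 0 < √Real.pi := Real.sqrt_pos.2 Real.pi_pos
  have hpi1 : 1 ≤ √Real.pi := by
    rw [Real.one_le_sqrt]
    linarith [Real.pi_gt_three]
  rw [bigLambda_eq_gaussLaplace, gaussLaplace, norm_mul, norm_two_div_sqrt_pi]
  have hneg : -2 * w.re < 0 := by linarith
  have h1 : ‖∫ u in Ioi (0 : ℝ), Complex.exp (-(u : ℂ) ^ 2 - 2 * u * w)‖ ≤
      ∫ u in Ioi (0 : ℝ), Real.exp (-2 * w.re * u) := by
    refine norm_integral_le_of_norm_le (integrableOn_exp_mul_Ioi hneg 0) ?_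
    refine Eventually.of_forall fun u => ?_
    rw [norm_gauss_exp]
    refine Real.exp_le_exp.2 ?_
    nlinarith [sq_nonneg u]
  have h2 : ∫ u in Ioi (0 : ℝ), Real.exp (-2 * w.re * u) = 1 / (2 * w.re) := by
    rw [integral_exp_mul_Ioi hneg 0]
    simp
  rw [h2] at h1
  calc _ ≤ 2 / 1 * (1 / (2 * w.re)) := by gcongr
    _ = 1 / w.re := by field_simp

lemma re_ge_of_mem_sphere {c : ℝ} {w v : ℂ} (hw : -c ≤ w.re) (hv : v ∈ Metric.sphere w 1) :
    -(c + 1) ≤ v.re := by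
  have h1 : ‖v - w‖ = 1 := by simpa [dist_eq_norm] using hv
  have h2 := (Complex.abs_re_le_norm (v - w)).trans h1.le
  have := (abs_le.1 h2).1
  simp only [Complex.sub_re] at this
  linarith

/-- Cauchy's estimate on the unit circle, which costs one unit of `c`. Bounding the right-hand side
of the differential equation term by term would leave an unbounded factor `z`. -/
theorem norm_deriv_bigLambda_le {c : ℝ} {w : ℂ} (hw : -c ≤ w.re) :
    ‖deriv bigLambda w‖ ≤ 2 * Real.exp ((c + 1) ^ 2) := by
  have := Complex.norm_deriv_le_of_forall_mem_sphere_norm_le (c := w) one_pos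
    differentiable_bigLambda.diffContOnCl
    fun v hv => norm_bigLambda_le (re_ge_of_mem_sphere hw hv)
  simpa using this

lemma differentiable_deriv_bigLambda : Differentiable ℂ (deriv bigLambda) := by
  have : deriv bigLambda = fun z => 2 * z * bigLambda z - 2 / (√Real.pi : ℂ) :=
    funext fun z => (hasDerivAt_bigLambda z).deriv
  rw [this]
  have := differentiable_bigLambda
  fun_prop

theorem norm_deriv_deriv_bigLambda_le {c : ℝ} {w : ℂ} (hw : -c ≤ w.re) :
    ‖deriv (deriv bigLambda) w‖ ≤ 2 * Real.exp ((c + 2) ^ 2) := by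
  have := Complex.norm_deriv_le_of_forall_mem_sphere_norm_le (c := w) one_pos
    differentiable_deriv_bigLambda.diffContOnCl
    fun v hv => norm_deriv_bigLambda_le (re_ge_of_mem_sphere hw hv)
  rw [div_one] at this
  refine this.trans (le_of_eq ?_)
  ring_nf

/-! ### The square root of `it` -/

/-- The principal square root of `it` for `t > 0`. -/
noncomputable def rootIT (t : ℝ) : ℂ := (√(t / 2) : ℂ) * (1 + Complex.I)

lemma sqrt_I_mul {t : ℝ} (ht : 0 < t) : Complex.sqrt (Complex.I * t) = rootIT t := by
  rw [Complex.sqrt_eq_real_add_ite, rootIT]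
  simp [abs_of_pos ht, ht.le]
  ring

lemma sqrt_I_mul_pi_mul {t : ℝ} (ht : 0 < t) :
    Complex.sqrt (Complex.I * Real.pi * t) = (√Real.pi : ℂ) * rootIT t := by
  have h : Complex.I * Real.pi * t = Complex.I * ((Real.pi * t : ℝ) : ℂ) := by
    push_cast
    ring
  rw [h, sqrt_I_mul (by positivity), rootIT, rootIT, mul_div_assoc,
    Real.sqrt_mul Real.pi_pos.le]
  push_cast
  ring

lemma rootIT_sq {t : ℝ} (ht : 0 < t) : rootIT t ^ 2 = Complex.I * t := by
  have h : ((√(t / 2) : ℝ) : ℂ) ^ 2 = (t : ℂ) / 2 := by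
    rw [← Complex.ofReal_pow, Real.sq_sqrt (by positivity)]
    push_cast
    ring
  rw [rootIT, mul_pow, h]
  linear_combination (t : ℂ) / 2 * Complex.I_sq

lemma rootIT_ne_zero {t : ℝ} (ht : 0 < t) : rootIT t ≠ 0 := by
  intro h
  have := rootIT_sq ht
  rw [h] at this
  simp [ht.ne'] at this

lemma rootIT_re (t : ℝ) : (rootIT t).re = √(t / 2) := by
  simp [rootIT]

lemma norm_rootIT {t : ℝ} (ht : 0 < t) : ‖rootIT t‖ = √t := by
  have h : ‖rootIT t‖ ^ 2 = t := by
    rw [← norm_pow, rootIT_sq ht]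
    simp [abs_of_pos ht]
  rw [← h, Real.sqrt_sq (norm_nonneg _), h]

lemma inv_rootIT {t : ℝ} (ht : 0 < t) :
    (rootIT t)⁻¹ = ((1 / (2 * √(t / 2)) : ℝ) : ℂ) * (1 - Complex.I) := by
  have h : (√(t / 2) : ℂ) ≠ 0 := by exact_mod_cast (Real.sqrt_pos.2 (by positivity)).ne'
  apply inv_eq_of_mul_eq_one_left
  rw [rootIT]
  push_cast
  field_simp
  linear_combination -Complex.I_sq

lemma hasDerivAt_rootIT {t : ℝ} (ht : 0 < t) :
    HasDerivAt rootIT (rootIT t / (2 * t)) t := by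
  have h1 : HasDerivAt (fun t : ℝ => √(t / 2)) (1 / 2 / (2 * √(t / 2))) t :=
    ((hasDerivAt_id t).div_const 2).sqrt (by simp [ht.ne'])
  have h2 := (h1.ofReal_comp).mul_const (1 + Complex.I)
  refine h2.congr_deriv ?_
  have h3 : 1 / 2 / (2 * √(t / 2)) = √(t / 2) / (2 * t) := by
    have h4 : √(t / 2) ^ 2 = t / 2 := Real.sq_sqrt (by positivity)
    have h5 : √(t / 2) ≠ 0 := (Real.sqrt_pos.2 (by positivity)).ne'
    field_simp
    rw [h4]
    ring
  rw [h3, rootIT]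
  push_cast
  ring

/-- The number `1/√(it)` is a positive multiple of `1 - i`, hence the sum of real and imaginary
parts. It is nonnegative for `s` in the closed first quadrant, which is why the double sector opens
counterclockwise from the real axis. -/
lemma re_div_two_rootIT {t : ℝ} (ht : 0 < t) (s : ℂ) :
    (s / (2 * rootIT t)).re = (s.re + s.im) / (4 * √(t / 2)) := by
  rw [div_eq_mul_inv, mul_inv, inv_rootIT ht]
  have : s * ((2 : ℂ)⁻¹ * (((1 / (2 * √(t / 2)) : ℝ) : ℂ) * (1 - Complex.I))) =
      ((1 / (4 * √(t / 2)) : ℝ) : ℂ) * (s * (1 - Complex.I)) := by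
    push_cast
    ring
  rw [this, Complex.re_ofReal_mul]
  simp only [Complex.mul_re, Complex.sub_re, Complex.one_re, Complex.I_re, Complex.sub_im,
    Complex.one_im, Complex.I_im]
  ring

/-! ### Solutions of the free Schrödinger equation -/

/-- A smooth solution of the free Schrödinger equation for `t > 0` which is entire in the space
variable, together with its first two space derivatives. -/
structure IsFreeSolution (F F₁ F₂ : ℝ → ℂ → ℂ) : Prop where
  deriv_space : ∀ t, 0 < t → ∀ s, HasDerivAt (F t) (F₁ t s) s
  deriv_space₂ : ∀ t, 0 < t → ∀ s, HasDerivAt (F₁ t) (F₂ t s) s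
  deriv_time : ∀ t, 0 < t → ∀ s, HasDerivAt (fun τ => F τ s) (Complex.I * F₂ t s) t
  continuous_space : ∀ t, 0 < t → Continuous (F₂ t)
  continuous_time : ∀ s, ContinuousOn (fun t => F₂ t s) (Ioi 0)

namespace IsFreeSolution

variable {F F₁ F₂ H H₁ H₂ : ℝ → ℂ → ℂ}

lemma add (hF : IsFreeSolution F F₁ F₂) (hH : IsFreeSolution H H₁ H₂) :
    IsFreeSolution (fun t s => F t s + H t s) (fun t s => F₁ t s + H₁ t s)
      (fun t s => F₂ t s + H₂ t s) where
  deriv_space t ht s := (hF.deriv_space t ht s).add (hH.deriv_space t ht s)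
  deriv_space₂ t ht s := (hF.deriv_space₂ t ht s).add (hH.deriv_space₂ t ht s)
  deriv_time t ht s := ((hF.deriv_time t ht s).add (hH.deriv_time t ht s)).congr_deriv (by ring)
  continuous_space t ht := (hF.continuous_space t ht).add (hH.continuous_space t ht)
  continuous_time s := (hF.continuous_time s).add (hH.continuous_time s)

lemma const_mul (hF : IsFreeSolution F F₁ F₂) (c : ℂ) :
    IsFreeSolution (fun t s => c * F t s) (fun t s => c * F₁ t s) (fun t s => c * F₂ t s) where
  deriv_space t ht s := (hF.deriv_space t ht s).const_mul c
  deriv_space₂ t ht s := (hF.deriv_space₂ t ht s).const_mul c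
  deriv_time t ht s := ((hF.deriv_time t ht s).const_mul c).congr_deriv (by ring)
  continuous_space t ht := (hF.continuous_space t ht).const_mul c
  continuous_time s := (hF.continuous_time s).const_mul c

/-- Translations and reflections preserve the free equation, since the second derivative only sees
`ε²`. The two signs of `ε` are the slopes of `|x|` on the half-lines. -/
lemma comp_affine (hF : IsFreeSolution F F₁ F₂) {ε : ℂ} (hε : ε ^ 2 = 1) (ζ : ℂ) :
    IsFreeSolution (fun t s => F t (ε * s + ζ)) (fun t s => ε * F₁ t (ε * s + ζ))
      (fun t s => F₂ t (ε * s + ζ)) := by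
  have hl : ∀ s : ℂ, HasDerivAt (fun s : ℂ => ε * s + ζ) ε s := fun s => by
    simpa using ((hasDerivAt_id s).const_mul ε).add_const ζ
  refine ⟨fun t ht s => ?_, fun t ht s => ?_, fun t ht s => hF.deriv_time t ht _,
    fun t ht => (hF.continuous_space t ht).comp (by fun_prop), fun s => hF.continuous_time _⟩
  · exact ((hF.deriv_space t ht _).comp s (hl s)).congr_deriv (by ring)
  · refine (((hF.deriv_space₂ t ht _).comp s (hl s)).const_mul ε).congr_deriv ?_
    linear_combination F₂ t (ε * s + ζ) * hε

lemma hasDerivAt_ofReal (hF : IsFreeSolution F F₁ F₂) {t : ℝ} (ht : 0 < t) (x : ℝ) :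
    HasDerivAt (fun y : ℝ => F t y) (F₁ t x) x :=
  (hF.deriv_space t ht x).comp_ofReal

lemma hasDerivAt_ofReal₂ (hF : IsFreeSolution F F₁ F₂) {t : ℝ} (ht : 0 < t) (x : ℝ) :
    HasDerivAt (fun y : ℝ => F₁ t y) (F₂ t x) x :=
  (hF.deriv_space₂ t ht x).comp_ofReal

end IsFreeSolution

/-- The free Schrödinger kernel. -/
noncomputable def freeKernel (t : ℝ) (s : ℂ) : ℂ :=
  1 / (2 * ((√Real.pi : ℂ) * rootIT t)) * Complex.exp (-(s ^ 2 / (4 * Complex.I * t)))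

/-- The solution of the free Schrödinger equation built from `Λ`. -/
noncomputable def lambdaKernel (κ t : ℝ) (s : ℂ) : ℂ :=
  bigLambda (s / (2 * rootIT t) + κ * rootIT t) * Complex.exp (-(s ^ 2 / (4 * Complex.I * t)))

lemma hasDerivAt_gaussPhase_space (t : ℝ) (s : ℂ) :
    HasDerivAt (fun s : ℂ => Complex.exp (-(s ^ 2 / (4 * Complex.I * t))))
      (-(s / (2 * Complex.I * t)) * Complex.exp (-(s ^ 2 / (4 * Complex.I * t)))) s := by
  refine (((hasDerivAt_id s).pow 2).div_const (4 * Complex.I * t)).neg.cexp.congr_deriv ?_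
  simp only [id, Pi.neg_apply, Pi.pow_apply]
  ring

lemma hasDerivAt_gaussPhase_time {t : ℝ} (ht : 0 < t) (s : ℂ) :
    HasDerivAt (fun t : ℝ => Complex.exp (-(s ^ 2 / (4 * Complex.I * t))))
      (s ^ 2 / (4 * Complex.I * t ^ 2) * Complex.exp (-(s ^ 2 / (4 * Complex.I * t)))) t := by
  have htc : (t : ℂ) ≠ 0 := by exact_mod_cast ht.ne'
  have h1 : HasDerivAt (fun t : ℝ => (t : ℂ)) 1 t := Complex.ofRealCLM.hasDerivAt
  have h2 := ((h1.const_mul (4 * Complex.I)).inv (by simp [ht.ne'])).const_mul (s ^ 2)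
  refine (h2.neg.cexp).congr_deriv ?_
  simp only [Pi.neg_apply, Pi.inv_apply]
  field_simp

lemma hasDerivAt_freeKernel_space (t : ℝ) (s : ℂ) :
    HasDerivAt (freeKernel t) (-(s / (2 * Complex.I * t)) * freeKernel t s) s := by
  refine ((hasDerivAt_gaussPhase_space t s).const_mul
    (1 / (2 * ((√Real.pi : ℂ) * rootIT t)))).congr_deriv ?_
  rw [freeKernel]
  ring

lemma hasDerivAt_inv_rootIT {t : ℝ} (ht : 0 < t) :
    HasDerivAt (fun t => (rootIT t)⁻¹) (-((rootIT t)⁻¹ / (2 * t))) t := by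
  have hr := rootIT_ne_zero ht
  have htc : (t : ℂ) ≠ 0 := by exact_mod_cast ht.ne'
  refine ((hasDerivAt_rootIT ht).inv hr).congr_deriv ?_
  field_simp

lemma hasDerivAt_freeKernel_time {t : ℝ} (ht : 0 < t) (s : ℂ) :
    HasDerivAt (fun τ => freeKernel τ s)
      ((-(1 / (2 * t)) + s ^ 2 / (4 * Complex.I * t ^ 2)) * freeKernel t s) t := by
  have h := ((hasDerivAt_inv_rootIT ht).const_mul (1 / (2 * (√Real.pi : ℂ)))).mul
    (hasDerivAt_gaussPhase_time ht s)
  have he : (fun τ => freeKernel τ s) = (fun t => 1 / (2 * (√Real.pi : ℂ)) * (rootIT t)⁻¹) *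
      fun t : ℝ => Complex.exp (-(s ^ 2 / (4 * Complex.I * t))) := by
    funext τ
    simp only [freeKernel, Pi.mul_apply]
    rw [← mul_assoc 2, one_div, mul_inv, one_div]
  rw [he]
  refine h.congr_deriv ?_
  rw [freeKernel, ← mul_assoc 2, one_div (2 * (√Real.pi : ℂ) * rootIT t), mul_inv]
  ring

lemma continuousOn_freeKernel_time (s : ℂ) : ContinuousOn (fun t => freeKernel t s) (Ioi 0) :=
  fun _ ht => (hasDerivAt_freeKernel_time ht s).continuousAt.continuousWithinAt

lemma continuous_freeKernel (t : ℝ) : Continuous (freeKernel t) :=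
  continuous_iff_continuousAt.2 fun s => (hasDerivAt_freeKernel_space t s).continuousAt

theorem isFreeSolution_freeKernel :
    IsFreeSolution freeKernel (fun t s => -(s / (2 * Complex.I * t)) * freeKernel t s)
      (fun t s => (-(1 / (2 * Complex.I * t)) + (s / (2 * Complex.I * t)) ^ 2) *
        freeKernel t s) where
  deriv_space t _ s := hasDerivAt_freeKernel_space t s
  deriv_space₂ t _ s := by
    refine ((((hasDerivAt_id s).div_const (2 * Complex.I * t)).neg).mul
      (hasDerivAt_freeKernel_space t s)).congr_deriv ?_
    simp only [id, Pi.neg_apply]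
    ring
  deriv_time t ht s := by
    refine (hasDerivAt_freeKernel_time ht s).congr_deriv ?_
    have htc : (t : ℂ) ≠ 0 := by exact_mod_cast ht.ne'
    rw [← mul_assoc]
    congr 1
    field_simp
    ring
  continuous_space t _ := by
    have := continuous_freeKernel t
    fun_prop
  continuous_time s := by
    have h1 := continuousOn_freeKernel_time s
    have h2 : ContinuousOn (fun t : ℝ => (2 * Complex.I * t)⁻¹) (Ioi 0) := by
      refine ContinuousOn.inv₀ (by fun_prop) fun t ht => ?_
      simp [(show (0 : ℝ) < t from ht).ne']
    simp only [div_eq_mul_inv, one_mul]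
    fun_prop

/-- The part `s/(2it)` coming from `Λ' = 2wΛ - 2/√π` cancels the derivative of the Gaussian, leaving
`κ`; the constant term becomes `-2` times the free kernel. For `κ = 0` this exhibits an
antiderivative of the free kernel. -/
lemma hasDerivAt_lambdaKernel_space (κ : ℝ) {t : ℝ} (ht : 0 < t) (s : ℂ) :
    HasDerivAt (lambdaKernel κ t) (κ * lambdaKernel κ t s - 2 * freeKernel t s) s := by
  have hr := rootIT_ne_zero ht
  have hw : HasDerivAt (fun s : ℂ => s / (2 * rootIT t) + κ * rootIT t) (1 / (2 * rootIT t)) s :=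
    ((hasDerivAt_id s).div_const _).add_const _
  refine (((hasDerivAt_bigLambda _).comp s hw).mul
    (hasDerivAt_gaussPhase_space t s)).congr_deriv ?_
  have hsq : s / (2 * Complex.I * t) = s / (2 * rootIT t ^ 2) := by
    rw [rootIT_sq ht, mul_assoc]
  simp only [Function.comp, lambdaKernel, freeKernel]
  rw [hsq]
  have := sqrt_pi_ne_zero
  field_simp
  ring

lemma hasDerivAt_lambdaArg_time (κ : ℝ) {t : ℝ} (ht : 0 < t) (s : ℂ) :
    HasDerivAt (fun t => s / (2 * rootIT t) + κ * rootIT t)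
      (-(s / (4 * t * rootIT t)) + κ * rootIT t / (2 * t)) t := by
  have h := ((hasDerivAt_inv_rootIT ht).const_mul (s / 2)).add
    ((hasDerivAt_rootIT ht).const_mul (κ : ℂ))
  refine (h.congr_deriv ?_).congr_of_eventuallyEq (Eventually.of_forall fun τ => ?_)
  · simp only [div_eq_mul_inv, mul_inv]
    ring
  · simp only [Pi.add_apply, div_eq_mul_inv, mul_inv]
    ring

lemma hasDerivAt_lambdaKernel_time (κ : ℝ) {t : ℝ} (ht : 0 < t) (s : ℂ) :
    HasDerivAt (fun τ => lambdaKernel κ τ s)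
      (Complex.I * (κ ^ 2 * lambdaKernel κ t s + (s / (Complex.I * t) - 2 * κ) * freeKernel t s))
      t := by
  have hr := rootIT_ne_zero ht
  have htc : (t : ℂ) ≠ 0 := by exact_mod_cast ht.ne'
  refine (((hasDerivAt_bigLambda _).comp t (hasDerivAt_lambdaArg_time κ ht s)).mul
    (hasDerivAt_gaussPhase_time ht s)).congr_deriv ?_
  simp only [Function.comp, lambdaKernel, freeKernel]
  -- Eliminating `t` in favour of `r = √(it)` turns the claim into a rational identity in `r` and
  -- `I`.
  have hsq : (t : ℂ) = -Complex.I * rootIT t ^ 2 := by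
    rw [rootIT_sq ht]
    linear_combination (t : ℂ) * Complex.I_sq
  have := sqrt_pi_ne_zero
  generalize Complex.exp (-(s ^ 2 / (4 * Complex.I * t))) = e
  generalize bigLambda (s / (2 * rootIT t) + κ * rootIT t) = l
  rw [hsq]
  generalize rootIT t = r at *
  have hI := Complex.I_sq
  have hI4 : Complex.I ^ 4 = 1 := by linear_combination (Complex.I ^ 2 - 1) * hI
  field_simp
  ring_nf
  simp only [hI, hI4]
  ring

lemma continuousOn_lambdaKernel_time (κ : ℝ) (s : ℂ) :
    ContinuousOn (fun t => lambdaKernel κ t s) (Ioi 0) :=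
  fun _ ht => (hasDerivAt_lambdaKernel_time κ ht s).continuousAt.continuousWithinAt

lemma continuous_lambdaKernel (κ : ℝ) {t : ℝ} (ht : 0 < t) : Continuous (lambdaKernel κ t) :=
  continuous_iff_continuousAt.2 fun s => (hasDerivAt_lambdaKernel_space κ ht s).continuousAt

theorem isFreeSolution_lambdaKernel (κ : ℝ) :
    IsFreeSolution (lambdaKernel κ)
      (fun t s => κ * lambdaKernel κ t s - 2 * freeKernel t s)
      (fun t s => κ ^ 2 * lambdaKernel κ t s +
        (s / (Complex.I * t) - 2 * κ) * freeKernel t s) where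
  deriv_space t ht s := hasDerivAt_lambdaKernel_space κ ht s
  deriv_space₂ t ht s := by
    refine (((hasDerivAt_lambdaKernel_space κ ht s).const_mul (κ : ℂ)).sub
      ((hasDerivAt_freeKernel_space t s).const_mul 2)).congr_deriv ?_
    have htc : (t : ℂ) ≠ 0 := by exact_mod_cast ht.ne'
    field_simp
    ring
  deriv_time t ht s := hasDerivAt_lambdaKernel_time κ ht s
  continuous_space t ht := by
    have := continuous_freeKernel t
    have := continuous_lambdaKernel κ ht
    fun_prop
  continuous_time s := by
    have h1 := continuousOn_freeKernel_time s
    have h2 := continuousOn_lambdaKernel_time κ s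
    have h3 : ContinuousOn (fun t : ℝ => (Complex.I * t)⁻¹) (Ioi 0) := by
      refine ContinuousOn.inv₀ (by fun_prop) fun t ht => ?_
      simp [(show (0 : ℝ) < t from ht).ne']
    simp only [div_eq_mul_inv]
    fun_prop

/-! ### From free solutions to the Schrödinger equation off the origin -/

lemma isAC_of_hasDerivAt {f f' : ℝ → ℂ} {I : Set ℝ} (hI : I.OrdConnected) (hm : MeasurableSet I)
    (hf : ∀ x ∈ I, HasDerivAt f (f' x) x) (hc : ContinuousOn f' I) : IsAC f I := by
  refine ⟨f', hc.locallyIntegrableOn hm, fun x hx y hy => ?_⟩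
  have hs : uIcc x y ⊆ I := hI.uIcc_subset hx hy
  exact (intervalIntegral.integral_eq_sub_of_hasDerivAt (fun z hz => hf z (hs hz))
    ((hc.mono hs).intervalIntegrable)).symm

lemma isOpen_timeInterval (T : EReal) : IsOpen (timeInterval T) :=
  (isOpen_lt continuous_const continuous_id).inter
    (isOpen_lt continuous_coe_real_ereal continuous_const)

lemma ordConnected_timeInterval (T : EReal) : (timeInterval T).OrdConnected := by
  refine ⟨fun x hx y hy z hz => ⟨hx.1.trans_le hz.1, lt_of_le_of_lt ?_ hy.2⟩⟩
  exact EReal.coe_le_coe_iff.2 hz.2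

/-- A function which agrees with a free solution on each half-line. -/
structure GluesFreeSolutions (Ψ : ℝ → ℝ → ℂ) (P P₁ P₂ Q Q₁ Q₂ : ℝ → ℂ → ℂ) : Prop where
  pos_solution : IsFreeSolution P P₁ P₂
  neg_solution : IsFreeSolution Q Q₁ Q₂
  eq_pos : ∀ t, 0 < t → ∀ x : ℝ, 0 < x → Ψ t x = P t x
  eq_neg : ∀ t, 0 < t → ∀ x : ℝ, x < 0 → Ψ t x = Q t x

namespace GluesFreeSolutions

variable {Ψ : ℝ → ℝ → ℂ} {P P₁ P₂ Q Q₁ Q₂ : ℝ → ℂ → ℂ}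

lemma hasDerivAt_pos (h : GluesFreeSolutions Ψ P P₁ P₂ Q Q₁ Q₂) {t x : ℝ} (ht : 0 < t)
    (hx : 0 < x) : HasDerivAt (Ψ t) (P₁ t x) x :=
  (h.pos_solution.hasDerivAt_ofReal ht x).congr_of_eventuallyEq
    ((eventually_gt_nhds hx).mono fun y hy => h.eq_pos t ht y hy)

lemma hasDerivAt_neg (h : GluesFreeSolutions Ψ P P₁ P₂ Q Q₁ Q₂) {t x : ℝ} (ht : 0 < t)
    (hx : x < 0) : HasDerivAt (Ψ t) (Q₁ t x) x :=
  (h.neg_solution.hasDerivAt_ofReal ht x).congr_of_eventuallyEq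
    ((eventually_lt_nhds hx).mono fun y hy => h.eq_neg t ht y hy)

lemma hasDerivAt_deriv_pos (h : GluesFreeSolutions Ψ P P₁ P₂ Q Q₁ Q₂) {t x : ℝ} (ht : 0 < t)
    (hx : 0 < x) : HasDerivAt (deriv (Ψ t)) (P₂ t x) x :=
  (h.pos_solution.hasDerivAt_ofReal₂ ht x).congr_of_eventuallyEq
    ((eventually_gt_nhds hx).mono fun _ hy => (h.hasDerivAt_pos ht hy).deriv)

lemma hasDerivAt_deriv_neg (h : GluesFreeSolutions Ψ P P₁ P₂ Q Q₁ Q₂) {t x : ℝ} (ht : 0 < t)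
    (hx : x < 0) : HasDerivAt (deriv (Ψ t)) (Q₂ t x) x :=
  (h.neg_solution.hasDerivAt_ofReal₂ ht x).congr_of_eventuallyEq
    ((eventually_lt_nhds hx).mono fun _ hy => (h.hasDerivAt_neg ht hy).deriv)

lemma hasDerivAt_time_pos (h : GluesFreeSolutions Ψ P P₁ P₂ Q Q₁ Q₂) {t x : ℝ} (ht : 0 < t)
    (hx : 0 < x) : HasDerivAt (fun s => Ψ s x) (Complex.I * P₂ t x) t :=
  (h.pos_solution.deriv_time t ht x).congr_of_eventuallyEq
    ((eventually_gt_nhds ht).mono fun s hs => h.eq_pos s hs x hx)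

lemma hasDerivAt_time_neg (h : GluesFreeSolutions Ψ P P₁ P₂ Q Q₁ Q₂) {t x : ℝ} (ht : 0 < t)
    (hx : x < 0) : HasDerivAt (fun s => Ψ s x) (Complex.I * Q₂ t x) t :=
  (h.neg_solution.deriv_time t ht x).congr_of_eventuallyEq
    ((eventually_gt_nhds ht).mono fun s hs => h.eq_neg s hs x hx)

theorem isAC12 (h : GluesFreeSolutions Ψ P P₁ P₂ Q Q₁ Q₂) (T : EReal) : IsAC12 T Ψ := by
  have hsub : timeInterval T ⊆ Ioi 0 := fun t ht => ht.1
  refine ⟨fun x hx => ?_, fun t ht => ⟨fun x hx => ?_, ⟨?_, ?_⟩, ?_, ?_⟩⟩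
  · have ho := ordConnected_timeInterval T
    have hm := (isOpen_timeInterval T).measurableSet
    rcases lt_or_gt_of_ne (show x ≠ 0 from hx) with hx | hx
    · exact isAC_of_hasDerivAt ho hm (fun t ht => h.hasDerivAt_time_neg ht.1 hx)
        (((h.neg_solution.continuous_time x).mono hsub).const_mul Complex.I)
    · exact isAC_of_hasDerivAt ho hm (fun t ht => h.hasDerivAt_time_pos ht.1 hx)
        (((h.pos_solution.continuous_time x).mono hsub).const_mul Complex.I)
  · rcases lt_or_gt_of_ne (show x ≠ 0 from hx) with hx | hx
    · exact (h.hasDerivAt_neg ht.1 hx).differentiableAt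
    · exact (h.hasDerivAt_pos ht.1 hx).differentiableAt
  · exact isAC_of_hasDerivAt ordConnected_Iio measurableSet_Iio
      (fun x hx => h.hasDerivAt_neg ht.1 hx)
      fun x _ => (h.neg_solution.hasDerivAt_ofReal₂ ht.1 x).continuousAt.continuousWithinAt
  · exact isAC_of_hasDerivAt ordConnected_Ioi measurableSet_Ioi
      (fun x hx => h.hasDerivAt_pos ht.1 hx)
      fun x _ => (h.pos_solution.hasDerivAt_ofReal₂ ht.1 x).continuousAt.continuousWithinAt
  · exact isAC_of_hasDerivAt ordConnected_Iio measurableSet_Iio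
      (fun x hx => h.hasDerivAt_deriv_neg ht.1 hx)
      ((h.neg_solution.continuous_space t ht.1).comp Complex.continuous_ofReal).continuousOn
  · exact isAC_of_hasDerivAt ordConnected_Ioi measurableSet_Ioi
      (fun x hx => h.hasDerivAt_deriv_pos ht.1 hx)
      ((h.pos_solution.continuous_space t ht.1).comp Complex.continuous_ofReal).continuousOn

theorem solvesSchrodinger (h : GluesFreeSolutions Ψ P P₁ P₂ Q Q₁ Q₂) (T : EReal) :
    SolvesSchrodinger T (fun _ _ => 0) Ψ := by
  refine Eventually.of_forall fun q ht hx => ?_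
  rcases lt_or_gt_of_ne (show q.2 ≠ 0 from hx) with hx | hx
  · refine ⟨_, _, h.hasDerivAt_time_neg ht.1 hx, h.hasDerivAt_deriv_neg ht.1 hx, ?_⟩
    linear_combination Q₂ q.1 q.2 * Complex.I_sq
  · refine ⟨_, _, h.hasDerivAt_time_pos ht.1 hx, h.hasDerivAt_deriv_pos ht.1 hx, ?_⟩
    linear_combination P₂ q.1 q.2 * Complex.I_sq

/-- The solutions glued together extend differentiably across the origin, so the one-sided limits
are their values at `0`. -/
theorem transmissionCondition (h : GluesFreeSolutions Ψ P P₁ P₂ Q Q₁ Q₂) {t : ℝ} (ht : 0 < t)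
    {M N : Matrix (Fin 2) (Fin 2) ℂ}
    (hB : BoundaryRelation M N (P t 0) (Q t 0) (P₁ t 0) (Q₁ t 0)) :
    TransmissionCondition M N (Ψ t) := by
  refine ⟨_, _, _, _, ?_, ?_, ?_, ?_, hB⟩
  · have := (h.pos_solution.hasDerivAt_ofReal ht 0).continuousAt.tendsto.mono_left
      (nhdsWithin_le_nhds (s := Ioi 0))
    simp only [Complex.ofReal_zero] at this
    exact this.congr' (eventually_mem_nhdsWithin.mono fun x hx => (h.eq_pos t ht x hx).symm)
  · have := (h.neg_solution.hasDerivAt_ofReal ht 0).continuousAt.tendsto.mono_left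
      (nhdsWithin_le_nhds (s := Iio 0))
    simp only [Complex.ofReal_zero] at this
    exact this.congr' (eventually_mem_nhdsWithin.mono fun x hx => (h.eq_neg t ht x hx).symm)
  · have := (h.pos_solution.hasDerivAt_ofReal₂ ht 0).continuousAt.tendsto.mono_left
      (nhdsWithin_le_nhds (s := Ioi 0))
    simp only [Complex.ofReal_zero] at this
    exact this.congr' (eventually_mem_nhdsWithin.mono fun x hx =>
      (h.hasDerivAt_pos ht hx).deriv.symm)
  · have := (h.neg_solution.hasDerivAt_ofReal₂ ht 0).continuousAt.tendsto.mono_left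
      (nhdsWithin_le_nhds (s := Iio 0))
    simp only [Complex.ofReal_zero] at this
    exact this.congr' (eventually_mem_nhdsWithin.mono fun x hx =>
      (h.hasDerivAt_neg ht hx).deriv.symm)

end GluesFreeSolutions

/-! ### Layers and their amplitudes -/

/-- A combination of the elementary solutions of the free Schrödinger equation. -/
noncomputable def layer (a b c : ℂ) (κ ν t : ℝ) (s : ℂ) : ℂ :=
  a * lambdaKernel κ t s + b * lambdaKernel ν t s + c * freeKernel t s

/-- The space derivative of `layer`. -/
noncomputable def layerDeriv (a b c : ℂ) (κ ν t : ℝ) (s : ℂ) : ℂ :=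
  a * (κ * lambdaKernel κ t s - 2 * freeKernel t s) +
    b * (ν * lambdaKernel ν t s - 2 * freeKernel t s) +
    c * (-(s / (2 * Complex.I * t)) * freeKernel t s)

lemma exists_isFreeSolution_layer (a b c : ℂ) (κ ν : ℝ) :
    ∃ F₂, IsFreeSolution (layer a b c κ ν) (layerDeriv a b c κ ν) F₂ :=
  ⟨_, (((isFreeSolution_lambdaKernel κ).const_mul a).add
    ((isFreeSolution_lambdaKernel ν).const_mul b)).add (isFreeSolution_freeKernel.const_mul c)⟩

/-- The coefficient of the Gaussian phase in `layer`. -/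
noncomputable def amplitude (a b c : ℂ) (κ ν t : ℝ) (s : ℂ) : ℂ :=
  a * bigLambda (s / (2 * rootIT t) + κ * rootIT t) +
    b * bigLambda (s / (2 * rootIT t) + ν * rootIT t) +
    c / (2 * (√Real.pi : ℂ)) * (rootIT t)⁻¹

lemma layer_eq_amplitude_mul (a b c : ℂ) (κ ν t : ℝ) (s : ℂ) :
    layer a b c κ ν t s =
      amplitude a b c κ ν t s * Complex.exp (-(s ^ 2 / (4 * Complex.I * t))) := by
  simp only [layer, amplitude, lambdaKernel, freeKernel, mul_inv, div_eq_mul_inv]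
  ring

/-- The first space derivative of `amplitude`. -/
noncomputable def amplitudeDeriv (a b : ℂ) (κ ν t : ℝ) (s : ℂ) : ℂ :=
  a * (deriv bigLambda (s / (2 * rootIT t) + κ * rootIT t) * (2 * rootIT t)⁻¹) +
    b * (deriv bigLambda (s / (2 * rootIT t) + ν * rootIT t) * (2 * rootIT t)⁻¹)

/-- The second space derivative of `amplitude`. -/
noncomputable def amplitudeDeriv₂ (a b : ℂ) (κ ν t : ℝ) (s : ℂ) : ℂ :=
  a * (deriv (deriv bigLambda) (s / (2 * rootIT t) + κ * rootIT t) * (2 * rootIT t)⁻¹ ^ 2) +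
    b * (deriv (deriv bigLambda) (s / (2 * rootIT t) + ν * rootIT t) * (2 * rootIT t)⁻¹ ^ 2)

/-- The time derivative of `amplitude`. -/
noncomputable def amplitudeTime (a b c : ℂ) (κ ν t : ℝ) (s : ℂ) : ℂ :=
  a * (deriv bigLambda (s / (2 * rootIT t) + κ * rootIT t) *
      (-(s / (4 * t * rootIT t)) + κ * rootIT t / (2 * t))) +
    b * (deriv bigLambda (s / (2 * rootIT t) + ν * rootIT t) *
      (-(s / (4 * t * rootIT t)) + ν * rootIT t / (2 * t))) +
    c / (2 * (√Real.pi : ℂ)) * (-((rootIT t)⁻¹ / (2 * t)))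

lemma hasDerivAt_lambdaArg_space (κ t : ℝ) (s : ℂ) :
    HasDerivAt (fun s : ℂ => s / (2 * rootIT t) + κ * rootIT t) (2 * rootIT t)⁻¹ s := by
  simpa using ((hasDerivAt_id s).div_const (2 * rootIT t)).add_const (κ * rootIT t)

lemma hasDerivAt_amplitude (a b c : ℂ) (κ ν t : ℝ) (s : ℂ) :
    HasDerivAt (amplitude a b c κ ν t) (amplitudeDeriv a b κ ν t s) s := by
  have h (μ : ℝ) := ((differentiable_bigLambda _).hasDerivAt).comp s
    (hasDerivAt_lambdaArg_space μ t s)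
  exact (((h κ).const_mul a).add ((h ν).const_mul b)).add_const _

lemma hasDerivAt_amplitudeDeriv (a b : ℂ) (κ ν t : ℝ) (s : ℂ) :
    HasDerivAt (amplitudeDeriv a b κ ν t) (amplitudeDeriv₂ a b κ ν t s) s := by
  have h (μ : ℝ) := (((differentiable_deriv_bigLambda _).hasDerivAt).comp s
    (hasDerivAt_lambdaArg_space μ t s)).mul_const (2 * rootIT t)⁻¹
  refine (((h κ).const_mul a).add ((h ν).const_mul b)).congr_deriv ?_
  rw [amplitudeDeriv₂]
  ring

lemma hasDerivAt_amplitude_time (a b c : ℂ) (κ ν : ℝ) {t : ℝ} (ht : 0 < t) (s : ℂ) :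
    HasDerivAt (fun τ => amplitude a b c κ ν τ s) (amplitudeTime a b c κ ν t s) t := by
  have h (μ : ℝ) := ((differentiable_bigLambda _).hasDerivAt).comp t
    (hasDerivAt_lambdaArg_time μ ht s)
  exact (((h κ).const_mul a).add ((h ν).const_mul b)).add ((hasDerivAt_inv_rootIT ht).const_mul _)

/-- The layer amplitude with the remaining oscillating factor, plus the free contribution. -/
noncomputable def reducedAmplitude (a b c : ℂ) (κ ν : ℝ) (d ζ : ℂ) (t : ℝ) (q : ℂ) : ℂ :=
  amplitude a b c κ ν t (q + ζ) * Complex.exp (d * ζ * q * (t : ℂ)⁻¹) +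
    1 / (2 * (√Real.pi : ℂ)) * (rootIT t)⁻¹

/-- The first space derivative of `reducedAmplitude`. -/
noncomputable def reducedAmplitudeDeriv (a b c : ℂ) (κ ν : ℝ) (d ζ : ℂ) (t : ℝ) (q : ℂ) : ℂ :=
  (amplitudeDeriv a b κ ν t (q + ζ) + amplitude a b c κ ν t (q + ζ) * (d * ζ * (t : ℂ)⁻¹)) *
    Complex.exp (d * ζ * q * (t : ℂ)⁻¹)

/-- The second space derivative of `reducedAmplitude`. -/
noncomputable def reducedAmplitudeDeriv₂ (a b c : ℂ) (κ ν : ℝ) (d ζ : ℂ) (t : ℝ) (q : ℂ) : ℂ :=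
  (amplitudeDeriv₂ a b κ ν t (q + ζ) + 2 * amplitudeDeriv a b κ ν t (q + ζ) * (d * ζ * (t : ℂ)⁻¹) +
    amplitude a b c κ ν t (q + ζ) * (d * ζ * (t : ℂ)⁻¹) ^ 2) *
    Complex.exp (d * ζ * q * (t : ℂ)⁻¹)

/-- The time derivative of `reducedAmplitude`. -/
noncomputable def reducedAmplitudeTime (a b c : ℂ) (κ ν : ℝ) (d ζ : ℂ) (t : ℝ) (q : ℂ) : ℂ :=
  (amplitudeTime a b c κ ν t (q + ζ) -
    amplitude a b c κ ν t (q + ζ) * (d * ζ * q * (t : ℂ)⁻¹ ^ 2)) *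
    Complex.exp (d * ζ * q * (t : ℂ)⁻¹) + 1 / (2 * (√Real.pi : ℂ)) * (-((rootIT t)⁻¹ / (2 * t)))

lemma hasDerivAt_phase_space (d ζ : ℂ) (t : ℝ) (q : ℂ) :
    HasDerivAt (fun q : ℂ => Complex.exp (d * ζ * q * (t : ℂ)⁻¹))
      ((d * ζ * (t : ℂ)⁻¹) * Complex.exp (d * ζ * q * (t : ℂ)⁻¹)) q := by
  refine (((hasDerivAt_id q).const_mul (d * ζ)).mul_const (t : ℂ)⁻¹).cexp.congr_deriv ?_
  simp only [id]
  ring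

lemma hasDerivAt_phase_time (d ζ : ℂ) {t : ℝ} (ht : 0 < t) (q : ℂ) :
    HasDerivAt (fun t : ℝ => Complex.exp (d * ζ * q * (t : ℂ)⁻¹))
      (-(d * ζ * q * (t : ℂ)⁻¹ ^ 2) * Complex.exp (d * ζ * q * (t : ℂ)⁻¹)) t := by
  have htc : (t : ℂ) ≠ 0 := by exact_mod_cast ht.ne'
  have h1 : HasDerivAt (fun t : ℝ => (t : ℂ)) 1 t := Complex.ofRealCLM.hasDerivAt
  refine ((h1.inv htc).const_mul (d * ζ * q)).cexp.congr_deriv ?_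
  simp only [Pi.inv_apply]
  field_simp

lemma hasDerivAt_reducedAmplitude (a b c : ℂ) (κ ν : ℝ) (d ζ : ℂ) (t : ℝ) (q : ℂ) :
    HasDerivAt (reducedAmplitude a b c κ ν d ζ t) (reducedAmplitudeDeriv a b c κ ν d ζ t q) q := by
  refine ((((hasDerivAt_amplitude a b c κ ν t (q + ζ)).comp_add_const q ζ).mul
    (hasDerivAt_phase_space d ζ t q)).add_const _).congr_deriv ?_
  rw [reducedAmplitudeDeriv]
  ring

lemma hasDerivAt_reducedAmplitudeDeriv (a b c : ℂ) (κ ν : ℝ) (d ζ : ℂ) (t : ℝ) (q : ℂ) :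
    HasDerivAt (reducedAmplitudeDeriv a b c κ ν d ζ t)
      (reducedAmplitudeDeriv₂ a b c κ ν d ζ t q) q := by
  have h1 := (hasDerivAt_amplitude a b c κ ν t (q + ζ)).comp_add_const q ζ
  have h2 := (hasDerivAt_amplitudeDeriv a b κ ν t (q + ζ)).comp_add_const q ζ
  refine ((h2.add (h1.mul_const (d * ζ * (t : ℂ)⁻¹))).mul
    (hasDerivAt_phase_space d ζ t q)).congr_deriv ?_
  simp only [reducedAmplitudeDeriv₂, Pi.add_apply]
  ring

lemma hasDerivAt_reducedAmplitude_time (a b c : ℂ) (κ ν : ℝ) (d ζ : ℂ) {t : ℝ} (ht : 0 < t)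
    (q : ℂ) : HasDerivAt (fun τ => reducedAmplitude a b c κ ν d ζ τ q)
      (reducedAmplitudeTime a b c κ ν d ζ t q) t := by
  refine (((hasDerivAt_amplitude_time a b c κ ν ht (q + ζ)).mul
    (hasDerivAt_phase_time d ζ ht q)).add
    ((hasDerivAt_inv_rootIT ht).const_mul (1 / (2 * (√Real.pi : ℂ))))).congr_deriv ?_
  rw [reducedAmplitudeTime]
  ring

/-! ### Bounds on the amplitudes -/

/-- For `s` in the closed first quadrant the first summand has nonnegative real part, so only
`κ√(it)` can push the argument to the left. The half-plane bounds for `Λ` then apply with `c = W√t`,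
uniformly in `s`. -/
lemma re_lambdaArg_ge {W κ t : ℝ} (hκ : |κ| ≤ W) (ht : 0 < t) {s : ℂ} (h1 : 0 ≤ s.re)
    (h2 : 0 ≤ s.im) : -(W * √t) ≤ (s / (2 * rootIT t) + κ * rootIT t).re := by
  rw [Complex.add_re, re_div_two_rootIT ht, Complex.re_ofReal_mul, rootIT_re]
  have h3 : √(t / 2) ≤ √t := Real.sqrt_le_sqrt (by linarith)
  have h4 : 0 ≤ (s.re + s.im) / (4 * √(t / 2)) := by positivity
  have h5 : -(|κ| * √(t / 2)) ≤ κ * √(t / 2) := by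
    rw [← neg_mul]
    exact mul_le_mul_of_nonneg_right (neg_abs_le κ) (Real.sqrt_nonneg _)
  have hW : 0 ≤ W := (abs_nonneg κ).trans hκ
  have h6 : |κ| * √(t / 2) ≤ W * √t := by gcongr
  linarith

/-- A common bound for `Λ` and its first two derivatives on a half-plane. -/
noncomputable def lambdaBound (W t : ℝ) : ℝ := 2 * Real.exp ((W * √t + 2) ^ 2)

lemma lambdaBound_pos (W t : ℝ) : 0 < lambdaBound W t := by
  unfold lambdaBound
  positivity

lemma continuous_lambdaBound (W : ℝ) : Continuous (lambdaBound W) := by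
  unfold lambdaBound
  fun_prop

/-- The `+ 2` in `lambdaBound` pays for the two Cauchy estimates behind the second derivative, and
so covers the other two bounds as well. -/
lemma norm_bigLambda_lambdaArg_le {W κ t : ℝ} (hκ : |κ| ≤ W) (ht : 0 < t) {s : ℂ}
    (h1 : 0 ≤ s.re) (h2 : 0 ≤ s.im) :
    ‖bigLambda (s / (2 * rootIT t) + κ * rootIT t)‖ ≤ lambdaBound W t ∧
    ‖deriv bigLambda (s / (2 * rootIT t) + κ * rootIT t)‖ ≤ lambdaBound W t ∧
    ‖deriv (deriv bigLambda) (s / (2 * rootIT t) + κ * rootIT t)‖ ≤ lambdaBound W t := by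
  have h := re_lambdaArg_ge hκ ht h1 h2
  have hW : 0 ≤ W * √t := mul_nonneg ((abs_nonneg κ).trans hκ) (Real.sqrt_nonneg _)
  refine ⟨(norm_bigLambda_le h).trans ?_, (norm_deriv_bigLambda_le h).trans ?_,
    norm_deriv_deriv_bigLambda_le h⟩
  · unfold lambdaBound
    gcongr
    linarith
  · unfold lambdaBound
    gcongr
    linarith

lemma norm_inv_rootIT {t : ℝ} (ht : 0 < t) : ‖(rootIT t)⁻¹‖ = (√t)⁻¹ := by
  rw [norm_inv, norm_rootIT ht]

lemma norm_div_two_sqrt_pi_le (c : ℂ) : ‖c / (2 * (√Real.pi : ℂ))‖ ≤ ‖c‖ := by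
  have hpi1 : 1 ≤ √Real.pi := by
    rw [Real.one_le_sqrt]
    linarith [Real.pi_gt_three]
  rw [norm_div]
  refine div_le_self (norm_nonneg _) ?_
  simp only [norm_mul, Complex.norm_real, Real.norm_eq_abs, abs_of_nonneg (Real.sqrt_nonneg _)]
  norm_num
  linarith

section Bounds

variable {W m κ ν t : ℝ} {a b c s : ℂ}

lemma norm_amplitude_le (hκ : |κ| ≤ W) (hν : |ν| ≤ W) (ha : ‖a‖ ≤ m) (hb : ‖b‖ ≤ m)
    (hc : ‖c‖ ≤ m) (ht : 0 < t) (h1 : 0 ≤ s.re) (h2 : 0 ≤ s.im) :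
    ‖amplitude a b c κ ν t s‖ ≤ 2 * m * lambdaBound W t + m * (√t)⁻¹ := by
  have hm : 0 ≤ m := (norm_nonneg _).trans ha
  have hk := (norm_bigLambda_lambdaArg_le hκ ht h1 h2).1
  have hn := (norm_bigLambda_lambdaArg_le hν ht h1 h2).1
  have e1 : ‖a * bigLambda (s / (2 * rootIT t) + κ * rootIT t)‖ ≤ m * lambdaBound W t := by
    rw [norm_mul]
    gcongr
  have e2 : ‖b * bigLambda (s / (2 * rootIT t) + ν * rootIT t)‖ ≤ m * lambdaBound W t := by
    rw [norm_mul]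
    gcongr
  have e3 : ‖c / (2 * (√Real.pi : ℂ)) * (rootIT t)⁻¹‖ ≤ m * (√t)⁻¹ := by
    rw [norm_mul, norm_inv_rootIT ht]
    gcongr
    exact (norm_div_two_sqrt_pi_le c).trans hc
  calc _ ≤ _ := norm_add₃_le
    _ ≤ m * lambdaBound W t + m * lambdaBound W t + m * (√t)⁻¹ := by gcongr
    _ = _ := by ring

lemma norm_inv_two_rootIT_le (ht : 0 < t) : ‖(2 * rootIT t)⁻¹‖ ≤ (√t)⁻¹ := by
  rw [mul_inv, norm_mul, norm_inv_rootIT ht]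
  have : 0 ≤ (√t)⁻¹ := by positivity
  norm_num
  linarith

lemma norm_amplitudeDeriv_le (hκ : |κ| ≤ W) (hν : |ν| ≤ W) (ha : ‖a‖ ≤ m) (hb : ‖b‖ ≤ m)
    (ht : 0 < t) (h1 : 0 ≤ s.re) (h2 : 0 ≤ s.im) :
    ‖amplitudeDeriv a b κ ν t s‖ ≤ 2 * m * lambdaBound W t * (√t)⁻¹ := by
  have hm : 0 ≤ m := (norm_nonneg _).trans ha
  have hL := (lambdaBound_pos W t).le
  have hk := (norm_bigLambda_lambdaArg_le hκ ht h1 h2).2.1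
  have hn := (norm_bigLambda_lambdaArg_le hν ht h1 h2).2.1
  have hr := norm_inv_two_rootIT_le ht
  have e1 : ‖a * (deriv bigLambda (s / (2 * rootIT t) + κ * rootIT t) * (2 * rootIT t)⁻¹)‖ ≤
      m * (lambdaBound W t * (√t)⁻¹) := by
    rw [norm_mul, norm_mul]
    gcongr
  have e2 : ‖b * (deriv bigLambda (s / (2 * rootIT t) + ν * rootIT t) * (2 * rootIT t)⁻¹)‖ ≤
      m * (lambdaBound W t * (√t)⁻¹) := by
    rw [norm_mul, norm_mul]
    gcongr
  calc _ ≤ _ := norm_add_le _ _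
    _ ≤ m * (lambdaBound W t * (√t)⁻¹) + m * (lambdaBound W t * (√t)⁻¹) := by gcongr
    _ = _ := by ring

lemma norm_amplitudeDeriv₂_le (hκ : |κ| ≤ W) (hν : |ν| ≤ W) (ha : ‖a‖ ≤ m) (hb : ‖b‖ ≤ m)
    (ht : 0 < t) (h1 : 0 ≤ s.re) (h2 : 0 ≤ s.im) :
    ‖amplitudeDeriv₂ a b κ ν t s‖ ≤ 2 * m * lambdaBound W t * (√t)⁻¹ ^ 2 := by
  have hm : 0 ≤ m := (norm_nonneg _).trans ha
  have hL := (lambdaBound_pos W t).le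
  have hk := (norm_bigLambda_lambdaArg_le hκ ht h1 h2).2.2
  have hn := (norm_bigLambda_lambdaArg_le hν ht h1 h2).2.2
  have hr := norm_inv_two_rootIT_le ht
  have e1 : ‖a * (deriv (deriv bigLambda) (s / (2 * rootIT t) + κ * rootIT t) *
      (2 * rootIT t)⁻¹ ^ 2)‖ ≤ m * (lambdaBound W t * (√t)⁻¹ ^ 2) := by
    rw [norm_mul, norm_mul, norm_pow]
    gcongr
  have e2 : ‖b * (deriv (deriv bigLambda) (s / (2 * rootIT t) + ν * rootIT t) *
      (2 * rootIT t)⁻¹ ^ 2)‖ ≤ m * (lambdaBound W t * (√t)⁻¹ ^ 2) := by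
    rw [norm_mul, norm_mul, norm_pow]
    gcongr
  calc _ ≤ _ := norm_add_le _ _
    _ ≤ m * (lambdaBound W t * (√t)⁻¹ ^ 2) + m * (lambdaBound W t * (√t)⁻¹ ^ 2) := by gcongr
    _ = _ := by ring

lemma norm_lambdaArg_time_le (hκ : |κ| ≤ W) (ht : 0 < t) :
    ‖-(s / (4 * t * rootIT t)) + κ * rootIT t / (2 * t)‖ ≤
      ‖s‖ * (t⁻¹ * (√t)⁻¹) + W * (√t * t⁻¹) := by
  have hW : 0 ≤ W := (abs_nonneg κ).trans hκ
  have e1 : ‖s / (4 * t * rootIT t)‖ ≤ ‖s‖ * (t⁻¹ * (√t)⁻¹) := by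
    rw [norm_div, norm_mul, norm_mul, norm_rootIT ht, div_eq_mul_inv, mul_inv, mul_inv]
    simp only [Complex.norm_real, Real.norm_eq_abs, abs_of_pos ht]
    gcongr
    have : 0 < t⁻¹ := by positivity
    norm_num
    linarith
  have e2 : ‖κ * rootIT t / (2 * t)‖ ≤ W * (√t * t⁻¹) := by
    rw [norm_div, norm_mul, norm_mul, norm_rootIT ht, div_eq_mul_inv, mul_inv, mul_assoc]
    simp only [Complex.norm_real, Real.norm_eq_abs, abs_of_pos ht]
    gcongr
    have : 0 < t⁻¹ := by positivity
    norm_num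
    linarith
  calc _ ≤ _ := norm_add_le _ _
    _ ≤ _ := by
      rw [norm_neg]
      gcongr

lemma norm_inv_rootIT_deriv_le (ht : 0 < t) :
    ‖-((rootIT t)⁻¹ / (2 * t))‖ ≤ t⁻¹ * (√t)⁻¹ := by
  rw [norm_neg, norm_div, norm_inv_rootIT ht, norm_mul, Complex.norm_real, Real.norm_eq_abs,
    abs_of_pos ht, div_eq_mul_inv, mul_inv]
  have : 0 < t⁻¹ * (√t)⁻¹ := by positivity
  norm_num
  nlinarith

lemma norm_amplitudeTime_le (hκ : |κ| ≤ W) (hν : |ν| ≤ W) (ha : ‖a‖ ≤ m) (hb : ‖b‖ ≤ m)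
    (hc : ‖c‖ ≤ m) (ht : 0 < t) (h1 : 0 ≤ s.re) (h2 : 0 ≤ s.im) :
    ‖amplitudeTime a b c κ ν t s‖ ≤
      2 * m * lambdaBound W t * (‖s‖ * (t⁻¹ * (√t)⁻¹) + W * (√t * t⁻¹)) +
        m * (t⁻¹ * (√t)⁻¹) := by
  have hm : 0 ≤ m := (norm_nonneg _).trans ha
  have hL := (lambdaBound_pos W t).le
  have hk := (norm_bigLambda_lambdaArg_le hκ ht h1 h2).2.1
  have hn := (norm_bigLambda_lambdaArg_le hν ht h1 h2).2.1
  have hk' := norm_lambdaArg_time_le (s := s) hκ ht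
  have hn' := norm_lambdaArg_time_le (s := s) hν ht
  set R := ‖s‖ * (t⁻¹ * (√t)⁻¹) + W * (√t * t⁻¹)
  have e1 : ‖a * (deriv bigLambda (s / (2 * rootIT t) + κ * rootIT t) *
      (-(s / (4 * t * rootIT t)) + κ * rootIT t / (2 * t)))‖ ≤ m * (lambdaBound W t * R) := by
    rw [norm_mul, norm_mul]
    gcongr
  have e2 : ‖b * (deriv bigLambda (s / (2 * rootIT t) + ν * rootIT t) *
      (-(s / (4 * t * rootIT t)) + ν * rootIT t / (2 * t)))‖ ≤ m * (lambdaBound W t * R) := by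
    rw [norm_mul, norm_mul]
    gcongr
  have e3 : ‖c / (2 * (√Real.pi : ℂ)) * (-((rootIT t)⁻¹ / (2 * t)))‖ ≤ m * (t⁻¹ * (√t)⁻¹) := by
    rw [norm_mul]
    gcongr
    · exact (norm_div_two_sqrt_pi_le c).trans hc
    · exact norm_inv_rootIT_deriv_le ht
  calc _ ≤ _ := norm_add₃_le
    _ ≤ m * (lambdaBound W t * R) + m * (lambdaBound W t * R) + m * (t⁻¹ * (√t)⁻¹) := by gcongr
    _ = _ := by ring

/-- The bound on the layer amplitude. -/
noncomputable def amplitudeBound (m W t : ℝ) : ℝ := 2 * m * lambdaBound W t + m * (√t)⁻¹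

/-- The coefficient bounding the reduced Green's function. -/
noncomputable def boundZero (m W t : ℝ) : ℝ := amplitudeBound m W t + (√t)⁻¹

/-- The coefficient bounding the space derivative of the reduced Green's function. -/
noncomputable def boundOne (m W t : ℝ) : ℝ :=
  2 * m * lambdaBound W t * (√t)⁻¹ + amplitudeBound m W t * t⁻¹

/-- The coefficient bounding the second space derivative of the reduced Green's function. -/
noncomputable def boundSpace (m W t : ℝ) : ℝ :=
  2 * m * lambdaBound W t * (√t)⁻¹ ^ 2 + 2 * (2 * m * lambdaBound W t * (√t)⁻¹) * t⁻¹ +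
    amplitudeBound m W t * (2 * t⁻¹ ^ 2)

/-- The coefficient bounding the time derivative of the reduced Green's function. -/
noncomputable def boundTime (m W t x : ℝ) : ℝ :=
  2 * m * lambdaBound W t * ((|x| + 1) * (t⁻¹ * (√t)⁻¹) + W * (√t * t⁻¹)) +
    m * (t⁻¹ * (√t)⁻¹) + amplitudeBound m W t * (|x| * t⁻¹ ^ 2) + t⁻¹ * (√t)⁻¹

lemma amplitudeBound_nonneg (hm : 0 ≤ m) : 0 ≤ amplitudeBound m W t := by
  have hL := (lambdaBound_pos W t).le
  unfold amplitudeBound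
  positivity

lemma boundZero_nonneg (hm : 0 ≤ m) : 0 ≤ boundZero m W t := by
  have := amplitudeBound_nonneg (W := W) (t := t) hm
  unfold boundZero
  positivity

lemma boundOne_nonneg (hm : 0 ≤ m) (ht : 0 < t) : 0 ≤ boundOne m W t := by
  have hL := (lambdaBound_pos W t).le
  have := amplitudeBound_nonneg (W := W) (t := t) hm
  unfold boundOne
  positivity

lemma boundSpace_nonneg (hm : 0 ≤ m) (ht : 0 < t) : 0 ≤ boundSpace m W t := by
  have hL := (lambdaBound_pos W t).le
  have := amplitudeBound_nonneg (W := W) (t := t) hm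
  unfold boundSpace
  positivity

lemma boundTime_nonneg (hm : 0 ≤ m) (hW : 0 ≤ W) (ht : 0 < t) (x : ℝ) :
    0 ≤ boundTime m W t x := by
  have hL := (lambdaBound_pos W t).le
  have := amplitudeBound_nonneg (W := W) (t := t) hm
  unfold boundTime
  positivity

variable {d ζ : ℂ} {q : ℝ}

/-- For `d = I` the exponent has real part `-q Im ζ / t ≤ 0`: the phase left over after removing the
Gaussian does not grow in the sector. -/
lemma norm_phase_le (hd : d = 0 ∨ d = Complex.I) (ht : 0 < t) (hζ : 0 ≤ ζ.im) (hq : 0 ≤ q) :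
    ‖Complex.exp (d * ζ * q * (t : ℂ)⁻¹)‖ ≤ 1 := by
  rw [Complex.norm_exp, ← Complex.ofReal_inv]
  rcases hd with rfl | rfl
  · simp
  · rw [mul_assoc, ← Complex.ofReal_mul, Complex.re_mul_ofReal, Real.exp_le_one_iff]
    have : 0 ≤ q * t⁻¹ := by positivity
    simp only [Complex.mul_re, Complex.I_re, Complex.I_im, zero_mul, one_mul, zero_sub]
    nlinarith

lemma norm_phase_coeff_le (hd : d = 0 ∨ d = Complex.I) : ‖d‖ ≤ 1 := by
  rcases hd with rfl | rfl <;> simp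

lemma norm_reducedAmplitude_le (hκ : |κ| ≤ W) (hν : |ν| ≤ W) (ha : ‖a‖ ≤ m) (hb : ‖b‖ ≤ m)
    (hc : ‖c‖ ≤ m) (hd : d = 0 ∨ d = Complex.I) (ht : 0 < t) (h1 : 0 ≤ ζ.re) (h2 : 0 ≤ ζ.im)
    (hq : 0 ≤ q) : ‖reducedAmplitude a b c κ ν d ζ t q‖ ≤ boundZero m W t := by
  have hm : 0 ≤ m := (norm_nonneg _).trans ha
  have hP := norm_amplitude_le (s := q + ζ) hκ hν ha hb hc ht (by simp; positivity) (by simpa)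
  have hE := norm_phase_le hd ht h2 hq
  have hA := amplitudeBound_nonneg (W := W) (t := t) hm
  have e : ‖1 / (2 * (√Real.pi : ℂ)) * (rootIT t)⁻¹‖ ≤ (√t)⁻¹ := by
    rw [norm_mul, norm_inv_rootIT ht]
    have := norm_div_two_sqrt_pi_le 1
    rw [norm_one] at this
    exact mul_le_of_le_one_left (by positivity) this
  calc _ ≤ _ := norm_add_le _ _
    _ ≤ amplitudeBound m W t * 1 + (√t)⁻¹ := by
      rw [norm_mul]
      gcongr
      exact hP
    _ = _ := by rw [mul_one, boundZero]

lemma norm_phase_factor_le (hd : d = 0 ∨ d = Complex.I) (ht : 0 < t) :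
    ‖d * ζ * (t : ℂ)⁻¹‖ ≤ ‖ζ‖ * t⁻¹ := by
  rw [norm_mul, norm_mul, norm_inv, Complex.norm_real, Real.norm_eq_abs, abs_of_pos ht]
  gcongr
  exact mul_le_of_le_one_left (norm_nonneg _) (norm_phase_coeff_le hd)

/-- Differentiating the phase brings down `ζ/t`. Since order `1` growth is allowed, `‖ζ‖` is
absorbed into `e^{‖ζ‖}` and the coefficient depends on `t` alone. -/
lemma norm_reducedAmplitudeDeriv_le (hκ : |κ| ≤ W) (hν : |ν| ≤ W) (ha : ‖a‖ ≤ m)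
    (hb : ‖b‖ ≤ m) (hc : ‖c‖ ≤ m) (hd : d = 0 ∨ d = Complex.I) (ht : 0 < t) (h1 : 0 ≤ ζ.re)
    (h2 : 0 ≤ ζ.im) (hq : 0 ≤ q) :
    ‖reducedAmplitudeDeriv a b c κ ν d ζ t q‖ ≤ boundOne m W t * Real.exp ‖ζ‖ := by
  have hm : 0 ≤ m := (norm_nonneg _).trans ha
  have hL := (lambdaBound_pos W t).le
  have hP : _ ≤ amplitudeBound m W t :=
    norm_amplitude_le (s := q + ζ) hκ hν ha hb hc ht (by simp; positivity) (by simpa)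
  have hP1 := norm_amplitudeDeriv_le (s := q + ζ) hκ hν ha hb ht (by simp; positivity) (by simpa)
  have hE := norm_phase_le hd ht h2 hq
  have hF := norm_phase_factor_le (ζ := ζ) hd ht
  have hA := amplitudeBound_nonneg (W := W) (t := t) hm
  have hn1 : 1 ≤ Real.exp ‖ζ‖ := Real.one_le_exp (norm_nonneg _)
  have hn2 : ‖ζ‖ ≤ Real.exp ‖ζ‖ := by linarith [Real.add_one_le_exp ‖ζ‖]
  rw [reducedAmplitudeDeriv, norm_mul]
  refine (mul_le_of_le_one_right (norm_nonneg _) hE).trans ((norm_add_le _ _).trans ?_)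
  rw [norm_mul]
  calc _ ≤ 2 * m * lambdaBound W t * (√t)⁻¹ * 1 + amplitudeBound m W t * (‖ζ‖ * t⁻¹) := by
        rw [mul_one]
        gcongr
    _ ≤ 2 * m * lambdaBound W t * (√t)⁻¹ * Real.exp ‖ζ‖ +
        amplitudeBound m W t * (Real.exp ‖ζ‖ * t⁻¹) := by gcongr
    _ = _ := by
      rw [boundOne]
      ring

lemma norm_reducedAmplitudeDeriv₂_le (hκ : |κ| ≤ W) (hν : |ν| ≤ W) (ha : ‖a‖ ≤ m)
    (hb : ‖b‖ ≤ m) (hc : ‖c‖ ≤ m) (hd : d = 0 ∨ d = Complex.I) (ht : 0 < t) (h1 : 0 ≤ ζ.re)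
    (h2 : 0 ≤ ζ.im) (hq : 0 ≤ q) :
    ‖reducedAmplitudeDeriv₂ a b c κ ν d ζ t q‖ ≤ boundSpace m W t * Real.exp ‖ζ‖ := by
  have hm : 0 ≤ m := (norm_nonneg _).trans ha
  have hL := (lambdaBound_pos W t).le
  have hP : _ ≤ amplitudeBound m W t :=
    norm_amplitude_le (s := q + ζ) hκ hν ha hb hc ht (by simp; positivity) (by simpa)
  have hP1 := norm_amplitudeDeriv_le (s := q + ζ) hκ hν ha hb ht (by simp; positivity) (by simpa)
  have hP2 := norm_amplitudeDeriv₂_le (s := q + ζ) hκ hν ha hb ht (by simp; positivity) (by simpa)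
  have hE := norm_phase_le hd ht h2 hq
  have hF := norm_phase_factor_le (ζ := ζ) hd ht
  have hA := amplitudeBound_nonneg (W := W) (t := t) hm
  have hn1 : 1 ≤ Real.exp ‖ζ‖ := Real.one_le_exp (norm_nonneg _)
  have hn2 : ‖ζ‖ ≤ Real.exp ‖ζ‖ := by linarith [Real.add_one_le_exp ‖ζ‖]
  -- From `1 + r + r²/2 ≤ e^r`; this is the source of the factor `2` in the last term of
  -- `boundSpace`.
  have hn3 : ‖ζ‖ ^ 2 ≤ 2 * Real.exp ‖ζ‖ := by
    linarith [Real.quadratic_le_exp_of_nonneg (norm_nonneg ζ), norm_nonneg ζ]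
  rw [reducedAmplitudeDeriv₂, norm_mul]
  refine (mul_le_of_le_one_right (norm_nonneg _) hE).trans (norm_add₃_le.trans ?_)
  rw [norm_mul (2 * _), norm_mul 2, norm_mul (amplitude _ _ _ _ _ _ _), norm_pow,
    Complex.norm_two]
  calc _ ≤ 2 * m * lambdaBound W t * (√t)⁻¹ ^ 2 * 1 +
          2 * (2 * m * lambdaBound W t * (√t)⁻¹) * (‖ζ‖ * t⁻¹) +
          amplitudeBound m W t * (‖ζ‖ * t⁻¹) ^ 2 := by
        rw [mul_one]
        gcongr
    _ = 2 * m * lambdaBound W t * (√t)⁻¹ ^ 2 * 1 +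
          2 * (2 * m * lambdaBound W t * (√t)⁻¹) * (‖ζ‖ * t⁻¹) +
          amplitudeBound m W t * (‖ζ‖ ^ 2 * t⁻¹ ^ 2) := by rw [mul_pow]
    _ ≤ 2 * m * lambdaBound W t * (√t)⁻¹ ^ 2 * Real.exp ‖ζ‖ +
          2 * (2 * m * lambdaBound W t * (√t)⁻¹) * (Real.exp ‖ζ‖ * t⁻¹) +
          amplitudeBound m W t * (2 * Real.exp ‖ζ‖ * t⁻¹ ^ 2) := by gcongr
    _ = _ := by
      rw [boundSpace]
      ring

lemma norm_reducedAmplitudeTime_le (hκ : |κ| ≤ W) (hν : |ν| ≤ W) (ha : ‖a‖ ≤ m)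
    (hb : ‖b‖ ≤ m) (hc : ‖c‖ ≤ m) (hd : d = 0 ∨ d = Complex.I) (ht : 0 < t) (h1 : 0 ≤ ζ.re)
    (h2 : 0 ≤ ζ.im) (hq : 0 ≤ q) :
    ‖reducedAmplitudeTime a b c κ ν d ζ t q‖ ≤ boundTime m W t q * Real.exp ‖ζ‖ := by
  have hm : 0 ≤ m := (norm_nonneg _).trans ha
  have hW : 0 ≤ W := (abs_nonneg κ).trans hκ
  have hL := (lambdaBound_pos W t).le
  have hP : _ ≤ amplitudeBound m W t :=
    norm_amplitude_le (s := q + ζ) hκ hν ha hb hc ht (by simp; positivity) (by simpa)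
  have hPt := norm_amplitudeTime_le (s := q + ζ) hκ hν ha hb hc ht (by simp; positivity) (by simpa)
  have hE := norm_phase_le hd ht h2 hq
  have hF : ‖d * ζ * q * (t : ℂ)⁻¹ ^ 2‖ ≤ ‖ζ‖ * (q * t⁻¹ ^ 2) := by
    rw [norm_mul, norm_mul, norm_mul, norm_pow, norm_inv, Complex.norm_real, Complex.norm_real,
      Real.norm_eq_abs, Real.norm_eq_abs, abs_of_pos ht, abs_of_nonneg hq, mul_assoc]
    gcongr
    exact mul_le_of_le_one_left (norm_nonneg _) (norm_phase_coeff_le hd)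
  have hA := amplitudeBound_nonneg (W := W) (t := t) hm
  have hn1 : 1 ≤ Real.exp ‖ζ‖ := Real.one_le_exp (norm_nonneg _)
  have hn2 : ‖ζ‖ ≤ Real.exp ‖ζ‖ := by linarith [Real.add_one_le_exp ‖ζ‖]
  -- The time derivative of the argument of `Λ` is linear in `s = q + ζ`, so a dependence on `q =
  -- |x|` remains in `boundTime`.
  have hs : ‖(q : ℂ) + ζ‖ ≤ (q + 1) * Real.exp ‖ζ‖ := by
    have h3 : ‖(q : ℂ) + ζ‖ ≤ q + ‖ζ‖ := by
      refine (norm_add_le _ _).trans ?_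
      rw [Complex.norm_real, Real.norm_eq_abs, abs_of_nonneg hq]
    nlinarith
  have e : ‖1 / (2 * (√Real.pi : ℂ)) * (-((rootIT t)⁻¹ / (2 * t)))‖ ≤ t⁻¹ * (√t)⁻¹ := by
    rw [norm_mul]
    have := norm_div_two_sqrt_pi_le 1
    rw [norm_one] at this
    exact (mul_le_of_le_one_left (norm_nonneg _) this).trans (norm_inv_rootIT_deriv_le ht)
  rw [reducedAmplitudeTime]
  refine (norm_add_le _ _).trans ?_
  have e' : ∀ u v w : ℂ, ‖w‖ ≤ 1 → ‖(u - v) * w‖ ≤ ‖u‖ + ‖v‖ := fun u v w hw => by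
    rw [norm_mul]
    exact (mul_le_of_le_one_right (norm_nonneg _) hw).trans (norm_sub_le _ _)
  refine (add_le_add (e' _ _ _ hE) e).trans ?_
  rw [norm_mul (amplitude _ _ _ _ _ _ _)]
  calc _ ≤ 2 * m * lambdaBound W t *
          ((q + 1) * Real.exp ‖ζ‖ * (t⁻¹ * (√t)⁻¹) + W * (√t * t⁻¹) * 1) +
          m * (t⁻¹ * (√t)⁻¹) * 1 + amplitudeBound m W t * (‖ζ‖ * (q * t⁻¹ ^ 2)) +
          t⁻¹ * (√t)⁻¹ * 1 := by
        rw [mul_one, mul_one, mul_one]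
        gcongr
        refine hPt.trans ?_
        gcongr
    _ ≤ 2 * m * lambdaBound W t *
          ((q + 1) * Real.exp ‖ζ‖ * (t⁻¹ * (√t)⁻¹) + W * (√t * t⁻¹) * Real.exp ‖ζ‖) +
          m * (t⁻¹ * (√t)⁻¹) * Real.exp ‖ζ‖ +
          amplitudeBound m W t * (Real.exp ‖ζ‖ * (q * t⁻¹ ^ 2)) +
          t⁻¹ * (√t)⁻¹ * Real.exp ‖ζ‖ := by gcongr
    _ = _ := by
      rw [boundTime, abs_of_nonneg hq]
      ring

end Bounds

/-! ### Coefficients depending on signs only -/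

/-- The value at nonzero arguments depends on their signs only. -/
def SignInvariant (m : ℝ → ℝ → ℂ) : Prop :=
  ∀ x x' y y', 0 < x * x' → 0 < y * y' → m x y = m x' y'

lemma SignInvariant.exists_bound {m : ℝ → ℝ → ℂ} (h : SignInvariant m) :
    ∃ C, ∀ x y, x ≠ 0 → y ≠ 0 → ‖m x y‖ ≤ C := by
  refine ⟨‖m 1 1‖ + ‖m 1 (-1)‖ + ‖m (-1) 1‖ + ‖m (-1) (-1)‖, fun x y hx hy => ?_⟩
  have n1 := norm_nonneg (m 1 1)
  have n2 := norm_nonneg (m 1 (-1))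
  have n3 := norm_nonneg (m (-1) 1)
  have n4 := norm_nonneg (m (-1) (-1))
  rcases lt_or_gt_of_ne hx with hx | hx <;> rcases lt_or_gt_of_ne hy with hy | hy
  · rw [h x (-1) y (-1) (by linarith) (by linarith)]
    linarith
  · rw [h x (-1) y 1 (by linarith) (by linarith)]
    linarith
  · rw [h x 1 y (-1) (by linarith) (by linarith)]
    linarith
  · rw [h x 1 y 1 (by linarith) (by linarith)]
    linarith

lemma pos_iff_of_mul_pos {x x' : ℝ} (h : 0 < x * x') : 0 < x ↔ 0 < x' :=
  ⟨fun hx => (pos_iff_pos_of_mul_pos h).1 hx, fun hx => (pos_iff_pos_of_mul_pos h).2 hx⟩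

lemma mul_pos_mul_of_mul_pos {x x' y y' : ℝ} (hx : 0 < x * x') (hy : 0 < y * y') :
    0 < x * y * (x' * y') := by
  have := mul_pos hx hy
  linarith

lemma signInvariant_heaviside : SignInvariant fun x y => (heaviside (x * y) : ℂ) := by
  intro x x' y y' hx hy
  simp only [heaviside, pos_iff_of_mul_pos (mul_pos_mul_of_mul_pos hx hy)]

lemma signInvariant_heaviside_neg : SignInvariant fun x y => (heaviside (-(x * y)) : ℂ) := by
  intro x x' y y' hx hy
  have h : 0 < -(x * y) * (-(x' * y')) := by
    have := mul_pos_mul_of_mul_pos hx hy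
    linarith
  simp only [heaviside, pos_iff_of_mul_pos h]

lemma signInvariant_sign : SignInvariant fun x y => (Real.sign (x * y) : ℂ) := by
  intro x x' y y' hx hy
  have h := mul_pos_mul_of_mul_pos hx hy
  rcases lt_trichotomy (x * y) 0 with h1 | h1 | h1
  · have h2 : x' * y' < 0 := by
      by_contra h2
      nlinarith
    simp only [Real.sign_of_neg h1, Real.sign_of_neg h2]
  · rw [h1] at h
    simp at h
  · simp only [Real.sign_of_pos h1, Real.sign_of_pos ((pos_iff_of_mul_pos h).1 h1)]

lemma signInvariant_eta (α β : ℂ) : SignInvariant (eta α β) := by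
  intro x x' y y' hx hy
  simp only [eta, pos_iff_of_mul_pos hx, pos_iff_of_mul_pos hy]

lemma signInvariant_muP (φ : ℝ) (α β : ℂ) : SignInvariant (muP φ α β) := by
  intro x x' y y' hx hy
  have h := signInvariant_heaviside x x' y y' hx hy
  simp only at h
  simp only [muP, h, signInvariant_eta α β x x' y y' hx hy]

lemma signInvariant_muM (φ : ℝ) (α β : ℂ) : SignInvariant (muM φ α β) := by
  intro x x' y y' hx hy
  have h := signInvariant_heaviside x x' y y' hx hy
  simp only at h
  simp only [muM, h, signInvariant_eta α β x x' y y' hx hy]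

lemma signInvariant_muZero (φ : ℝ) (α β : ℂ) : SignInvariant (muZero φ α β) := by
  intro x x' y y' hx hy
  have h1 := signInvariant_heaviside_neg x x' y y' hx hy
  have h2 := signInvariant_sign x x' y y' hx hy
  simp only at h1 h2
  simp only [muZero, h1, h2, signInvariant_eta α β x x' y y' hx hy]

/-! ### The continued Green's function -/

/-- The holomorphic continuation of the absolute value to the complex plane without the imaginary
axis. -/
noncomputable def sectorAbs (z : ℂ) : ℂ := if 0 < z.re then z else -z

lemma sectorAbs_of_pos {z : ℂ} (h : 0 < z.re) : sectorAbs z = z := if_pos h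

lemma sectorAbs_of_neg {z : ℂ} (h : z.re < 0) : sectorAbs z = -z := if_neg h.le.not_gt

lemma norm_sectorAbs (z : ℂ) : ‖sectorAbs z‖ = ‖z‖ := by
  unfold sectorAbs
  split_ifs <;> simp

lemma sectorAbs_ofReal {y : ℝ} (hy : y ≠ 0) : sectorAbs y = (|y| : ℝ) := by
  rcases lt_or_gt_of_ne hy with h | h
  · rw [sectorAbs_of_neg (by simpa), abs_of_neg h, Complex.ofReal_neg]
  · rw [sectorAbs_of_pos (by simpa), abs_of_pos h]

/-- An angle below `π/2` keeps the sector off the imaginary axis, where `sectorAbs` jumps, and the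
sign change folds its second half onto the first. Hence `|x| + sectorAbs z` always lies in the
quadrant where `Λ` is controlled. -/
lemma sectorAbs_of_mem_doubleSector {θ : ℝ} (hθ : θ < Real.pi / 2) {z : ℂ}
    (hz : z ∈ doubleSector θ) :
    z.re ≠ 0 ∧ 0 ≤ (sectorAbs z).re ∧ 0 ≤ (sectorAbs z).im := by
  have key : ∀ w : ℂ, w ≠ 0 → Complex.arg w ∈ Icc 0 θ → 0 < w.re ∧ 0 ≤ w.im := by
    intro w hw h
    have h1 : |Complex.arg w| < Real.pi / 2 := by
      rw [abs_of_nonneg h.1]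
      exact h.2.trans_lt hθ
    exact ⟨(Complex.abs_arg_lt_pi_div_two_iff.1 h1).resolve_right hw,
      Complex.arg_nonneg_iff.1 h.1⟩
  rcases hz with ⟨h0, h | h⟩
  · have := key z h0 h
    rw [sectorAbs_of_pos this.1]
    exact ⟨this.1.ne', this.1.le, this.2⟩
  · have := key (-z) (neg_ne_zero.2 h0) h
    have h1 : z.re < 0 := by simpa using this.1
    rw [sectorAbs_of_neg h1]
    exact ⟨h1.ne, this.1.le, this.2⟩

/-- The free kernel plus a layer with coefficients depending on the signs of `x` and `Re z`. -/
noncomputable def layeredGreen (mP mM mO : ℝ → ℝ → ℂ) (κ ν t x : ℝ) (z : ℂ) : ℂ :=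
  layer (mP x z.re) (mM x z.re) (mO x z.re) κ ν t ((|x| : ℝ) + sectorAbs z) +
    freeKernel t (x - z)

lemma pointGreen_eq_layeredGreen (φ : ℝ) (α β : ℂ) {t : ℝ} (ht : 0 < t) (x : ℝ) {y : ℝ}
    (hy : y ≠ 0) : pointGreen φ α β t x y =
      layeredGreen (muP φ α β) (muM φ α β) (muZero φ α β) (omegaP φ α) (omegaM φ α) t x y := by
  simp only [pointGreen, layeredGreen, sectorAbs_ofReal hy, Complex.ofReal_re, sqrt_I_mul ht,
    sqrt_I_mul_pi_mul ht, layer, lambdaKernel, freeKernel, Complex.ofReal_add]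
  ring

section

variable {mP mM mO : ℝ → ℝ → ℂ} {κ ν : ℝ}

lemma differentiable_layer (a b c : ℂ) (κ ν : ℝ) {t : ℝ} (ht : 0 < t) :
    Differentiable ℂ (layer a b c κ ν t) := fun s => by
  obtain ⟨F₂, h⟩ := exists_isFreeSolution_layer a b c κ ν
  exact (h.deriv_space t ht s).differentiableAt

lemma differentiableOn_layeredGreen (hP : SignInvariant mP) (hM : SignInvariant mM)
    (hO : SignInvariant mO) {t x : ℝ} (ht : 0 < t) (hx : x ≠ 0) :
    DifferentiableOn ℂ (layeredGreen mP mM mO κ ν t x) {z | z.re ≠ 0} := by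
  intro z hz
  refine DifferentiableAt.differentiableWithinAt ?_
  have hxx : 0 < x * x := mul_self_pos.2 hx
  have hl := differentiable_layer (mP x z.re) (mM x z.re) (mO x z.re) κ ν ht
  have hk : Differentiable ℂ (freeKernel t) := fun s =>
    (hasDerivAt_freeKernel_space t s).differentiableAt
  rcases lt_or_gt_of_ne (show z.re ≠ 0 from hz) with h | h
  · have hd : DifferentiableAt ℂ (fun w : ℂ => layer (mP x z.re) (mM x z.re) (mO x z.re) κ ν t
        ((|x| : ℝ) + -w) + freeKernel t (x - w)) z := by fun_prop
    refine hd.congr_of_eventuallyEq ?_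
    filter_upwards [(isOpen_lt Complex.continuous_re continuous_const).mem_nhds h] with w hw
    have hw : w.re < 0 := hw
    have hwz := mul_pos_of_neg_of_neg hw h
    rw [layeredGreen, sectorAbs_of_neg hw, hP x x _ _ hxx hwz, hM x x _ _ hxx hwz,
      hO x x _ _ hxx hwz]
  · have hd : DifferentiableAt ℂ (fun w : ℂ => layer (mP x z.re) (mM x z.re) (mO x z.re) κ ν t
        ((|x| : ℝ) + w) + freeKernel t (x - w)) z := by fun_prop
    refine hd.congr_of_eventuallyEq ?_
    filter_upwards [(isOpen_lt continuous_const Complex.continuous_re).mem_nhds h] with w hw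
    have hw : 0 < w.re := hw
    have hwz := mul_pos hw h
    rw [layeredGreen, sectorAbs_of_pos hw, hP x x _ _ hxx hwz, hM x x _ _ hxx hwz,
      hO x x _ _ hxx hwz]

/-- Sign invariance allows the coefficients to be frozen at `x = 1` and `x = -1`, which makes each
branch entire in `s`. The factors `1 *` and `-1 *` are the `ε` of `IsFreeSolution.comp_affine`. -/
lemma exists_gluesFreeSolutions_layeredGreen (hP : SignInvariant mP) (hM : SignInvariant mM)
    (hO : SignInvariant mO) (κ ν : ℝ) {z : ℂ} (hz : z.re ≠ 0) :
    ∃ P₂ Q₂, GluesFreeSolutions (fun t x => layeredGreen mP mM mO κ ν t x z)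
      (fun t s => layer (mP 1 z.re) (mM 1 z.re) (mO 1 z.re) κ ν t (1 * s + sectorAbs z) +
        freeKernel t (1 * s + -z))
      (fun t s => 1 * layerDeriv (mP 1 z.re) (mM 1 z.re) (mO 1 z.re) κ ν t (1 * s + sectorAbs z) +
        1 * (-((1 * s + -z) / (2 * Complex.I * t)) * freeKernel t (1 * s + -z))) P₂
      (fun t s => layer (mP (-1) z.re) (mM (-1) z.re) (mO (-1) z.re) κ ν t (-1 * s + sectorAbs z) +
        freeKernel t (1 * s + -z))
      (fun t s => -1 * layerDeriv (mP (-1) z.re) (mM (-1) z.re) (mO (-1) z.re) κ ν t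
          (-1 * s + sectorAbs z) +
        1 * (-((1 * s + -z) / (2 * Complex.I * t)) * freeKernel t (1 * s + -z))) Q₂ := by
  obtain ⟨F₂, hF⟩ := exists_isFreeSolution_layer (mP 1 z.re) (mM 1 z.re) (mO 1 z.re) κ ν
  obtain ⟨H₂, hH⟩ := exists_isFreeSolution_layer (mP (-1) z.re) (mM (-1) z.re) (mO (-1) z.re) κ ν
  have hzz : 0 < z.re * z.re := mul_self_pos.2 hz
  refine ⟨_, _, (hF.comp_affine (by norm_num) (sectorAbs z)).add
    (isFreeSolution_freeKernel.comp_affine (by norm_num) (-z)),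
    (hH.comp_affine (by norm_num) (sectorAbs z)).add
    (isFreeSolution_freeKernel.comp_affine (by norm_num) (-z)), ?_, ?_⟩
  · intro t _ x hx
    have hx1 : 0 < x * 1 := by linarith
    simp only [layeredGreen, hP x 1 _ _ hx1 hzz, hM x 1 _ _ hx1 hzz, hO x 1 _ _ hx1 hzz,
      abs_of_pos hx, one_mul, sub_eq_add_neg]
  · intro t _ x hx
    have hx1 : 0 < x * -1 := by linarith
    simp only [layeredGreen, hP x (-1) _ _ hx1 hzz, hM x (-1) _ _ hx1 hzz, hO x (-1) _ _ hx1 hzz,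
      abs_of_neg hx, one_mul, neg_mul, sub_eq_add_neg, Complex.ofReal_neg]

/-! ### The reduced Green's function -/

/-- With `ζ = sectorAbs z`, the difference `(|x| + ζ)² - (z - x)²` is `4|x|ζ` if `x` and `Re z` have
the same sign and `0` otherwise. The free kernel loses its phase entirely, because `(x - z)² = (z -
x)²`. -/
lemma reducedGreen_layeredGreen {t x : ℝ} (ht : 0 < t) (hx : x ≠ 0) {z : ℂ} (hz : z.re ≠ 0) :
    reducedGreen (fun t => 1 / (4 * t)) (layeredGreen mP mM mO κ ν) t x z =
      reducedAmplitude (mP x z.re) (mM x z.re) (mO x z.re) κ ν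
        (if 0 < x * z.re then Complex.I else 0) (sectorAbs z) t (|x| : ℝ) := by
  have htc : (t : ℂ) ≠ 0 := by exact_mod_cast ht.ne'
  have hI : (Complex.I)⁻¹ = -Complex.I := Complex.inv_I
  have e1 : ∀ s : ℂ, Complex.exp (-(Complex.I * ((1 / (4 * t) : ℝ) : ℂ) * (z - x) ^ 2)) *
      Complex.exp (-(s ^ 2 / (4 * Complex.I * t))) =
      Complex.exp (Complex.I * (s ^ 2 - (z - x) ^ 2) / (4 * t)) := by
    intro s
    rw [← Complex.exp_add]
    congr 1
    push_cast
    rw [div_eq_mul_inv (s ^ 2), mul_inv, mul_inv, hI]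
    field_simp
    ring
  have e2 : Complex.I * ((((|x| : ℝ) : ℂ) + sectorAbs z) ^ 2 - (z - x) ^ 2) / (4 * t) =
      (if 0 < x * z.re then Complex.I else 0) * sectorAbs z * ((|x| : ℝ) : ℂ) * (t : ℂ)⁻¹ := by
    rcases lt_or_gt_of_ne hx with hx | hx <;> rcases lt_or_gt_of_ne hz with hz | hz
    · rw [if_pos (mul_pos_of_neg_of_neg hx hz), abs_of_neg hx, sectorAbs_of_neg hz]
      push_cast
      field_simp
      ring
    · rw [if_neg (mul_neg_of_neg_of_pos hx hz).not_gt, abs_of_neg hx, sectorAbs_of_pos hz]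
      push_cast
      field_simp
      ring
    · rw [if_neg (mul_neg_of_pos_of_neg hx hz).not_gt, abs_of_pos hx, sectorAbs_of_neg hz]
      field_simp
      ring
    · rw [if_pos (mul_pos hx hz), abs_of_pos hx, sectorAbs_of_pos hz]
      field_simp
      ring
  rw [reducedGreen, layeredGreen, layer_eq_amplitude_mul, mul_add, mul_left_comm, e1, e2,
    freeKernel, mul_left_comm, e1, reducedAmplitude, add_comm ((|x| : ℝ) : ℂ)]
  have e3 : Complex.exp (Complex.I * (((x : ℂ) - z) ^ 2 - (z - x) ^ 2) / (4 * t)) = 1 := by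
    rw [show ((x : ℂ) - z) ^ 2 - (z - x) ^ 2 = 0 by ring]
    simp
  rw [e3, mul_one, ← mul_assoc 2, one_div (2 * (√Real.pi : ℂ) * rootIT t), mul_inv, one_div]

lemma abs_sign_smul_norm {x : ℝ} (hx : x ≠ 0) (w : ℂ) :
    ‖((SignType.sign x : ℤ) : ℝ) • w‖ = ‖w‖ := by
  rcases lt_or_gt_of_ne hx with h | h
  · simp [sign_neg h]
  · simp [sign_pos h]

lemma hasDerivAt_comp_abs {f f' : ℂ → ℂ} (hf : ∀ q, HasDerivAt f (f' q) q) {x : ℝ} (hx : x ≠ 0) :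
    HasDerivAt (fun y : ℝ => f ((|y| : ℝ) : ℂ))
      (((SignType.sign x : ℤ) : ℝ) • f' ((|x| : ℝ) : ℂ)) x := by
  have h1 := (hf ((|x| : ℝ) : ℂ)).comp_ofReal
  have h2 := h1.scomp x (hasDerivAt_abs hx)
  refine h2.congr_deriv ?_
  congr 1
  rcases lt_or_gt_of_ne hx with h | h
  · simp [sign_neg h]
  · simp [sign_pos h]

theorem reducedGreen_bounds (hP : SignInvariant mP) (hM : SignInvariant mM)
    (hO : SignInvariant mO) {m W : ℝ} (hκ : |κ| ≤ W) (hν : |ν| ≤ W)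
    (hmP : ∀ x y, x ≠ 0 → y ≠ 0 → ‖mP x y‖ ≤ m) (hmM : ∀ x y, x ≠ 0 → y ≠ 0 → ‖mM x y‖ ≤ m)
    (hmO : ∀ x y, x ≠ 0 → y ≠ 0 → ‖mO x y‖ ≤ m) {t x : ℝ} (ht : 0 < t) (hx : x ≠ 0) {z : ℂ}
    (hz : z.re ≠ 0) (h1 : 0 ≤ (sectorAbs z).re) (h2 : 0 ≤ (sectorAbs z).im) :
    let R := reducedGreen (fun t => 1 / (4 * t)) (layeredGreen mP mM mO κ ν)
    ‖R t x z‖ ≤ boundZero m W t ∧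
      DifferentiableAt ℝ (fun y => R t y z) x ∧
      ‖deriv (fun y => R t y z) x‖ ≤ boundOne m W t * Real.exp ‖z‖ ∧
      DifferentiableAt ℝ (deriv fun y => R t y z) x ∧
      ‖deriv (deriv fun y => R t y z) x‖ ≤ boundSpace m W t * Real.exp ‖z‖ ∧
      DifferentiableAt ℝ (fun s => R s x z) t ∧
      ‖deriv (fun s => R s x z) t‖ ≤ boundTime m W t x * Real.exp ‖z‖ := by
  intro R
  have ha := hmP x z.re hx hz
  have hb := hmM x z.re hx hz
  have hc := hmO x z.re hx hz
  set d : ℂ := if 0 < x * z.re then Complex.I else 0 with hd_def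
  have hd : d = 0 ∨ d = Complex.I := by
    rw [hd_def]
    split_ifs <;> simp
  have hq := abs_nonneg x
  rw [← norm_sectorAbs z]
  have hzz : 0 < z.re * z.re := mul_self_pos.2 hz
  have hR : ∀ y, 0 < y * x → R t y z = reducedAmplitude (mP x z.re) (mM x z.re) (mO x z.re) κ ν d
      (sectorAbs z) t (|y| : ℝ) := by
    intro y hy
    have hy0 : y ≠ 0 := by
      rintro rfl
      simp at hy
    have hs : 0 < y * z.re ↔ 0 < x * z.re :=
      pos_iff_of_mul_pos (mul_pos_mul_of_mul_pos hy hzz)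
    simp only [R, reducedGreen_layeredGreen ht hy0 hz, hP y x _ _ hy hzz, hM y x _ _ hy hzz,
      hO y x _ _ hy hzz, hs, hd_def]
  have hev : ∀ y, 0 < y * x → ∀ᶠ w in 𝓝 y, 0 < w * x := fun y hy =>
    (isOpen_lt continuous_const (by fun_prop : Continuous fun w : ℝ => w * x)).mem_nhds hy
  have hne : ∀ y, 0 < y * x → y ≠ 0 := by
    rintro y hy rfl
    simp at hy
  have hD1 : ∀ y, 0 < y * x → HasDerivAt (fun y => R t y z) (((SignType.sign y : ℤ) : ℝ) •
      reducedAmplitudeDeriv (mP x z.re) (mM x z.re) (mO x z.re) κ ν d (sectorAbs z) t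
        (|y| : ℝ)) y := fun y hy =>
    (hasDerivAt_comp_abs (hasDerivAt_reducedAmplitude _ _ _ κ ν d (sectorAbs z) t)
      (hne y hy)).congr_of_eventuallyEq ((hev y hy).mono fun w hw => hR w hw)
  have hxx : 0 < x * x := mul_self_pos.2 hx
  -- The sign produced by differentiating `|y|` is constant near `x`, so it passes through the
  -- second differentiation as a scalar.
  have hsign : ∀ y, 0 < y * x → SignType.sign y = SignType.sign x := by
    intro y hy
    rcases lt_or_gt_of_ne hx with h | h
    · rw [sign_neg h, sign_neg]
      nlinarith
    · rw [sign_pos h, sign_pos]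
      exact (pos_iff_of_mul_pos hy).2 h
  have hD2 : HasDerivAt (deriv fun y => R t y z) (((SignType.sign x : ℤ) : ℝ) •
      ((SignType.sign x : ℤ) : ℝ) • reducedAmplitudeDeriv₂ (mP x z.re) (mM x z.re) (mO x z.re) κ ν d
        (sectorAbs z) t (|x| : ℝ)) x := by
    refine ((hasDerivAt_comp_abs (hasDerivAt_reducedAmplitudeDeriv (mP x z.re) (mM x z.re)
      (mO x z.re) κ ν d (sectorAbs z) t) hx).const_smul
      ((SignType.sign x : ℤ) : ℝ)).congr_of_eventuallyEq ?_
    filter_upwards [hev x hxx] with w hw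
    rw [(hD1 w hw).deriv, hsign w hw]
    rfl
  have hDt : HasDerivAt (fun s => R s x z) (reducedAmplitudeTime (mP x z.re) (mM x z.re)
      (mO x z.re) κ ν d (sectorAbs z) t (|x| : ℝ)) t := by
    refine (hasDerivAt_reducedAmplitude_time _ _ _ κ ν d (sectorAbs z) ht _).congr_of_eventuallyEq
      ((eventually_gt_nhds ht).mono fun s hs => ?_)
    exact reducedGreen_layeredGreen hs hx hz
  refine ⟨?_, (hD1 x hxx).differentiableAt, ?_, hD2.differentiableAt, ?_, hDt.differentiableAt, ?_⟩
  · rw [hR x hxx]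
    exact norm_reducedAmplitude_le hκ hν ha hb hc hd ht h1 h2 hq
  · rw [(hD1 x hxx).deriv, abs_sign_smul_norm hx]
    exact norm_reducedAmplitudeDeriv_le hκ hν ha hb hc hd ht h1 h2 hq
  · rw [hD2.deriv, abs_sign_smul_norm hx, abs_sign_smul_norm hx]
    exact norm_reducedAmplitudeDeriv₂_le hκ hν ha hb hc hd ht h1 h2 hq
  · rw [hDt.deriv]
    have := norm_reducedAmplitudeTime_le hκ hν ha hb hc hd ht h1 h2 hq
    rwa [boundTime, abs_abs, ← boundTime] at this

/-! ### Continuity and size of the coefficients in the bounds -/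

lemma continuousOn_inv_sqrt : ContinuousOn (fun t : ℝ => (√t)⁻¹) (Ioi 0) :=
  ContinuousOn.inv₀ Real.continuous_sqrt.continuousOn fun _ ht => (Real.sqrt_pos.2 ht).ne'

lemma continuousOn_inv_Ioi : ContinuousOn (fun t : ℝ => t⁻¹) (Ioi 0) :=
  ContinuousOn.inv₀ continuousOn_id fun _ ht => (show (0 : ℝ) < _ from ht).ne'

lemma continuousOn_boundZero (m W : ℝ) : ContinuousOn (boundZero m W) (Ioi 0) := by
  have h1 := (continuous_lambdaBound W).continuousOn (s := Ioi 0)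
  have h2 := continuousOn_inv_sqrt
  unfold boundZero amplitudeBound
  fun_prop

lemma continuousOn_boundOne (m W : ℝ) : ContinuousOn (boundOne m W) (Ioi 0) := by
  have h1 := (continuous_lambdaBound W).continuousOn (s := Ioi 0)
  have h2 := continuousOn_inv_sqrt
  have h3 := continuousOn_inv_Ioi
  unfold boundOne amplitudeBound
  fun_prop

lemma continuousOn_boundSpace (m W : ℝ) : ContinuousOn (boundSpace m W) (Ioi 0) := by
  have h1 := (continuous_lambdaBound W).continuousOn (s := Ioi 0)
  have h2 := continuousOn_inv_sqrt
  have h3 := continuousOn_inv_Ioi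
  unfold boundSpace amplitudeBound
  fun_prop

lemma continuousOn_boundTime (m W : ℝ) :
    ContinuousOn (fun q : ℝ × ℝ => boundTime m W q.1 q.2) (Ioi 0 ×ˢ univ) := by
  have hm : MapsTo (Prod.fst : ℝ × ℝ → ℝ) (Ioi 0 ×ˢ univ) (Ioi 0) := fun q hq => hq.1
  have h0 := continuousOn_fst (s := (Ioi 0 ×ˢ univ : Set (ℝ × ℝ)))
  have h1 : ContinuousOn (fun q : ℝ × ℝ => lambdaBound W q.1) (Ioi 0 ×ˢ univ) :=
    (continuous_lambdaBound W).comp_continuousOn h0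
  have h2 : ContinuousOn (fun q : ℝ × ℝ => (√q.1)⁻¹) (Ioi 0 ×ˢ univ) :=
    continuousOn_inv_sqrt.comp h0 hm
  have h3 : ContinuousOn (fun q : ℝ × ℝ => q.1⁻¹) (Ioi 0 ×ˢ univ) :=
    continuousOn_inv_Ioi.comp h0 hm
  unfold boundTime amplitudeBound
  fun_prop

/-- Since `1/√a = 2√t` for `a = 1/(4t)`, division compensates the `1/√t` singularity exactly: for `t
> 0` the quotient agrees with a function continuous at `0`. -/
lemma boundedNear_boundZero_div (m W : ℝ) :
    BoundedNear (𝓝[>] 0) fun t => boundZero m W t / √(1 / (4 * t)) := by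
  have hc : Continuous fun t : ℝ => 2 * √t * (2 * m * lambdaBound W t) + 2 * (m + 1) := by
    have := continuous_lambdaBound W
    fun_prop
  refine ⟨2 * √0 * (2 * m * lambdaBound W 0) + 2 * (m + 1) + 1, ?_⟩
  have h := (hc.continuousAt (x := 0)).eventually_lt (continuousAt_const
    (y := 2 * √0 * (2 * m * lambdaBound W 0) + 2 * (m + 1) + 1)) (by linarith)
  filter_upwards [h.filter_mono nhdsWithin_le_nhds, eventually_mem_nhdsWithin] with t ht ht0
  have ht0 : 0 < t := ht0
  refine le_of_eq_of_le ?_ ht.le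
  have hs : √(1 / (4 * t)) = (2 * √t)⁻¹ := by
    rw [one_div, Real.sqrt_inv, Real.sqrt_mul (by norm_num),
      show (4 : ℝ) = 2 ^ 2 by norm_num, Real.sqrt_sq (by norm_num)]
  have hst : √t ≠ 0 := (Real.sqrt_pos.2 ht0).ne'
  rw [hs, boundZero, amplitudeBound]
  field_simp
  ring

theorem exponentialBounds_layeredGreen (hP : SignInvariant mP) (hM : SignInvariant mM)
    (hO : SignInvariant mO) (κ ν : ℝ) (T : EReal) (M N : Matrix (Fin 2) (Fin 2) ℂ) {θ : ℝ}
    (hθ : θ < Real.pi / 2) :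
    ExponentialBounds T M N (doubleSector θ) (layeredGreen mP mM mO κ ν) := by
  obtain ⟨C₁, h₁⟩ := hP.exists_bound
  obtain ⟨C₂, h₂⟩ := hM.exists_bound
  obtain ⟨C₃, h₃⟩ := hO.exists_bound
  set m := max C₁ (max C₂ C₃)
  have hm : 0 ≤ m := (norm_nonneg _).trans ((h₁ 1 1 one_ne_zero one_ne_zero).trans
    (le_max_left _ _))
  set W := max |κ| |ν|
  have hW : 0 ≤ W := (abs_nonneg κ).trans (le_max_left _ _)
  have hsub : timeInterval T ⊆ Ioi 0 := fun t ht => ht.1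
  have hfst : ∀ {f : ℝ → ℝ}, ContinuousOn f (Ioi 0) →
      ContinuousOn (Function.uncurry fun t _ : ℝ => f t) (timeInterval T ×ˢ puncturedLine) :=
    fun hf => hf.comp continuousOn_fst fun q hq => hsub hq.1
  -- Order `p = 1`, with no growth for the function itself and `e^{‖z‖}` for its derivatives. `A₂`
  -- is a sum since it must dominate both the second space derivative and the time derivative. `A₀`
  -- and `A₁` do not depend on `x`, so boundedness at `x → 0` is immediate.
  refine ⟨fun t => 1 / (4 * t), 1, fun t _ => boundZero m W t, fun t _ => boundOne m W t,
    fun t x => boundSpace m W t + boundTime m W t x, fun _ _ => 0, fun _ _ => 1, fun _ _ => 1,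
    ?_, ?_, ?_, one_pos, one_lt_two, ?_, ?_, ?_, ?_, ?_, ?_⟩
  · have hd : ∀ t ∈ timeInterval T, HasDerivAt (fun t : ℝ => 1 / (4 * t)) (-(t⁻¹ ^ 2) / 4) t := by
      intro t ht
      have ht0 : t ≠ 0 := ht.1.ne'
      have := ((hasDerivAt_inv ht0).const_mul (1 / 4 : ℝ))
      refine (this.congr_deriv ?_).congr_of_eventuallyEq (Eventually.of_forall fun s => ?_)
      · field_simp
      · simp only [one_div, mul_inv]
    have hc : ContinuousOn (fun t : ℝ => -(t⁻¹ ^ 2) / 4) (timeInterval T) := by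
      have := continuousOn_inv_Ioi.mono hsub
      fun_prop
    refine ⟨_, hc.locallyIntegrableOn (isOpen_timeInterval T).measurableSet, fun x hx y hy => ?_⟩
    have hs := (ordConnected_timeInterval T).uIcc_subset hx hy
    exact (intervalIntegral.integral_eq_sub_of_hasDerivAt (fun z hz => hd z (hs hz))
      ((hc.mono hs).intervalIntegrable)).symm
  · intro t ht
    have := ht.1
    positivity
  · have := tendsto_inv_nhdsGT_zero (𝕜 := ℝ)
    refine (this.const_mul_atTop (by norm_num : (0 : ℝ) < 1 / 4)).congr fun t => ?_
    simp only [one_div, mul_inv]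
  · exact ⟨hfst (continuousOn_boundZero m W), continuousOn_const,
      fun t ht x _ => ⟨boundZero_nonneg hm, le_rfl⟩⟩
  · exact ⟨hfst (continuousOn_boundOne m W), continuousOn_const,
      fun t ht x _ => ⟨boundOne_nonneg hm ht.1, zero_le_one⟩⟩
  · refine ⟨(hfst (continuousOn_boundSpace m W)).add ((continuousOn_boundTime m W).mono
      (prod_mono hsub (subset_univ _))), continuousOn_const, fun t ht x _ =>
      ⟨add_nonneg (boundSpace_nonneg hm ht.1) (boundTime_nonneg hm hW ht.1 x), zero_le_one⟩⟩
  · intro t ht x hx z hz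
    obtain ⟨hz0, h1, h2⟩ := sectorAbs_of_mem_doubleSector hθ hz
    obtain ⟨b0, d1, b1, d2, b2, dt, bt⟩ := reducedGreen_bounds hP hM hO (κ := κ) (ν := ν) (m := m)
      (W := W) (le_max_left _ _) (le_max_right _ _)
      (fun x y hx hy => (h₁ x y hx hy).trans (le_max_left _ _))
      (fun x y hx hy => (h₂ x y hx hy).trans ((le_max_left _ _).trans (le_max_right _ _)))
      (fun x y hx hy => (h₃ x y hx hy).trans ((le_max_right _ _).trans (le_max_right _ _)))
      ht.1 hx hz0 h1 h2
    have e1 : boundSpace m W t ≤ boundSpace m W t + boundTime m W t x :=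
      le_add_of_nonneg_right (boundTime_nonneg hm hW ht.1 x)
    have e2 : boundTime m W t x ≤ boundSpace m W t + boundTime m W t x :=
      le_add_of_nonneg_left (boundSpace_nonneg hm ht.1)
    simp only [Real.rpow_one, zero_mul, one_mul, Real.exp_zero, mul_one]
    exact ⟨b0, d1, b1, d2, b2.trans (by gcongr), dt, bt.trans (by gcongr)⟩
  · exact fun x _ => ⟨boundedNear_boundZero_div m W, 0, Eventually.of_forall fun _ => le_rfl⟩
  · exact fun t _ => ⟨fun _ => ⟨⟨_, Eventually.of_forall fun _ => le_rfl⟩,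
      ⟨_, Eventually.of_forall fun _ => le_rfl⟩⟩, fun _ =>
      ⟨⟨_, Eventually.of_forall fun _ => le_rfl⟩, ⟨_, Eventually.of_forall fun _ => le_rfl⟩⟩⟩

end

/-! ### The initial condition -/

lemma norm_gaussPhase_ofReal (t s : ℝ) :
    ‖Complex.exp (-((s : ℂ) ^ 2 / (4 * Complex.I * t)))‖ = 1 := by
  have h : -((s : ℂ) ^ 2 / (4 * Complex.I * t)) = ((s ^ 2 / (4 * t) : ℝ) : ℂ) * Complex.I := by
    rw [div_eq_mul_inv, mul_inv, mul_inv, Complex.inv_I]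
    push_cast
    ring
  rw [h, Complex.norm_exp_ofReal_mul_I]

lemma norm_lambdaKernel_ofReal (κ t s : ℝ) :
    ‖lambdaKernel κ t s‖ = ‖bigLambda (s / (2 * rootIT t) + κ * rootIT t)‖ := by
  rw [lambdaKernel, norm_mul, norm_gaussPhase_ofReal, mul_one]

lemma norm_lambdaKernel_zero_le {t s : ℝ} (ht : 0 < t) (hs : 0 ≤ s) :
    ‖lambdaKernel 0 t s‖ ≤ 2 := by
  rw [norm_lambdaKernel_ofReal]
  have h := norm_bigLambda_le (c := 0) (w := s / (2 * rootIT t) + ((0 : ℝ) : ℂ) * rootIT t) ?_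
  · simpa using h
  · have := re_lambdaArg_ge (W := 0) (κ := 0) (s := s) (by simp) ht (by simpa) (by simp)
    simpa using this

lemma eventually_norm_lambdaKernel_le (κ : ℝ) {c : ℝ} (hc : 0 < c) :
    ∀ᶠ t in 𝓝[>] (0 : ℝ), ∀ s : ℝ, c ≤ s → ‖lambdaKernel κ t s‖ ≤ 8 * √(t / 2) / c := by
  have hK : 0 < |κ| + 1 := by positivity
  -- With `τ = √(t/2)` the argument of `Λ` has real part at least `c/(4τ) - |κ|τ`. The threshold
  -- makes the second term at most half of the first, leaving `c/(8τ)` uniformly in `s ≥ c`.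
  have h0 : ∀ᶠ t in 𝓝[>] (0 : ℝ), t / 2 < c / (8 * (|κ| + 1)) := by
    have : Tendsto (fun t : ℝ => t / 2) (𝓝[>] 0) (𝓝 (0 / 2)) :=
      ((continuous_id.div_const 2).tendsto 0).mono_left nhdsWithin_le_nhds
    exact this.eventually (gt_mem_nhds (by rw [zero_div]; positivity))
  filter_upwards [h0, eventually_mem_nhdsWithin] with t ht ht0 s hs
  have ht0 : 0 < t := ht0
  set τ := √(t / 2) with hτ
  have hτ0 : 0 < τ := Real.sqrt_pos.2 (by positivity)
  have hτ2 : τ ^ 2 = t / 2 := Real.sq_sqrt (by positivity)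
  have h1 : |κ| * τ ≤ c / (8 * τ) := by
    rw [lt_div_iff₀ (by positivity)] at ht
    rw [le_div_iff₀ (by positivity)]
    have : |κ| * τ * (8 * τ) = 8 * |κ| * τ ^ 2 := by ring
    rw [this, hτ2]
    nlinarith [abs_nonneg κ]
  have h2 : c / (8 * τ) ≤ (s / (2 * rootIT t) + κ * rootIT t : ℂ).re := by
    rw [Complex.add_re, re_div_two_rootIT ht0, Complex.re_ofReal_mul, rootIT_re, ← hτ]
    simp only [Complex.ofReal_re, Complex.ofReal_im, add_zero]
    have h3 : c / (4 * τ) ≤ s / (4 * τ) := by gcongr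
    have h4 : c / (4 * τ) = 2 * (c / (8 * τ)) := by
      field_simp
      norm_num
    have h5 : -(|κ| * τ) ≤ κ * τ := by
      rw [← neg_mul]
      exact mul_le_mul_of_nonneg_right (neg_abs_le κ) hτ0.le
    linarith
  have h6 : 0 < c / (8 * τ) := by positivity
  rw [norm_lambdaKernel_ofReal]
  refine (norm_bigLambda_le_inv (h6.trans_le h2)).trans ?_
  calc _ ≤ 1 / (c / (8 * τ)) := one_div_le_one_div_of_le h6 h2
    _ = _ := by rw [one_div_div]

lemma tendsto_sqrt_bound (c : ℝ) :
    Tendsto (fun t : ℝ => 8 * √(t / 2) / c) (𝓝[>] 0) (𝓝 0) := by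
  have hc : Continuous fun t : ℝ => 8 * √(t / 2) / c := by fun_prop
  simpa using (hc.tendsto 0).mono_left (nhdsWithin_le_nhds (s := Ioi 0))

lemma tendsto_lambdaKernel (κ : ℝ) {s : ℝ} (hs : 0 < s) :
    Tendsto (fun t => lambdaKernel κ t s) (𝓝[>] 0) (𝓝 0) :=
  squeeze_zero_norm' ((eventually_norm_lambdaKernel_le κ hs).mono fun _ ht => ht s le_rfl)
    (tendsto_sqrt_bound s)

/-- Continuously differentiable up to the boundary of `[a, b]`, with derivative `f'`. -/
structure C1On (f f' : ℝ → ℂ) (a b : ℝ) : Prop where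
  continuousOn : ContinuousOn f (Icc a b)
  continuousOn_deriv : ContinuousOn f' (Icc a b)
  hasDerivAt : ∀ s ∈ Ioo a b, HasDerivAt f (f' s) s

namespace C1On

variable {f f' : ℝ → ℂ} {a b : ℝ}

lemma mono (h : C1On f f' a b) {c d : ℝ} (hc : a ≤ c) (hd : d ≤ b) : C1On f f' c d :=
  ⟨h.1.mono (Icc_subset_Icc hc hd), h.2.mono (Icc_subset_Icc hc hd),
    fun s hs => h.3 s (Ioo_subset_Ioo hc hd hs)⟩

lemma comp_add_const (h : C1On f f' a b) (d : ℝ) :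
    C1On (fun s => f (s + d)) (fun s => f' (s + d)) (a - d) (b - d) := by
  have hm : MapsTo (fun s : ℝ => s + d) (Icc (a - d) (b - d)) (Icc a b) := fun s hs =>
    ⟨by linarith [hs.1], by linarith [hs.2]⟩
  exact ⟨h.1.comp (by fun_prop) hm, h.2.comp (by fun_prop) hm, fun s hs =>
    (h.3 (s + d) ⟨by linarith [hs.1], by linarith [hs.2]⟩).comp_add_const s d⟩

lemma comp_const_sub (h : C1On f f' a b) (d : ℝ) :
    C1On (fun s => f (d - s)) (fun s => -f' (d - s)) (d - b) (d - a) := by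
  have hm : MapsTo (fun s : ℝ => d - s) (Icc (d - b) (d - a)) (Icc a b) := fun s hs =>
    ⟨by linarith [hs.2], by linarith [hs.1]⟩
  exact ⟨h.1.comp (by fun_prop) hm, (h.2.comp (by fun_prop) hm).neg, fun s hs =>
    (h.3 (d - s) ⟨by linarith [hs.2], by linarith [hs.1]⟩).comp_const_sub d s⟩

lemma of_contDiffOn (hab : a < b) (h : ContDiffOn ℝ ∞ f (Icc a b)) :
    C1On f (derivWithin f (Icc a b)) a b :=
  ⟨h.continuousOn, h.continuousOn_derivWithin (uniqueDiffOn_Icc hab) (by norm_num),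
    fun s hs => by
      have hd := (h.differentiableOn (by norm_num)) s (Ioo_subset_Icc_self hs)
      exact hd.hasDerivWithinAt.hasDerivAt (Icc_mem_nhds hs.1 hs.2)⟩

end C1On

/-- Integration against the free kernel picks up half of the boundary value at the point of
stationary phase. -/
theorem tendsto_integral_freeKernel_mul {f f' : ℝ → ℂ} {c b : ℝ} (hc : 0 ≤ c) (hcb : c < b)
    (hf : C1On f f' c b) {l : ℂ}
    (hl : Tendsto (fun t => lambdaKernel 0 t c) (𝓝[>] 0) (𝓝 l)) :
    Tendsto (fun t => ∫ s in c..b, freeKernel t s * f s) (𝓝[>] 0) (𝓝 (l * f c / 2)) := by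
  have hI : uIcc c b = Icc c b := uIcc_of_le hcb.le
  -- Integration by parts replaces the free kernel, whose modulus blows up as `t → 0⁺`, by
  -- `lambdaKernel 0`, which is bounded by `2` and tends to `0` at every `s > 0`. Dominated
  -- convergence then leaves only the endpoint `c`, with weight `l`: `1` if `c = 0` and `0` if `c >
  -- 0`.
  have hparts : ∀ t : ℝ, 0 < t → ∫ s in c..b, freeKernel t s * f s =
      -(1 / 2) * (f b * lambdaKernel 0 t b - f c * lambdaKernel 0 t c -
        ∫ s in c..b, f' s * lambdaKernel 0 t s) := by
    intro t ht
    have hd : ∀ s : ℝ, HasDerivAt (fun s : ℝ => lambdaKernel 0 t s) (-2 * freeKernel t s) s :=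
      fun s => ((hasDerivAt_lambdaKernel_space 0 ht s).comp_ofReal).congr_deriv (by simp)
    have hk : Continuous fun s : ℝ => -2 * freeKernel t s :=
      continuous_const.mul ((continuous_freeKernel t).comp Complex.continuous_ofReal)
    rw [← intervalIntegral.integral_mul_deriv_eq_deriv_mul_of_hasDerivAt (u := f) (u' := f')
      (v := fun s : ℝ => lambdaKernel 0 t s) (v' := fun s : ℝ => -2 * freeKernel t s)
      (hI ▸ hf.continuousOn) (fun s _ => (hd s).continuousAt.continuousWithinAt)
      (by rw [min_eq_left hcb.le, max_eq_right hcb.le]; exact hf.hasDerivAt) (fun s _ => hd s)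
      ((hI ▸ hf.continuousOn_deriv : ContinuousOn f' (uIcc c b)).intervalIntegrable)
      (hk.intervalIntegrable _ _), ← intervalIntegral.integral_const_mul]
    refine intervalIntegral.integral_congr fun s _ => ?_
    ring
  have hrest : Tendsto (fun t => ∫ s in c..b, f' s * lambdaKernel 0 t s) (𝓝[>] 0)
      (𝓝 (∫ _ in c..b, (0 : ℂ))) := by
    have hmem := eventually_mem_nhdsWithin (a := (0 : ℝ)) (s := Ioi 0)
    refine intervalIntegral.tendsto_integral_filter_of_dominated_convergence
      (fun s => ‖f' s‖ * 2) ?_ ?_ ?_ ?_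
    · filter_upwards [hmem] with t ht
      rw [uIoc_of_le hcb.le]
      refine ContinuousOn.aestronglyMeasurable ?_ measurableSet_Ioc
      exact (hf.continuousOn_deriv.mono Ioc_subset_Icc_self).mul
        ((continuous_lambdaKernel 0 ht).comp Complex.continuous_ofReal).continuousOn
    · filter_upwards [hmem] with t ht
      refine Eventually.of_forall fun s hs => ?_
      rw [uIoc_of_le hcb.le] at hs
      rw [norm_mul]
      gcongr
      exact norm_lambdaKernel_zero_le ht (hc.trans hs.1.le)
    · refine ContinuousOn.intervalIntegrable ?_
      rw [hI]
      exact hf.continuousOn_deriv.norm.mul continuousOn_const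
    · refine Eventually.of_forall fun s hs => ?_
      rw [uIoc_of_le hcb.le] at hs
      simpa using (tendsto_lambdaKernel 0 (hc.trans_lt hs.1)).const_mul (f' s)
  have hb := (tendsto_lambdaKernel 0 (hc.trans_lt hcb)).const_mul (f b)
  have h := (((hb.sub (hl.const_mul (f c))).sub hrest).const_mul (-(1 / 2) : ℂ))
  have hv : -(1 / 2) * (f b * 0 - f c * l - ∫ _ in c..b, (0 : ℂ)) = l * f c / 2 := by
    rw [intervalIntegral.integral_zero]
    ring
  rw [hv] at h
  exact h.congr' (eventually_mem_nhdsWithin.mono fun t ht => (hparts t ht).symm)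

lemma tendsto_lambdaKernel_zero_zero :
    Tendsto (fun t => lambdaKernel 0 t ((0 : ℝ) : ℂ)) (𝓝[>] 0) (𝓝 1) := by
  refine tendsto_const_nhds.congr fun t => ?_
  simp [lambdaKernel, bigLambda_zero]

lemma tendsto_integral_lambdaKernel_mul (κ : ℝ) {f : ℝ → ℂ} {c b : ℝ} (hc : 0 < c) (hcb : c < b)
    (hf : ContinuousOn f (Icc c b)) :
    Tendsto (fun t => ∫ s in c..b, lambdaKernel κ t s * f s) (𝓝[>] 0) (𝓝 0) := by
  obtain ⟨C, hC⟩ := isCompact_Icc.exists_bound_of_continuousOn hf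
  have h := ((tendsto_sqrt_bound c).mul_const C).mul_const |b - c|
  rw [zero_mul, zero_mul] at h
  refine squeeze_zero_norm' ?_ h
  filter_upwards [eventually_norm_lambdaKernel_le κ hc] with t ht
  refine intervalIntegral.norm_integral_le_of_norm_le_const fun s hs => ?_
  rw [uIoc_of_le hcb.le] at hs
  rw [norm_mul]
  have h1 := ht s hs.1.le
  exact mul_le_mul h1 (hC s (Ioc_subset_Icc_self hs)) (norm_nonneg _) ((norm_nonneg _).trans h1)

/-- Away from `s = 0` the `Λ` terms are uniformly `O(√t)`, and the free kernel has no stationary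
point, so its endpoint contribution vanishes as well. -/
lemma tendsto_integral_layer_mul (A B C : ℂ) (κ ν : ℝ) {f f' : ℝ → ℂ} {c b : ℝ} (hc : 0 < c)
    (hcb : c < b) (hf : C1On f f' c b) :
    Tendsto (fun t => ∫ s in c..b, layer A B C κ ν t s * f s) (𝓝[>] 0) (𝓝 0) := by
  have h1 := (tendsto_integral_lambdaKernel_mul κ hc hcb hf.continuousOn).const_mul A
  have h2 := (tendsto_integral_lambdaKernel_mul ν hc hcb hf.continuousOn).const_mul B
  have h3 := (tendsto_integral_freeKernel_mul hc.le hcb hf (tendsto_lambdaKernel 0 hc)).const_mul C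
  have h := (h1.add h2).add h3
  have hv : A * 0 + B * 0 + C * (0 * f c / 2) = 0 := by ring
  rw [hv] at h
  refine h.congr' (eventually_mem_nhdsWithin.mono fun t ht => ?_)
  have hI : uIcc c b = Icc c b := uIcc_of_le hcb.le
  have hint : ∀ g : ℂ → ℂ, Continuous g → IntervalIntegrable (fun s : ℝ => g s * f s) volume c b :=
    fun g hg => ContinuousOn.intervalIntegrable (by
      rw [hI]
      exact (hg.comp Complex.continuous_ofReal).continuousOn.mul hf.continuousOn)
  have i1 := (hint _ (continuous_lambdaKernel κ ht)).const_mul A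
  have i2 := (hint _ (continuous_lambdaKernel ν ht)).const_mul B
  have i3 := (hint _ (continuous_freeKernel t)).const_mul C
  rw [← intervalIntegral.integral_const_mul, ← intervalIntegral.integral_const_mul,
    ← intervalIntegral.integral_const_mul, ← intervalIntegral.integral_add i1 i2,
    ← intervalIntegral.integral_add (i1.add i2) i3]
  refine intervalIntegral.integral_congr fun s _ => ?_
  simp only [layer]
  ring

lemma freeKernel_neg (t : ℝ) (s : ℂ) : freeKernel t (-s) = freeKernel t s := by
  simp [freeKernel]

/-- The free kernel is an approximate identity for smooth functions on a bounded interval. -/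
theorem tendsto_integral_freeKernel_sub_mul {f f' : ℝ → ℂ} {x b : ℝ} (hx : |x| < b)
    (hf : C1On f f' (-b) b) :
    Tendsto (fun t => ∫ y in (-b)..b, freeKernel t (x - y) * f y) (𝓝[>] 0) (𝓝 (f x)) := by
  obtain ⟨hx1, hx2⟩ := abs_lt.1 hx
  -- The interval is split at the stationary point `y = x`; after moving it to `0`, each side
  -- contributes half of `f x`.
  have hl : C1On (fun s => f (x - s)) (fun s => -f' (x - s)) 0 (x - -b) := by
    have := (hf.mono le_rfl hx2.le).comp_const_sub x
    rwa [sub_self] at this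
  have hr : C1On (fun s => f (s + x)) (fun s => f' (s + x)) 0 (b - x) := by
    have := (hf.mono hx1.le le_rfl).comp_add_const x
    rwa [sub_self] at this
  have h1 := tendsto_integral_freeKernel_mul le_rfl (by linarith) hl tendsto_lambdaKernel_zero_zero
  have h2 := tendsto_integral_freeKernel_mul le_rfl (by linarith) hr tendsto_lambdaKernel_zero_zero
  have h := h1.add h2
  have hv : 1 * f (x - 0) / 2 + 1 * f (0 + x) / 2 = f x := by
    rw [sub_zero, zero_add]
    ring
  rw [hv] at h
  refine h.congr fun t => ?_
  have hint : IntervalIntegrable (fun y : ℝ => freeKernel t (x - y) * f y) volume (-b) b := by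
    refine ContinuousOn.intervalIntegrable ?_
    rw [uIcc_of_le (by linarith)]
    exact ((continuous_freeKernel t).comp (by fun_prop)).continuousOn.mul hf.continuousOn
  have hs1 : uIcc (-b) x ⊆ uIcc (-b) b := by
    rw [uIcc_of_le hx1.le, uIcc_of_le (by linarith)]
    exact Icc_subset_Icc le_rfl hx2.le
  have hs2 : uIcc x b ⊆ uIcc (-b) b := by
    rw [uIcc_of_le hx2.le, uIcc_of_le (by linarith)]
    exact Icc_subset_Icc hx1.le le_rfl
  rw [← intervalIntegral.integral_add_adjacent_intervals (hint.mono_set hs1) (hint.mono_set hs2)]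
  congr 1
  · have := intervalIntegral.integral_comp_sub_left (a := -b) (b := x)
      (fun s : ℝ => freeKernel t s * f (x - s)) x
    rw [sub_self] at this
    rw [← this]
    refine intervalIntegral.integral_congr fun y _ => ?_
    simp only [sub_sub_cancel, Complex.ofReal_sub]
  · have := intervalIntegral.integral_comp_sub_right (a := x) (b := b)
      (fun s : ℝ => freeKernel t s * f (s + x)) x
    rw [sub_self] at this
    rw [← this]
    refine intervalIntegral.integral_congr fun y _ => ?_
    simp only [sub_add_cancel, Complex.ofReal_sub]
    rw [← freeKernel_neg, neg_sub]

section

variable {mP mM mO : ℝ → ℝ → ℂ} {κ ν : ℝ}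

lemma layeredGreen_pos (hP : SignInvariant mP) (hM : SignInvariant mM) (hO : SignInvariant mO)
    {t x y : ℝ} (hx : x ≠ 0) (hy : 0 < y) : layeredGreen mP mM mO κ ν t x y =
      layer (mP x 1) (mM x 1) (mO x 1) κ ν t ((|x| + y : ℝ) : ℂ) + freeKernel t (x - y) := by
  have hxx : 0 < x * x := mul_self_pos.2 hx
  have h1 : 0 < y * 1 := by linarith
  rw [layeredGreen, Complex.ofReal_re, hP _ _ _ _ hxx h1, hM _ _ _ _ hxx h1, hO _ _ _ _ hxx h1,
    sectorAbs_ofReal hy.ne', abs_of_pos hy, Complex.ofReal_add]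

lemma layeredGreen_neg (hP : SignInvariant mP) (hM : SignInvariant mM) (hO : SignInvariant mO)
    {t x y : ℝ} (hx : x ≠ 0) (hy : y < 0) : layeredGreen mP mM mO κ ν t x y =
      layer (mP x (-1)) (mM x (-1)) (mO x (-1)) κ ν t ((|x| - y : ℝ) : ℂ) +
        freeKernel t (x - y) := by
  have hxx : 0 < x * x := mul_self_pos.2 hx
  have h1 : 0 < y * -1 := by linarith
  rw [layeredGreen, Complex.ofReal_re, hP _ _ _ _ hxx h1, hM _ _ _ _ hxx h1, hO _ _ _ _ hxx h1,
    sectorAbs_ofReal hy.ne, abs_of_neg hy, sub_eq_add_neg |x|, Complex.ofReal_add]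

theorem initialCondition_layeredGreen (hP : SignInvariant mP) (hM : SignInvariant mM)
    (hO : SignInvariant mO) {x b : ℝ} (hx : x ≠ 0) (hxb : |x| < b) {f f' : ℝ → ℂ}
    (hf : C1On f f' (-b) b) :
    (∀ t, 0 < t →
      IntervalIntegrable (fun y : ℝ => layeredGreen mP mM mO κ ν t x y * f y) volume (-b) b) ∧
    Tendsto (fun t => ∫ y in (-b)..b, layeredGreen mP mM mO κ ν t x y * f y) (𝓝[>] 0)
      (𝓝 (f x)) := by
  have hx0 : 0 < |x| := abs_pos.2 hx
  have hb : 0 < b := hx0.trans hxb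
  have hfp : C1On f f' 0 b := hf.mono (by linarith) le_rfl
  have hfn : C1On f f' (-b) 0 := hf.mono le_rfl hb.le
  set LP := layer (mP x 1) (mM x 1) (mO x 1) κ ν
  set LN := layer (mP x (-1)) (mM x (-1)) (mO x (-1)) κ ν
  have cP : ∀ t, 0 < t → Continuous (LP t) := fun t ht =>
    (differentiable_layer _ _ _ κ ν ht).continuous
  have cN : ∀ t, 0 < t → Continuous (LN t) := fun t ht =>
    (differentiable_layer _ _ _ κ ν ht).continuous
  have iP : ∀ t, 0 < t →
      IntervalIntegrable (fun y : ℝ => LP t ((|x| + y : ℝ) : ℂ) * f y) volume 0 b := by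
    intro t ht
    refine ContinuousOn.intervalIntegrable ?_
    rw [uIcc_of_le hb.le]
    exact ((cP t ht).comp (by fun_prop)).continuousOn.mul hfp.continuousOn
  have iN : ∀ t, 0 < t →
      IntervalIntegrable (fun y : ℝ => LN t ((|x| - y : ℝ) : ℂ) * f y) volume (-b) 0 := by
    intro t ht
    refine ContinuousOn.intervalIntegrable ?_
    rw [uIcc_of_le (by linarith)]
    exact ((cN t ht).comp (by fun_prop)).continuousOn.mul hfn.continuousOn
  have iK : ∀ t, IntervalIntegrable (fun y : ℝ => freeKernel t (x - y) * f y) volume (-b) b := by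
    intro t
    refine ContinuousOn.intervalIntegrable ?_
    rw [uIcc_of_le (by linarith)]
    exact ((continuous_freeKernel t).comp (by fun_prop)).continuousOn.mul hf.continuousOn
  have hs1 : uIcc (-b) 0 ⊆ uIcc (-b) b := by
    rw [uIcc_of_le (by linarith), uIcc_of_le (by linarith)]
    exact Icc_subset_Icc le_rfl hb.le
  have hs2 : uIcc 0 b ⊆ uIcc (-b) b := by
    rw [uIcc_of_le hb.le, uIcc_of_le (by linarith)]
    exact Icc_subset_Icc (by linarith) le_rfl
  -- Only the open interval is available, since the coefficients are controlled by signs and `y = 0`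
  -- has none. Integrals do not see the endpoint.
  have eP : ∀ t, EqOn (fun y : ℝ => LP t ((|x| + y : ℝ) : ℂ) * f y + freeKernel t (x - y) * f y)
      (fun y : ℝ => layeredGreen mP mM mO κ ν t x y * f y) (uIoo 0 b) := by
    intro t y hy
    rw [uIoo_of_le hb.le] at hy
    simp only [layeredGreen_pos hP hM hO hx hy.1, add_mul, LP]
  have eN : ∀ t, EqOn (fun y : ℝ => LN t ((|x| - y : ℝ) : ℂ) * f y + freeKernel t (x - y) * f y)
      (fun y : ℝ => layeredGreen mP mM mO κ ν t x y * f y) (uIoo (-b) 0) := by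
    intro t y hy
    rw [uIoo_of_le (by linarith)] at hy
    simp only [layeredGreen_neg hP hM hO hx hy.2, add_mul, LN]
  have gP := fun t (ht : 0 < t) => ((iP t ht).add ((iK t).mono_set hs2)).congr_uIoo (eP t)
  have gN := fun t (ht : 0 < t) => ((iN t ht).add ((iK t).mono_set hs1)).congr_uIoo (eN t)
  refine ⟨fun t ht => (gN t ht).trans (gP t ht), ?_⟩
  -- In the variable `s = |x| + |y|` the integration starts at `|x| > 0`, so the layer tends to
  -- zero.
  have lP : Tendsto (fun t => ∫ y in (0 : ℝ)..b, LP t ((|x| + y : ℝ) : ℂ) * f y) (𝓝[>] 0)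
      (𝓝 0) := by
    have hC : C1On (fun s => f (s + -|x|)) (fun s => f' (s + -|x|)) (|x| + 0) (|x| + b) := by
      have := hfp.comp_add_const (-|x|)
      rwa [sub_neg_eq_add, sub_neg_eq_add, add_comm 0, add_comm b] at this
    refine (tendsto_integral_layer_mul (mP x 1) (mM x 1) (mO x 1) κ ν (by linarith) (by linarith)
      hC).congr fun t => ?_
    rw [← intervalIntegral.integral_comp_add_left
      (fun s : ℝ => layer (mP x 1) (mM x 1) (mO x 1) κ ν t s * f (s + -|x|)) |x|]
    refine intervalIntegral.integral_congr fun y _ => ?_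
    simp only [LP, add_neg_cancel_comm]
  have lN : Tendsto (fun t => ∫ y in (-b)..0, LN t ((|x| - y : ℝ) : ℂ) * f y) (𝓝[>] 0)
      (𝓝 0) := by
    have hC := hfn.comp_const_sub |x|
    refine (tendsto_integral_layer_mul (mP x (-1)) (mM x (-1)) (mO x (-1)) κ ν (by linarith)
      (by linarith) hC).congr fun t => ?_
    rw [← intervalIntegral.integral_comp_sub_left
      (fun s : ℝ => layer (mP x (-1)) (mM x (-1)) (mO x (-1)) κ ν t s * f (|x| - s)) |x|]
    refine intervalIntegral.integral_congr fun y _ => ?_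
    simp only [LN, sub_sub_cancel]
  have h := (lN.add lP).add (tendsto_integral_freeKernel_sub_mul hxb hf)
  rw [add_zero, zero_add] at h
  refine h.congr' (eventually_mem_nhdsWithin.mono fun t ht => ?_)
  beta_reduce
  rw [← intervalIntegral.integral_add_adjacent_intervals (gN t ht) (gP t ht),
    ← intervalIntegral.integral_congr_uIoo (eN t), ← intervalIntegral.integral_congr_uIoo (eP t),
    intervalIntegral.integral_add (iN t ht) ((iK t).mono_set hs1),
    intervalIntegral.integral_add (iP t ht) ((iK t).mono_set hs2),
    ← intervalIntegral.integral_add_adjacent_intervals ((iK t).mono_set hs1)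
      ((iK t).mono_set hs2)]
  ring

end

/-! ### The transmission condition -/

section

variable {M N : Matrix (Fin 2) (Fin 2) ℂ} {u v d e u' v' d' e' : ℂ}

lemma BoundaryRelation.add (h : BoundaryRelation M N u v d e)
    (h' : BoundaryRelation M N u' v' d' e') :
    BoundaryRelation M N (u + u') (v + v') (d + d') (e + e') := by
  unfold BoundaryRelation at *
  have e1 : (![u + u', v + v'] : Fin 2 → ℂ) = ![u, v] + ![u', v'] := by simp
  have e2 : (![d + d', -(e + e')] : Fin 2 → ℂ) = ![d, -e] + ![d', -e'] := by
    simp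
    ring
  rw [e1, e2, Matrix.mulVec_add, Matrix.mulVec_add, h, h']

lemma BoundaryRelation.smul (h : BoundaryRelation M N u v d e) (c : ℂ) :
    BoundaryRelation M N (c * u) (c * v) (c * d) (c * e) := by
  unfold BoundaryRelation at *
  have e1 : (![c * u, c * v] : Fin 2 → ℂ) = c • ![u, v] := by simp
  have e2 : (![c * d, -(c * e)] : Fin 2 → ℂ) = c • ![d, -e] := by simp
  rw [e1, e2, Matrix.mulVec_smul, Matrix.mulVec_smul, h]

lemma BoundaryRelation.congr (h : BoundaryRelation M N u v d e) (h1 : u = u') (h2 : v = v')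
    (h3 : d = d') (h4 : e = e') : BoundaryRelation M N u' v' d' e' := by
  subst h1 h2 h3 h4
  exact h

lemma interfaceCondition_iff (J : Matrix (Fin 2) (Fin 2) ℂ) :
    InterfaceCondition J u v d e ↔
      u - (J 0 0 * u + J 0 1 * v) = Complex.I * (d + J 0 0 * d - J 0 1 * e) ∧
      v - (J 1 0 * u + J 1 1 * v) = Complex.I * (-e + J 1 0 * d - J 1 1 * e) := by
  unfold InterfaceCondition BoundaryRelation
  rw [funext_iff, Fin.forall_fin_two]
  simp only [Matrix.mulVec, dotProduct, Fin.sum_univ_two, Matrix.sub_apply, Matrix.smul_apply,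
    Matrix.add_apply, Matrix.one_apply, Matrix.cons_val_zero, Matrix.cons_val_one, smul_eq_mul]
  norm_num
  constructor
  · rintro ⟨h1, h2⟩
    exact ⟨by linear_combination h1, by linear_combination h2⟩
  · rintro ⟨h1, h2⟩
    exact ⟨by linear_combination h1, by linear_combination h2⟩

/-- An eigenvector of `J` with eigenvalue `l` satisfies a Robin type relation with coefficient
`w` where `1 - l = i w (1 + l)`. -/
lemma interfaceCondition_of_eigenvector {J : Matrix (Fin 2) (Fin 2) ℂ} {l w : ℂ}
    (h1 : J 0 0 * u + J 0 1 * v = l * u) (h2 : J 1 0 * u + J 1 1 * v = l * v)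
    (hl : 1 - l = Complex.I * w * (1 + l)) : InterfaceCondition J u v (w * u) (-(w * v)) := by
  rw [interfaceCondition_iff]
  constructor
  · linear_combination u * hl - (1 + Complex.I * w) * h1
  · linear_combination v * hl - (1 + Complex.I * w) * h2

/-- Data in the eigenspace of `J` for the eigenvalue `-1`. -/
lemma interfaceCondition_of_eigenvector_neg_one {J : Matrix (Fin 2) (Fin 2) ℂ}
    (h1 : J 0 0 * u + J 0 1 * v = -1 * u) (h2 : J 1 0 * u + J 1 1 * v = -1 * v) :
    InterfaceCondition J 0 0 u (-v) := by
  rw [interfaceCondition_iff]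
  constructor
  · linear_combination -Complex.I * h1
  · linear_combination -Complex.I * h2

end

/-! ### Eigenvectors and eigenvalues of `J` in terms of the parameters -/

lemma unitaryOf_entries (φ : ℝ) (α β : ℂ) :
    unitaryOf φ α β 0 0 = Complex.exp (Complex.I * φ) * α ∧
    unitaryOf φ α β 0 1 = -(Complex.exp (Complex.I * φ) * conj β) ∧
    unitaryOf φ α β 1 0 = Complex.exp (Complex.I * φ) * β ∧
    unitaryOf φ α β 1 1 = Complex.exp (Complex.I * φ) * conj α := by
  simp [unitaryOf]

section Parameters

variable {φ : ℝ} {α β : ℂ}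

lemma re_sq_add_im_sq_add (h : ‖α‖ ^ 2 + ‖β‖ ^ 2 = 1) :
    (α.re : ℂ) ^ 2 + (α.im : ℂ) ^ 2 + β * conj β = 1 := by
  rw [Complex.mul_conj, Complex.normSq_eq_norm_sq, ← Complex.ofReal_pow, ← Complex.ofReal_pow,
    ← Complex.ofReal_add, ← Complex.ofReal_add, Complex.ofReal_eq_one, ← h,
    ← Complex.normSq_eq_norm_sq α, Complex.normSq_apply]
  ring

lemma re_sq_le_one (h : ‖α‖ ^ 2 + ‖β‖ ^ 2 = 1) : α.re ^ 2 ≤ 1 := by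
  have h1 := Complex.normSq_eq_norm_sq α
  rw [Complex.normSq_apply] at h1
  nlinarith [sq_nonneg ‖β‖, sq_nonneg α.im]

lemma sqrt_sq_one_sub (h : ‖α‖ ^ 2 + ‖β‖ ^ 2 = 1) : √(1 - α.re ^ 2) ^ 2 = 1 - α.re ^ 2 :=
  Real.sq_sqrt (by linarith [re_sq_le_one h])

lemma offdiag_eq_zero_of_abs_re_eq_one (h : ‖α‖ ^ 2 + ‖β‖ ^ 2 = 1) (ha : |α.re| = 1) :
    α.im = 0 ∧ β = 0 := by
  have h1 := Complex.normSq_eq_norm_sq α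
  rw [Complex.normSq_apply] at h1
  have h2 : α.re ^ 2 = 1 := by rw [← sq_abs, ha, one_pow]
  have h3 : α.im ^ 2 + ‖β‖ ^ 2 = 0 := by nlinarith
  have h4 : α.im ^ 2 = 0 := by nlinarith [sq_nonneg α.im, sq_nonneg ‖β‖]
  have h5 : ‖β‖ ^ 2 = 0 := by nlinarith [sq_nonneg α.im, sq_nonneg ‖β‖]
  exact ⟨pow_eq_zero_iff two_ne_zero |>.1 h4, norm_eq_zero.1 (pow_eq_zero_iff two_ne_zero |>.1 h5)⟩

/-- The columns `Θ(xy) ± η^{(x,y)}` are eigenvectors of `J`. -/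
lemma unitaryOf_eigenvector (h : ‖α‖ ^ 2 + ‖β‖ ^ 2 = 1) {ε : ℂ} (hε : ε ^ 2 = 1) {y : ℝ}
    (hy : y ≠ 0) :
    let J := unitaryOf φ α β
    let l := Complex.exp (Complex.I * φ) * (α.re - ε * Complex.I * (√(1 - α.re ^ 2) : ℝ))
    let u := heaviside (1 * y) + ε * eta α β 1 y
    let v := heaviside (-1 * y) + ε * eta α β (-1) y
    J 0 0 * u + J 0 1 * v = l * u ∧ J 1 0 * u + J 1 1 * v = l * v := by
  intro J l u v
  obtain ⟨j1, j2, j3, j4⟩ := unitaryOf_entries φ α β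
  have hα : α = α.re + α.im * Complex.I := (Complex.re_add_im α).symm
  have hα' : conj α = α.re - α.im * Complex.I := by
    apply Complex.ext <;> simp
  have hI := Complex.I_sq
  have hab := re_sq_add_im_sq_add h
  have hs : ((√(1 - α.re ^ 2) : ℝ) : ℂ) ^ 2 = 1 - (α.re : ℂ) ^ 2 := by
    exact_mod_cast sqrt_sq_one_sub h
  have n1 : ¬ (0 : ℝ) < -1 := by norm_num
  simp only [J, l, u, v, j1, j2, j3, j4]
  -- The matrix `B = e^{-iφ} J` has determinant `1` and trace `2 Re α`. If `|Re α| = 1` it is scalar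
  -- and every vector is an eigenvector. Otherwise, with `S = √(1 - (Re α)²)`, the entries `η` form
  -- the matrix `(B - Re α)/(-iS)`, whose square is the identity, so the vectors in question are
  -- columns of `1 + ε(B - Re α)/(-iS)`.
  by_cases ha : |α.re| = 1
  · obtain ⟨h1, h2⟩ := offdiag_eq_zero_of_abs_re_eq_one h ha
    have h3 : √(1 - α.re ^ 2) = 0 := by
      rw [← sq_abs, ha]
      simp
    have h4 : α = α.re := by
      rw [h1] at hα
      simpa using hα
    have h5 : conj α = α.re := by rw [hα', h1]; simp
    rw [h3, h5, h2]
    simp only [eta, if_pos ha, map_zero]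
    constructor
    · conv_lhs => rw [h4]
      simp
    · simp
  · have hs0 : ((√(1 - α.re ^ 2) : ℝ) : ℂ) ≠ 0 := by
      intro h0
      rw [h0] at hs
      have h1 : α.re ^ 2 = 1 := by
        have : (α.re : ℂ) ^ 2 = 1 := by linear_combination hs
        exact_mod_cast this
      exact ha ((sq_eq_sq₀ (abs_nonneg _) zero_le_one).1 (by rw [sq_abs, h1, one_pow]))
    rw [hα']
    generalize hbeta : conj β = β' at *
    rcases lt_or_gt_of_ne hy with hy | hy
    · have t1 : heaviside (1 * y) = 0 := if_neg (by linarith)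
      have t2 : heaviside (-1 * y) = 1 := if_pos (by linarith)
      simp only [eta, if_neg ha, t1, t2, if_pos (zero_lt_one' ℝ), if_neg n1, if_neg hy.not_gt, hbeta]
      generalize hS : ((√(1 - α.re ^ 2) : ℝ) : ℂ) = S at *
      generalize Complex.exp (Complex.I * φ) = w
      constructor
      · nth_rewrite 1 [hα]
        generalize (α.re : ℂ) = a at *
        generalize (α.im : ℂ) = b at *
        field_simp
        push_cast
        linear_combination (-w * b * ε * β' - w * S * β' * ε ^ 2) * hI + w * S * β' * hε
      · generalize (α.re : ℂ) = a at *
        generalize (α.im : ℂ) = b at *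
        field_simp
        push_cast
        linear_combination w * S * Complex.I * b * hε + w * ε * Complex.I * (hs - hab)
    · have t1 : heaviside (1 * y) = 1 := if_pos (by linarith)
      have t2 : heaviside (-1 * y) = 0 := if_neg (by linarith)
      simp only [eta, if_neg ha, t1, t2, if_pos (zero_lt_one' ℝ), if_neg n1, if_pos hy]
      generalize hS : ((√(1 - α.re ^ 2) : ℝ) : ℂ) = S at *
      generalize Complex.exp (Complex.I * φ) = w
      constructor
      · nth_rewrite 1 [hα]
        generalize (α.re : ℂ) = a at *
        generalize (α.im : ℂ) = b at *
        field_simp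
        push_cast
        linear_combination -w * b * Complex.I * S * hε + w * ε * Complex.I * (hs - hab)
      · generalize (α.re : ℂ) = a at *
        generalize (α.im : ℂ) = b at *
        field_simp
        push_cast
        linear_combination (w * β * S * ε ^ 2 - w * β * ε * b) * hI - w * β * S * hε

end Parameters

section

variable {φ : ℝ} {α β : ℂ}

lemma exp_I_mul_ofReal (φ : ℝ) :
    Complex.exp (Complex.I * φ) = (Real.cos φ : ℂ) + (Real.sin φ : ℂ) * Complex.I := by
  rw [mul_comm, Complex.exp_mul_I, Complex.ofReal_cos, Complex.ofReal_sin]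

lemma cos_sq_add_sin_sq_ofReal (φ : ℝ) : (Real.cos φ : ℂ) ^ 2 + (Real.sin φ : ℂ) ^ 2 = 1 := by
  exact_mod_cast Real.cos_sq_add_sin_sq φ

/-- With `Re α = cos χ` and `ε√(1 - (Re α)²) = sin χ` one has `l = e^{i(φ - χ)}`, and the Cayley
transform of `l` is `-tan((φ - χ)/2) = (sin χ - sin φ)/(cos φ + cos χ)`. -/
lemma eigenvalue_relation (h : ‖α‖ ^ 2 + ‖β‖ ^ 2 = 1) (hne : Real.cos φ + α.re ≠ 0) {ε : ℂ}
    (hε : ε ^ 2 = 1) :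
    let l := Complex.exp (Complex.I * φ) * (α.re - ε * Complex.I * (√(1 - α.re ^ 2) : ℝ))
    1 - l = Complex.I * ((-(Real.sin φ : ℂ) + ε * (√(1 - α.re ^ 2) : ℝ)) /
      ((Real.cos φ : ℂ) + α.re)) * (1 + l) := by
  intro l
  have hs : ((√(1 - α.re ^ 2) : ℝ) : ℂ) ^ 2 = 1 - (α.re : ℂ) ^ 2 := by
    exact_mod_cast sqrt_sq_one_sub h
  have hne' : (Real.cos φ : ℂ) + α.re ≠ 0 := by exact_mod_cast hne
  have hcd := cos_sq_add_sin_sq_ofReal φ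
  have hI := Complex.I_sq
  simp only [l, exp_I_mul_ofReal]
  generalize ((√(1 - α.re ^ 2) : ℝ) : ℂ) = s at *
  generalize (α.re : ℂ) = a at *
  generalize (Real.cos φ : ℂ) = c at *
  generalize (Real.sin φ : ℂ) = d at *
  have hεs : (ε * s) ^ 2 = 1 - a ^ 2 := by rw [mul_pow, hε, hs, one_mul]
  rw [mul_assoc ε, mul_comm Complex.I s, ← mul_assoc ε]
  generalize ε * s = p at *
  field_simp
  linear_combination (-a + p * Complex.I) * hcd + (-c - d * Complex.I) * hεs +
    (c * p ^ 2 + d ^ 2 * a + d * p ^ 2 * Complex.I - d ^ 2 * Complex.I * p) * hI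

lemma heaviside_of_pos {x : ℝ} (hx : 0 < x) : heaviside x = 1 := if_pos hx

lemma heaviside_of_neg {x : ℝ} (hx : x < 0) : heaviside x = 0 := if_neg hx.le.not_gt

/-- The data attached to the coefficients of the Green's function satisfy the interface
condition. -/
structure InterfaceCoefficients (φ : ℝ) (α β : ℂ) (y : ℝ) : Prop where
  plus : InterfaceCondition (unitaryOf φ α β) (muP φ α β 1 y) (muP φ α β (-1) y)
    (omegaP φ α * muP φ α β 1 y) (-(omegaP φ α * muP φ α β (-1) y))
  minus : InterfaceCondition (unitaryOf φ α β) (muM φ α β 1 y) (muM φ α β (-1) y)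
    (omegaM φ α * muM φ α β 1 y) (-(omegaM φ α * muM φ α β (-1) y))
  zero : InterfaceCondition (unitaryOf φ α β) (muZero φ α β 1 y + 1) (muZero φ α β (-1) y + 1)
    (-2 * (muP φ α β 1 y + muM φ α β 1 y)) (2 * (muP φ α β (-1) y + muM φ α β (-1) y))
  deriv_zero : InterfaceCondition (unitaryOf φ α β) 0 0
    (-muZero φ α β 1 y + Real.sign y) (muZero φ α β (-1) y + Real.sign y)

lemma interfaceCondition_zero (J : Matrix (Fin 2) (Fin 2) ℂ) : InterfaceCondition J 0 0 0 0 := by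
  rw [interfaceCondition_iff]
  simp

/-- Neither eigenvalue is `-1`, so both eigenvectors give Robin type data with real coefficients
`ω_±`. The coefficient of the free kernel is the sum of the two eigenvector data because `sgn + 1 =
2Θ`, and the choice `μ₀ = sgn(xy)` makes the last field vanish. -/
lemma interfaceCoefficients_of_ne (h : ‖α‖ ^ 2 + ‖β‖ ^ 2 = 1) (hne : α.re ≠ -Real.cos φ) {y : ℝ}
    (hy : y ≠ 0) : InterfaceCoefficients φ α β y := by
  have hne' : Real.cos φ + α.re ≠ 0 := fun h0 => hne (by linarith)
  obtain ⟨p1, p2⟩ := unitaryOf_eigenvector (φ := φ) h (one_pow 2 : (1 : ℂ) ^ 2 = 1) hy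
  obtain ⟨m1, m2⟩ := unitaryOf_eigenvector (φ := φ) h (by norm_num : (-1 : ℂ) ^ 2 = 1) hy
  have P := interfaceCondition_of_eigenvector p1 p2
    (eigenvalue_relation h hne' (one_pow 2 : (1 : ℂ) ^ 2 = 1))
  have M := interfaceCondition_of_eigenvector m1 m2
    (eigenvalue_relation h hne' (by norm_num : (-1 : ℂ) ^ 2 = 1))
  have oP : (omegaP φ α : ℂ) =
      (-(Real.sin φ : ℂ) + 1 * (√(1 - α.re ^ 2) : ℝ)) / ((Real.cos φ : ℂ) + α.re) := by
    rw [omegaP, if_pos hne]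
    push_cast
    ring
  have oM : (omegaM φ α : ℂ) =
      (-(Real.sin φ : ℂ) + -1 * (√(1 - α.re ^ 2) : ℝ)) / ((Real.cos φ : ℂ) + α.re) := by
    rw [omegaM, if_pos hne]
    push_cast
    ring
  rw [← oP] at P
  rw [← oM] at M
  have eP : ∀ x, muP φ α β x y =
      -(omegaP φ α : ℂ) / 2 * (heaviside (x * y) + 1 * eta α β x y) := fun x => by
    rw [muP, if_pos hne, one_mul]
  have eM : ∀ x, muM φ α β x y =
      -(omegaM φ α : ℂ) / 2 * (heaviside (x * y) + -1 * eta α β x y) := fun x => by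
    rw [muM, if_pos hne]
    ring
  have eO : ∀ x, muZero φ α β x y = Real.sign (x * y) := fun x => by
    rw [muZero, if_pos hne]
  have hsgn : ((Real.sign (1 * y) : ℝ) : ℂ) + 1 = 2 * heaviside (1 * y) ∧
      ((Real.sign (-1 * y) : ℝ) : ℂ) + 1 = 2 * heaviside (-1 * y) := by
    rw [one_mul, neg_one_mul]
    rcases lt_or_gt_of_ne hy with hy | hy
    · rw [heaviside_of_neg hy, heaviside_of_pos (neg_pos.2 hy), Real.sign_of_neg hy,
        Real.sign_of_pos (neg_pos.2 hy)]
      norm_num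
    · rw [heaviside_of_pos hy, heaviside_of_neg (neg_lt_zero.2 hy), Real.sign_of_pos hy,
        Real.sign_of_neg (neg_lt_zero.2 hy)]
      norm_num
  refine ⟨?_, ?_, ?_, ?_⟩
  · exact (BoundaryRelation.smul P (-(omegaP φ α : ℂ) / 2)).congr (eP 1).symm (eP (-1)).symm
      (by rw [eP]; ring) (by rw [eP]; ring)
  · exact (BoundaryRelation.smul M (-(omegaM φ α : ℂ) / 2)).congr (eM 1).symm (eM (-1)).symm
      (by rw [eM]; ring) (by rw [eM]; ring)
  · refine (BoundaryRelation.add P M).congr ?_ ?_ ?_ ?_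
    · rw [eO, hsgn.1]
      ring
    · rw [eO, hsgn.2]
      ring
    · rw [eP, eM]
      ring
    · rw [eP, eM]
      ring
  · refine BoundaryRelation.congr (interfaceCondition_zero _) rfl rfl ?_ ?_
    · rw [eO, one_mul, neg_add_cancel]
    · rw [eO, neg_one_mul, Real.sign_neg]
      simp

/-- The eigenvalue for `ε = -1` is now `-1`, and its eigenvector `Θ - η` may only occur in the
derivatives, with zero boundary values. The choice of `μ₀` arranges this: `μ₀ + 1 = Θ + η` belongs
to the other eigenspace, while `Θ - η` appears in the `deriv_zero` data. -/
lemma interfaceCoefficients_of_eq (h : ‖α‖ ^ 2 + ‖β‖ ^ 2 = 1) (h0 : 0 ≤ φ) (hπ : φ < Real.pi)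
    (heq : α.re = -Real.cos φ) (hne : α.re ≠ -1) {y : ℝ} (hy : y ≠ 0) :
    InterfaceCoefficients φ α β y := by
  have hφ : 0 < φ := by
    rcases h0.eq_or_lt with h1 | h1
    · rw [← h1, Real.cos_zero] at heq
      exact absurd heq hne
    · exact h1
  have hsin : 0 < Real.sin φ := Real.sin_pos_of_pos_of_lt_pi hφ hπ
  have hsq : √(1 - α.re ^ 2) = Real.sin φ := by
    rw [heq, neg_sq, ← Real.sin_sq, Real.sqrt_sq hsin.le]
  have hsin' : (Real.sin φ : ℂ) ≠ 0 := by exact_mod_cast hsin.ne'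
  have hcd := cos_sq_add_sin_sq_ofReal φ
  have hI := Complex.I_sq
  obtain ⟨p1, p2⟩ := unitaryOf_eigenvector (φ := φ) h (one_pow 2 : (1 : ℂ) ^ 2 = 1) hy
  obtain ⟨m1, m2⟩ := unitaryOf_eigenvector (φ := φ) h (by norm_num : (-1 : ℂ) ^ 2 = 1) hy
  have oP : (omegaP φ α : ℂ) = (Real.cos φ : ℂ) / (Real.sin φ : ℂ) := by
    rw [omegaP, if_neg (not_not.2 heq), if_pos hne]
    push_cast
    rfl
  have hlP : 1 - Complex.exp (Complex.I * φ) *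
      (α.re - 1 * Complex.I * (√(1 - α.re ^ 2) : ℝ)) = Complex.I * omegaP φ α *
      (1 + Complex.exp (Complex.I * φ) * (α.re - 1 * Complex.I * (√(1 - α.re ^ 2) : ℝ))) := by
    rw [hsq, heq, oP, exp_I_mul_ofReal, Complex.ofReal_neg]
    generalize (Real.cos φ : ℂ) = c at *
    generalize (Real.sin φ : ℂ) = d at *
    field_simp
    linear_combination (c * Complex.I - d) * hcd +
      (2 * d * c ^ 2 + d ^ 2 * c * Complex.I + d ^ 3) * hI
  have hlM : Complex.exp (Complex.I * φ) *
      (α.re - -1 * Complex.I * (√(1 - α.re ^ 2) : ℝ)) = -1 := by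
    rw [hsq, heq, exp_I_mul_ofReal, Complex.ofReal_neg]
    linear_combination -hcd + (Real.sin φ : ℂ) ^ 2 * hI
  rw [hlM] at m1 m2
  have P := interfaceCondition_of_eigenvector p1 p2 hlP
  have M := interfaceCondition_of_eigenvector_neg_one m1 m2
  have eP : ∀ x, muP φ α β x y =
      -(omegaP φ α : ℂ) / 2 * (heaviside (x * y) + 1 * eta α β x y) := fun x => by
    rw [muP, if_neg (not_not.2 heq), if_pos hne, one_mul]
  have eM : ∀ x, muM φ α β x y = 0 := fun x => by
    rw [muM, if_neg (not_not.2 heq)]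
  have eO : ∀ x, muZero φ α β x y = eta α β x y - heaviside (-(x * y)) := fun x => by
    rw [muZero, if_neg (not_not.2 heq), if_pos hne]
  have hv : heaviside (1 * y) + heaviside (-(1 * y)) = 1 ∧
      heaviside (-1 * y) + heaviside (-(-1 * y)) = 1 ∧
      heaviside (-(1 * y)) + Real.sign y = heaviside (1 * y) ∧
      heaviside (-(-1 * y)) - Real.sign y = heaviside (-1 * y) := by
    rw [one_mul, neg_one_mul, neg_neg]
    rcases lt_or_gt_of_ne hy with hy | hy
    · rw [heaviside_of_neg hy, heaviside_of_pos (neg_pos.2 hy), Real.sign_of_neg hy]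
      norm_num
    · rw [heaviside_of_pos hy, heaviside_of_neg (neg_lt_zero.2 hy), Real.sign_of_pos hy]
      norm_num
  obtain ⟨v1, v2, v3, v4⟩ := hv
  have v1' : (heaviside (1 * y) : ℂ) + heaviside (-(1 * y)) = 1 := by exact_mod_cast v1
  have v2' : (heaviside (-1 * y) : ℂ) + heaviside (-(-1 * y)) = 1 := by exact_mod_cast v2
  have v3' : (heaviside (-(1 * y)) : ℂ) + Real.sign y = heaviside (1 * y) := by exact_mod_cast v3
  have v4' : (heaviside (-(-1 * y)) : ℂ) - Real.sign y = heaviside (-1 * y) := by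
    exact_mod_cast v4
  refine ⟨?_, ?_, ?_, ?_⟩
  · exact (BoundaryRelation.smul P (-(omegaP φ α : ℂ) / 2)).congr (eP 1).symm (eP (-1)).symm
      (by rw [eP]; ring) (by rw [eP]; ring)
  · exact BoundaryRelation.congr (interfaceCondition_zero _) (eM _).symm (eM _).symm
      (by rw [eM]; ring) (by rw [eM]; ring)
  · refine BoundaryRelation.congr P ?_ ?_ ?_ ?_
    · rw [eO]
      linear_combination v1'
    · rw [eO]
      linear_combination v2'
    · rw [eP, eM]
      ring
    · rw [eP, eM]
      ring
  · refine BoundaryRelation.congr M rfl rfl ?_ ?_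
    · rw [eO]
      linear_combination -v3'
    · rw [eO]
      linear_combination v4'

/-- Here `J = -I`, the Dirichlet condition on both sides, and the layer is the reflected free kernel
with a minus sign. -/
lemma interfaceCoefficients_of_eq_neg_one (h : ‖α‖ ^ 2 + ‖β‖ ^ 2 = 1) (h0 : 0 ≤ φ)
    (hπ : φ < Real.pi) (heq : α.re = -Real.cos φ) (h1 : α.re = -1) (y : ℝ) :
    InterfaceCoefficients φ α β y := by
  obtain ⟨hb, hβ⟩ := offdiag_eq_zero_of_abs_re_eq_one h (by rw [h1]; simp)
  have hα : α = -1 := Complex.ext (by simpa using h1) (by simpa using hb)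
  have hφ : φ = 0 := by
    have hc : Real.cos φ = Real.cos 0 := by
      rw [Real.cos_zero]
      linarith
    exact Real.injOn_cos ⟨h0, hπ.le⟩ ⟨le_rfl, Real.pi_pos.le⟩ hc
  obtain ⟨j1, j2, j3, j4⟩ := unitaryOf_entries φ α β
  have eP : ∀ x, muP φ α β x y = 0 := fun x => by
    rw [muP, if_neg (not_not.2 heq), if_neg (not_not.2 h1)]
  have eM : ∀ x, muM φ α β x y = 0 := fun x => by rw [muM, if_neg (not_not.2 heq)]
  have eO : ∀ x, muZero φ α β x y = -1 := fun x => by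
    rw [muZero, if_neg (not_not.2 heq), if_neg (not_not.2 h1)]
  have hz := interfaceCondition_zero (unitaryOf φ α β)
  refine ⟨?_, ?_, ?_, ?_⟩
  · simpa only [eP, mul_zero, neg_zero] using hz
  · simpa only [eM, mul_zero, neg_zero] using hz
  · simpa only [eP, eM, eO, mul_zero, add_zero, neg_add_cancel] using hz
  · rw [interfaceCondition_iff, j1, j2, j3, j4, hφ, hα, hβ]
    simp

theorem interfaceCoefficients (h : ‖α‖ ^ 2 + ‖β‖ ^ 2 = 1) (h0 : 0 ≤ φ) (hπ : φ < Real.pi) {y : ℝ}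
    (hy : y ≠ 0) : InterfaceCoefficients φ α β y := by
  by_cases heq : α.re = -Real.cos φ
  · by_cases h1 : α.re = -1
    · exact interfaceCoefficients_of_eq_neg_one h h0 hπ heq h1 y
    · exact interfaceCoefficients_of_eq h h0 hπ heq h1 hy
  · exact interfaceCoefficients_of_ne h heq hy

/-- The boundary data of the Green's function satisfy the interface condition. -/
theorem interfaceCondition_layer (h : ‖α‖ ^ 2 + ‖β‖ ^ 2 = 1) (h0 : 0 ≤ φ) (hπ : φ < Real.pi)
    {y : ℝ} (hy : y ≠ 0) (t : ℝ) :
    let L := fun x => layer (muP φ α β x y) (muM φ α β x y) (muZero φ α β x y) (omegaP φ α)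
      (omegaM φ α) t ((|y| : ℝ) : ℂ)
    let L' := fun x => layerDeriv (muP φ α β x y) (muM φ α β x y) (muZero φ α β x y) (omegaP φ α)
      (omegaM φ α) t ((|y| : ℝ) : ℂ)
    let k := freeKernel t (-(y : ℂ))
    let k' := -(-(y : ℂ) / (2 * Complex.I * t)) * freeKernel t (-(y : ℂ))
    InterfaceCondition (unitaryOf φ α β) (L 1 + k) (L (-1) + k) (L' 1 + k') (-L' (-1) + k') := by
  intro L L' k k'
  obtain ⟨hP, hM, hO, hD⟩ := interfaceCoefficients h h0 hπ hy
  have hyk : freeKernel t (-(y : ℂ)) = freeKernel t ((|y| : ℝ) : ℂ) := by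
    rcases lt_or_gt_of_ne hy with hy | hy
    · rw [abs_of_neg hy, Complex.ofReal_neg]
    · rw [abs_of_pos hy, freeKernel_neg]
  have hys : (y : ℂ) = Real.sign y * ((|y| : ℝ) : ℂ) := by
    rcases lt_or_gt_of_ne hy with hy | hy
    · rw [abs_of_neg hy, Real.sign_of_neg hy]
      push_cast
      ring
    · rw [abs_of_pos hy, Real.sign_of_pos hy]
      push_cast
      ring
  -- Linearity of the relation: the boundary data are the four coefficient vectors weighted by
  -- `L_{ω₊}`, `L_{ω₋}`, `K` and `(|y|/(2it)) K`. The source term joins the last two, which explains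
  -- the `+ 1` and the `Real.sign y` there.
  have R := (((hP.smul (lambdaKernel (omegaP φ α) t ((|y| : ℝ) : ℂ))).add
    (hM.smul (lambdaKernel (omegaM φ α) t ((|y| : ℝ) : ℂ)))).add
    (hO.smul (freeKernel t ((|y| : ℝ) : ℂ)))).add
    (hD.smul (((|y| : ℝ) : ℂ) / (2 * Complex.I * t) * freeKernel t ((|y| : ℝ) : ℂ)))
  refine R.congr ?_ ?_ ?_ ?_
  · simp only [L, k, layer, hyk]
    ring
  · simp only [L, k, layer, hyk]
    ring
  · simp only [L', k', layerDeriv, hyk]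
    linear_combination (-freeKernel t ((|y| : ℝ) : ℂ) / (2 * Complex.I * t)) * hys
  · simp only [L', k', layerDeriv, hyk]
    linear_combination (-freeKernel t ((|y| : ℝ) : ℂ) / (2 * Complex.I * t)) * hys

end

/-! ### Unitary matrices and special cases -/

/-- Dividing `J` by a square root `e^{iφ}` of its determinant gives an element of `SU(2)`, which is
determined by its first column. -/
lemma exists_represents {J : Matrix (Fin 2) (Fin 2) ℂ} (hJ : J ∈ Matrix.unitaryGroup (Fin 2) ℂ) :
    ∃ (φ : ℝ) (α β : ℂ), Represents φ α β J := by
  obtain ⟨φ, h0, hπ, hdet⟩ : ∃ φ : ℝ, 0 ≤ φ ∧ φ < Real.pi ∧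
      Complex.exp (Complex.I * φ) ^ 2 = J.det := by
    have hn : ‖J.det‖ = 1 := CStarRing.norm_of_mem_unitary (Matrix.det_of_mem_unitary hJ)
    have he : J.det = Complex.exp (J.det.arg * Complex.I) := by
      have := Complex.norm_mul_exp_arg_mul_I J.det
      rw [hn] at this
      simpa using this.symm
    have h1 := Complex.neg_pi_lt_arg J.det
    have h2 := Complex.arg_le_pi J.det
    have hpi := Real.pi_pos
    -- Half the argument lies in `(-π/2, π/2]`; a negative value is shifted by `π`, which only
    -- changes the sign of the root.
    rcases le_or_gt 0 J.det.arg with h | h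
    · refine ⟨J.det.arg / 2, by linarith, by linarith, ?_⟩
      rw [← Complex.exp_nat_mul]
      conv_rhs => rw [he]
      congr 1
      push_cast
      ring
    · refine ⟨J.det.arg / 2 + Real.pi, by linarith, by linarith, ?_⟩
      rw [← Complex.exp_nat_mul]
      conv_rhs => rw [he, ← Complex.exp_periodic]
      congr 1
      push_cast
      ring
  set e := Complex.exp (Complex.I * φ) with he
  have hee : conj e * e = 1 := by
    rw [he, ← Complex.exp_conj, ← Complex.exp_add]
    simp
  have hJ1 := Matrix.mem_unitaryGroup_iff'.1 hJ
  -- Comparing entries of the adjugate and the adjoint expresses the second column through the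
  -- first.
  have hadj : J.adjugate = J.det • star J := by
    calc J.adjugate = star J * J * J.adjugate := by rw [hJ1, one_mul]
      _ = J.det • star J := by
        rw [mul_assoc, Matrix.mul_adjugate, mul_smul_comm, mul_one]
  have h11 : J 1 1 = J.det * conj (J 0 0) := by
    have := congr_fun (congr_fun hadj 0) 0
    simpa [Matrix.adjugate_fin_two, Matrix.star_apply] using this
  have h01 : -J 0 1 = J.det * conj (J 1 0) := by
    have := congr_fun (congr_fun hadj 0) 1
    simpa [Matrix.adjugate_fin_two, Matrix.star_apply] using this
  have hcol : ‖J 0 0‖ ^ 2 + ‖J 1 0‖ ^ 2 = 1 := by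
    have := congr_fun (congr_fun hJ1 0) 0
    simp only [Matrix.mul_apply, Fin.sum_univ_two, Matrix.star_apply, Matrix.one_apply_eq] at this
    have h2 : ((‖J 0 0‖ ^ 2 + ‖J 1 0‖ ^ 2 : ℝ) : ℂ) = 1 := by
      rw [← this]
      push_cast
      rw [← Complex.conj_mul', ← Complex.conj_mul']
      rfl
    exact_mod_cast h2
  have hne : ‖conj e‖ = 1 := by
    have h3 : ‖e‖ = 1 := by
      rw [he, mul_comm, Complex.norm_exp_ofReal_mul_I]
    rw [RCLike.norm_conj, h3]
  refine ⟨φ, conj e * J 0 0, conj e * J 1 0, h0, hπ, ?_, ?_⟩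
  · rw [norm_mul, norm_mul, hne, one_mul, one_mul, hcol]
  · obtain ⟨j1, j2, j3, j4⟩ := unitaryOf_entries φ (conj e * J 0 0) (conj e * J 1 0)
    rw [← he] at j1 j2 j3 j4
    simp only [map_mul, Complex.conj_conj] at j2 j4
    ext i k
    fin_cases i <;> fin_cases k
    · simp only [Fin.zero_eta, Fin.isValue, j1]
      linear_combination -J 0 0 * hee
    · simp only [Fin.zero_eta, Fin.mk_one, Fin.isValue, j2]
      linear_combination -h01 + conj (J 1 0) * hdet
    · simp only [Fin.zero_eta, Fin.mk_one, Fin.isValue, j3]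
      linear_combination -J 1 0 * hee
    · simp only [Fin.mk_one, Fin.isValue, j4]
      linear_combination h11 - conj (J 0 0) * hdet

/-! ### Cayley transforms and the special interface conditions -/

lemma conj_mul_self_eq_one {l p : ℂ} (hp : p ≠ 0) (hl : l * p = conj p) : conj l * l = 1 := by
  have hp' : conj p ≠ 0 := (map_ne_zero _).2 hp
  have h1 : conj l * conj p = p := by rw [← map_mul, hl, Complex.conj_conj]
  have h2 : (conj l * l) * (p * conj p) = 1 * (p * conj p) := by
    linear_combination conj p * conj l * hl + conj p * h1
  exact mul_right_cancel₀ (mul_ne_zero hp hp') h2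

lemma diagonal_mem_unitaryGroup {l m : ℂ} (hl : conj l * l = 1) (hm : conj m * m = 1) :
    !![l, 0; 0, m] ∈ Matrix.unitaryGroup (Fin 2) ℂ := by
  rw [Matrix.mem_unitaryGroup_iff']
  ext i k
  fin_cases i <;> fin_cases k <;>
    simp [Matrix.mul_apply, Fin.sum_univ_two, Matrix.star_apply, hl, hm]

/-- The matrix has eigenvectors `(1, 1)` and `(1, -1)` with eigenvalues `l` and `m`. It serves the
conditions symmetric under reflection, `δ` and `δ'`, where sums and differences of boundary data
decouple. -/
lemma symmetric_mem_unitaryGroup {l m : ℂ} (hl : conj l * l = 1) (hm : conj m * m = 1) :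
    !![(l + m) / 2, (l - m) / 2; (l - m) / 2, (l + m) / 2] ∈ Matrix.unitaryGroup (Fin 2) ℂ := by
  have h2 : conj (2 : ℂ) = 2 := map_ofNat _ 2
  rw [Matrix.mem_unitaryGroup_iff']
  ext i k
  fin_cases i <;> fin_cases k <;>
    simp [Matrix.mul_apply, Fin.sum_univ_two, Matrix.star_apply, h2]
  · linear_combination hl / 2 + hm / 2
  · linear_combination hl / 2 - hm / 2
  · linear_combination hl / 2 - hm / 2
  · linear_combination hl / 2 + hm / 2

lemma interfaceCondition_symmetric_iff {l m u v d e : ℂ} :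
    InterfaceCondition !![(l + m) / 2, (l - m) / 2; (l - m) / 2, (l + m) / 2] u v d e ↔
      (1 - l) * (u + v) = Complex.I * (1 + l) * (d - e) ∧
      (1 - m) * (u - v) = Complex.I * (1 + m) * (d + e) := by
  rw [interfaceCondition_iff]
  simp only [Matrix.of_apply, Matrix.cons_val', Matrix.cons_val_zero, Matrix.cons_val_one,
    Matrix.cons_val_fin_one]
  constructor
  · rintro ⟨h1, h2⟩
    exact ⟨by linear_combination h1 + h2, by linear_combination h1 - h2⟩
  · rintro ⟨h1, h2⟩
    exact ⟨by linear_combination h1 / 2 + h2 / 2, by linear_combination h1 / 2 - h2 / 2⟩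

lemma interfaceCondition_diagonal_iff {l m u v d e : ℂ} :
    InterfaceCondition !![l, 0; 0, m] u v d e ↔
      (1 - l) * u = Complex.I * (1 + l) * d ∧ (1 - m) * v = -(Complex.I * (1 + m) * e) := by
  rw [interfaceCondition_iff]
  simp only [Matrix.of_apply, Matrix.cons_val', Matrix.cons_val_zero, Matrix.cons_val_one,
    Matrix.cons_val_fin_one]
  constructor
  · rintro ⟨h1, h2⟩
    exact ⟨by linear_combination h1, by linear_combination h2⟩
  · rintro ⟨h1, h2⟩
    exact ⟨by linear_combination h1, by linear_combination h2⟩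

/-- With the Cayley transform `l = (b - ia)/(b + ia)`, the relation `(1 - l) u = i (1 + l) d`
is `a u = b d`. -/
lemma cayley_relation_iff {l a b u d : ℂ} (hne : b + Complex.I * a ≠ 0)
    (hl : l * (b + Complex.I * a) = b - Complex.I * a) :
    (1 - l) * u = Complex.I * (1 + l) * d ↔ a * u = b * d := by
  have h1 : (b + Complex.I * a) * ((1 - l) * u - Complex.I * (1 + l) * d) =
      2 * Complex.I * (a * u - b * d) := by
    linear_combination (-u - Complex.I * d) * hl
  constructor
  · intro h
    rw [h, sub_self, mul_zero] at h1
    have := (mul_eq_zero.1 h1.symm).resolve_left (by simp)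
    linear_combination this
  · intro h
    rw [h, sub_self, mul_zero] at h1
    have := (mul_eq_zero.1 h1).resolve_left hne
    linear_combination this

/-- The Cayley transform of a real ratio. -/
lemma exists_cayley (a b : ℝ) (h : a ≠ 0 ∨ b ≠ 0) :
    ∃ l : ℂ, conj l * l = 1 ∧
      ∀ u d : ℂ, (1 - l) * u = Complex.I * (1 + l) * d ↔ a * u = b * d := by
  have hne : (b : ℂ) + Complex.I * a ≠ 0 := by
    intro h0
    have h1 := congr_arg Complex.re h0
    have h2 := congr_arg Complex.im h0
    simp at h1 h2
    tauto
  have hl : ((b : ℂ) - Complex.I * a) / (b + Complex.I * a) * (b + Complex.I * a) =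
      b - Complex.I * a := div_mul_cancel₀ _ hne
  refine ⟨((b : ℂ) - Complex.I * a) / (b + Complex.I * a), ?_, fun u d =>
    cayley_relation_iff hne hl⟩
  refine conj_mul_self_eq_one hne (hl.trans ?_)
  simp
  ring

/-- The eigenvalue `-1` on `(1, -1)` forces continuity; the Cayley parameter on `(1, 1)` encodes
`c(u₊ + u₋) = 2(d₊ - d₋)`. -/
lemma isCoveredByUnitary_delta (c : ℝ) :
    IsCoveredByUnitary fun uP uM dP dM => uP = uM ∧ dP - dM = c * uP := by
  obtain ⟨l, hl, h⟩ := exists_cayley c 2 (Or.inr two_ne_zero)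
  refine ⟨_, symmetric_mem_unitaryGroup hl (by simp : conj (-1 : ℂ) * -1 = 1), ?_⟩
  intro u v d e
  rw [interfaceCondition_symmetric_iff, h]
  push_cast
  constructor
  · rintro ⟨h1, h2⟩
    have h3 : u = v := by linear_combination h2 / 2
    subst h3
    exact ⟨rfl, by linear_combination -h1 / 2⟩
  · rintro ⟨rfl, h2⟩
    exact ⟨by linear_combination -2 * h2, by ring⟩

/-- The roles of the eigenvectors are exchanged: eigenvalue `1` on `(1, 1)` forces `d₊ = d₋`, and
`(1, -1)` carries `2(u₊ - u₋) = c(d₊ + d₋)`. -/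
lemma isCoveredByUnitary_deltaPrime (c : ℝ) :
    IsCoveredByUnitary fun uP uM dP dM => dP = dM ∧ uP - uM = c * dP := by
  obtain ⟨m, hm, h⟩ := exists_cayley 2 c (Or.inl two_ne_zero)
  refine ⟨_, symmetric_mem_unitaryGroup (by simp : conj (1 : ℂ) * 1 = 1) hm, ?_⟩
  intro u v d e
  rw [interfaceCondition_symmetric_iff, h]
  push_cast
  constructor
  · rintro ⟨h1, h2⟩
    have h3 : d = e := by
      have h4 : 2 * Complex.I * (d - e) = 0 := by linear_combination -h1
      have := (mul_eq_zero.1 h4).resolve_left (by simp)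
      linear_combination this
    subst h3
    exact ⟨rfl, by linear_combination h2 / 2⟩
  · rintro ⟨rfl, h2⟩
    exact ⟨by ring, by linear_combination 2 * h2⟩

lemma isCoveredByUnitary_decoupled (a b a' b' : ℝ) (h : a ≠ 0 ∨ b ≠ 0) (h' : a' ≠ 0 ∨ b' ≠ 0) :
    IsCoveredByUnitary fun uP uM dP dM => a * uP = b * dP ∧ a' * uM = b' * dM := by
  obtain ⟨l, hl, hlr⟩ := exists_cayley a b h
  -- The interface condition contains `-d₋`, hence the sign of `b'`.
  obtain ⟨m, hm, hmr⟩ := exists_cayley a' (-b') (by simpa using h')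
  refine ⟨_, diagonal_mem_unitaryGroup hl hm, fun u v d e => ?_⟩
  rw [interfaceCondition_diagonal_iff, hlr, ← mul_neg, hmr]
  push_cast
  rw [neg_mul_neg]

lemma isCoveredByUnitary_dirichlet :
    IsCoveredByUnitary fun uP uM _ _ => uP = 0 ∧ uM = 0 := by
  simpa using isCoveredByUnitary_decoupled 1 0 1 0 (Or.inl one_ne_zero) (Or.inl one_ne_zero)

lemma isCoveredByUnitary_neumann :
    IsCoveredByUnitary fun _ _ dP dM => dP = 0 ∧ dM = 0 := by
  simpa [eq_comm] using
    isCoveredByUnitary_decoupled 0 1 0 1 (Or.inr one_ne_zero) (Or.inr one_ne_zero)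

lemma isCoveredByUnitary_robin (a b : ℝ) :
    IsCoveredByUnitary fun uP uM dP dM => dP = a * uP ∧ dM = b * uM := by
  simpa [eq_comm] using
    isCoveredByUnitary_decoupled a 1 b 1 (Or.inr one_ne_zero) (Or.inr one_ne_zero)

/-! ### The main theorem -/

theorem greenAssumption_pointGreen {φ : ℝ} {α β : ℂ} {J : Matrix (Fin 2) (Fin 2) ℂ}
    (hJ : Represents φ α β J) (T : EReal) :
    GreenAssumption T (fun _ _ => 0) (1 - J) (Complex.I • (1 + J)) (pointGreen φ α β) := by
  obtain ⟨h0, hπ, hab, rfl⟩ := hJ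
  have hP := signInvariant_muP φ α β
  have hM := signInvariant_muM φ α β
  have hO := signInvariant_muZero φ α β
  have hpi := Real.pi_pos
  have hθ : Real.pi / 4 < Real.pi / 2 := by linarith
  -- Any angle strictly between `0` and `π/2` would serve.
  refine ⟨Real.pi / 4, layeredGreen (muP φ α β) (muM φ α β) (muZero φ α β) (omegaP φ α)
    (omegaM φ α), by linarith, hθ, fun t ht x hx => ⟨fun y hy =>
      (pointGreen_eq_layeredGreen φ α β ht.1 x hy).symm, ?_, ?_⟩, fun z hz => ?_,
    fun t ht y hy => ?_, fun x hx => ⟨|x| + 1, by linarith, fun f hf => ?_⟩,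
    exponentialBounds_layeredGreen hP hM hO _ _ T _ _ hθ⟩
  · exact ((differentiableOn_layeredGreen hP hM hO ht.1 hx).mono fun z hz =>
      (sectorAbs_of_mem_doubleSector hθ hz).1).continuousOn
  · exact (differentiableOn_layeredGreen hP hM hO ht.1 hx).mono fun z hz =>
      (sectorAbs_of_mem_doubleSector hθ (interior_subset hz)).1
  · obtain ⟨P₂, Q₂, hG⟩ := exists_gluesFreeSolutions_layeredGreen hP hM hO (omegaP φ α)
      (omegaM φ α) (sectorAbs_of_mem_doubleSector hθ hz).1
    exact ⟨hG.isAC12 T, hG.solvesSchrodinger T⟩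
  · have hy : y ≠ 0 := hy
    obtain ⟨P₂, Q₂, hG⟩ := exists_gluesFreeSolutions_layeredGreen hP hM hO (omegaP φ α)
      (omegaM φ α) (z := (y : ℂ)) (by simpa using hy)
    have hfun : (fun x => pointGreen φ α β t x y) = fun x => layeredGreen (muP φ α β) (muM φ α β)
        (muZero φ α β) (omegaP φ α) (omegaM φ α) t x y :=
      funext fun x => pointGreen_eq_layeredGreen φ α β ht.1 x hy
    rw [hfun]
    refine hG.transmissionCondition ht.1 ?_
    refine BoundaryRelation.congr (interfaceCondition_layer hab h0 hπ hy t) ?_ ?_ ?_ ?_ <;>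
      simp only [sectorAbs_ofReal hy, Complex.ofReal_re, mul_zero, zero_add, one_mul, neg_mul]
  · have hx : x ≠ 0 := hx
    have hb : -(|x| + 1) < |x| + 1 := by linarith [abs_nonneg x]
    obtain ⟨h1, h2⟩ := initialCondition_layeredGreen hP hM hO (κ := omegaP φ α)
      (ν := omegaM φ α) hx (lt_add_one |x|) (C1On.of_contDiffOn hb hf)
    -- The identification with the continuation is available only for `y ≠ 0`, which is enough under
    -- the integral.
    have heq : ∀ t, 0 < t → ∀ᵐ y : ℝ, layeredGreen (muP φ α β) (muM φ α β) (muZero φ α β)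
        (omegaP φ α) (omegaM φ α) t x y * f y = pointGreen φ α β t x y * f y := by
      intro t ht
      filter_upwards [compl_mem_ae_iff.2 (measure_singleton (0 : ℝ))] with y hy
      rw [pointGreen_eq_layeredGreen φ α β ht x hy]
    refine ⟨fun t ht => (h1 t ht.1).congr_ae (ae_restrict_of_ae (heq t ht.1)), ?_⟩
    refine h2.congr' (eventually_mem_nhdsWithin.mono fun t ht => ?_)
    exact intervalIntegral.integral_congr_ae ((heq t ht).mono fun y hy _ => hy)

end PointInteraction

theorem proposition5p3 :
    -- every unitary `J` is parametrised by some `(φ, α, β)`, and for each such parametrisation the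
    -- explicit Green's function satisfies the assumptions with `V = 0`, `M = I - J`, `N = i(I + J)`
    (∀ J ∈ Matrix.unitaryGroup (Fin 2) ℂ,
      (∃ (φ : ℝ) (α β : ℂ), PointInteraction.Represents φ α β J) ∧
      ∀ (φ : ℝ) (α β : ℂ), PointInteraction.Represents φ α β J →
        ∀ T : EReal, 0 < T →
          PointInteraction.GreenAssumption T (fun _ _ => 0) (1 - J) (Complex.I • (1 + J))
            (PointInteraction.pointGreen φ α β)) ∧
    -- `δ`-potentials of strength `c`
    (∀ c : ℝ, PointInteraction.IsCoveredByUnitary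
      fun uP uM dP dM => uP = uM ∧ dP - dM = c * uP) ∧
    -- `δ'`-potentials of strength `c`
    (∀ c : ℝ, PointInteraction.IsCoveredByUnitary
      fun uP uM dP dM => dP = dM ∧ uP - uM = c * dP) ∧
    -- Dirichlet conditions
    (PointInteraction.IsCoveredByUnitary fun uP uM _ _ => uP = 0 ∧ uM = 0) ∧
    -- Neumann conditions
    (PointInteraction.IsCoveredByUnitary fun _ _ dP dM => dP = 0 ∧ dM = 0) ∧
    -- Robin conditions
    (∀ a b : ℝ, PointInteraction.IsCoveredByUnitary
      fun uP uM dP dM => dP = a * uP ∧ dM = b * uM) :=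
  ⟨fun _ hJ => ⟨PointInteraction.exists_represents hJ, fun _ _ _ hR T _ =>
      PointInteraction.greenAssumption_pointGreen hR T⟩,
    PointInteraction.isCoveredByUnitary_delta, PointInteraction.isCoveredByUnitary_deltaPrime,
    PointInteraction.isCoveredByUnitary_dirichlet, PointInteraction.isCoveredByUnitary_neumann,
    PointInteraction.isCoveredByUnitary_robin⟩
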